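/- Let $(K,|\cdot|)$ be a complete ultrametric valued field of mixed characteristic $(0,p)$, and let $$X=\mathrm D^+(c_0,R_0)-\bigcup_{i=1}^{n}\mathrm D^-(c_i,R_i),\qquad c_i\in K,\ R_i>0,\ |c_i-c_0|\le R_0,$$ be a $K$-affinoid with $X(K^{\mathrm{alg}})\neq\emptyset$. Put $r_X=\min(R_0,\dots,R_n)$ and $s_X=\max(|c_0|,R_0)$. Let $\mathcal H_K(X)$ be the completion, for the norm $\|f\|_X=\sup_{x\in X(K^{\mathrm{alg}})}|f(x)|$, of the ring of rational fractions in $K(T)$ without poles in $X(K^{\mathrm{alg}})$. Let $\mathcal Q(X)\subset K^\times$ be the topological group of all $q$ such that $x\mapsto qx$ is a bijection of $X$, and $\mathcal Q_1(X)=\{q\in\mathcal Q(X):|q-1|<1\}$. For $q\in\mathcal Q(X)$ let $\sigma_q(f)(T)=f(qT)$, and let $\delta_1=T\frac{d}{dT}$. For $S\subseteq\mathcal Q(X)$, a (discrete) $\sigma$-module over $S$ is a free $\mathcal H_K(X)$-module $M$ of finite rank with a group morphism $q\mapsto\sigma_q^M$ from the group $\langle S\rangle$ generated by $S$ to $\mathrm{Aut}^{\mathrm{cont}}_K(M)$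 such that $\sigma_q^M(fm)=\sigma_q(f)\sigma_q^M(m)$ for all $q\in S$. A (discrete) $(\sigma,\delta)$-module over $S$ is a $\sigma$-module over $S$ with a connection $\delta_1^M:M\to M$, i.e. an additive map with $\delta_1^M(fm)=\delta_1(f)m+f\delta_1^M(m)$. Morphisms are the $\mathcal H_K(X)$-linear maps that commute with $\sigma_q$ for all $q\in S$ (and with $\delta_1$). In a basis $e$ of $M$ write $\sigma^M_q(e_i)=\sum_j a_{ij}(q,T)e_j$ and $\delta_1^M(e_i)=\sum_j g_{ij}(T)e_j$, and set $A(q,T)=(a_{ij}(q,T))$, $G(T)=(g_{ij}(T))$. For $R\le r_X$ let $\mathcal U_R=\{(x,y)\in X\times X:|x-y|<R\}$. A matrix function $Y(x,y)=\sum_{k\ge0}F_k(y)(x-y)^k$ with $F_k\in M_n(\mathcal H_K(X))$ converges on $\mathcal U_R$ if $\|F_k\|_X\rho^k\to0$ for all $0\le\rho<R$. A $\sigma$-module over a set $S\subseteq\mathcal Q_1(X)$ not consisting only of roots of unity is *Taylor admissible* if there are $r\le R\le r_X$ with $S\subseteq\mathrm D^-(1,r/s_X)$ and a matrix $Y(x,y)$,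 converging on $\mathcal U_R$, with $Y(y,y)=\mathrm{Id}$, which is simultaneously a solution of all the equations $Y(qx,y)=A(q,x)Y(x,y)$, $q\in S$. A $(\sigma,\delta)$-module over a set $S\subseteq\mathcal Q_1(X)$ is *Taylor admissible* if there are $r\le R\le r_X$ with $S\subseteq\mathrm D^-(1,r/s_X)$ such that the Taylor solution $Y_G(x,y)=\sum_{k\ge0}G_{[k]}(y)\frac{(x-y)^k}{k!}$ of the differential equation $\delta_1Y=GY$ (where $G_{[0]}=\mathrm{Id}$, $TG_{[1]}=G$, $G_{[k+1]}=\frac{d}{dT}G_{[k]}+G_{[k]}G_{[1]}$, all in $M_n(\mathcal H_K(X))$) converges on $\mathcal U_R$ and satisfies $Y_G(qx,y)=A(q,x)Y_G(x,y)$ for all $q\in S$. Denote the full subcategories of Taylor admissible objects by $\sigma\text{-}\mathrm{Mod}(\mathcal H_K(X))^{\mathrm{adm}}_S$ and $(\sigma,\delta)\text{-}\mathrm{Mod}(\mathcal H_K(X))^{\mathrm{adm}}_S$; for $S=\{q\}$ write $\sigma_q\text{-}\mathrm{Mod}(\mathcal H_K(X))^{\mathrm{adm}}$ and $(\sigma_q,\delta_q)\text{-}\mathrm{Mod}(\mathcal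 H_K(X))^{\mathrm{adm}}$. **Theorem.** Let $q\in\mathcal Q_1(X)$. 1. If $q$ is not a root of unity, the restriction functor $$\bigcup_U\mathrm{Res}^U_q:\ \bigcup_U\ \sigma\text{-}\mathrm{Mod}(\mathcal H_K(X))^{\mathrm{adm}}_U\longrightarrow\sigma_q\text{-}\mathrm{Mod}(\mathcal H_K(X))^{\mathrm{adm}}$$ is an equivalence of categories. 2. For every $q\in\mathcal Q_1(X)$ (root of unity or not), the restriction functor $$\bigcup_U\mathrm{Res}^U_q:\ \bigcup_U\ (\sigma,\delta)\text{-}\mathrm{Mod}(\mathcal H_K(X))^{\mathrm{adm}}_U\longrightarrow(\sigma_q,\delta_q)\text{-}\mathrm{Mod}(\mathcal H_K(X))^{\mathrm{adm}}$$ is an equivalence of categories. Here $U$ runs over the open neighbourhoods of $q$, and $\bigcup_U$ is the filtered colimit of categories along the restriction functors: its objects are the Taylor admissible modules over some $U$, and a morphism between a module over $U$ and one over $U'$ is an $\mathcal H_K(X)$-linear map that is a morphism over some open neighbourhood $V\subseteq U\cap U'$ of $q$. -/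

import Mathlib

open CategoryTheory Filter Topology

universe u

noncomputable section

namespace QDiff

/-! ## The algebraic closure with its absolute value -/

/-- The unique extension of the absolute value of the complete ultrametric field `K` to its
algebraic closure (the spectral norm). -/
instance algClosureNormedField (K : Type u) [NontriviallyNormedField K] [IsUltrametricDist K]
    [CompleteSpace K] : NormedField (AlgebraicClosure K) :=
  spectralNorm.normedField K (AlgebraicClosure K)

theorem norm_algClosure_add_le {K : Type u} [NontriviallyNormedField K] [IsUltrametricDist K]
    [CompleteSpace K] (x y : AlgebraicClosure K) : ‖x + y‖ ≤ max ‖x‖ ‖y‖ :=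
  isNonarchimedean_spectralNorm x y

theorem norm_algClosure_sub_le {K : Type u} [NontriviallyNormedField K] [IsUltrametricDist K]
    [CompleteSpace K] (x y : AlgebraicClosure K) : ‖x - y‖ ≤ max ‖x‖ ‖y‖ := by
  simpa [sub_eq_add_neg] using norm_algClosure_add_le x (-y)

/-! ## Affinoids and analytic elements -/

/-- A `K`-affinoid `X = D⁺(c₀, R₀) - ⋃ᵢ D⁻(cᵢ, Rᵢ)`, `i = 1, …, numHoles`, with centres in `K`,
positive radii, `cᵢ ∈ D⁺(c₀, R₀)`, and at least one point over the algebraic closure of `K`. -/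
structure Affinoid (K : Type u) [NontriviallyNormedField K] [IsUltrametricDist K]
    [CompleteSpace K] where
  c₀ : K
  R₀ : ℝ
  R₀_pos : 0 < R₀
  numHoles : ℕ
  c : Fin numHoles → K
  R : Fin numHoles → ℝ
  R_pos : ∀ i, 0 < R i
  c_mem : ∀ i, ‖c i - c₀‖ ≤ R₀
  exists_point : ∃ x : AlgebraicClosure K,
    ‖x - algebraMap K (AlgebraicClosure K) c₀‖ ≤ R₀ ∧
      ∀ i, R i ≤ ‖x - algebraMap K (AlgebraicClosure K) (c i)‖

namespace Affinoid

variable {K : Type u} [NontriviallyNormedField K] [IsUltrametricDist K] [CompleteSpace K]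
variable (X : Affinoid K)

/-- The set `X(K^alg)`. -/
def points : Set (AlgebraicClosure K) :=
  {x | ‖x - algebraMap K (AlgebraicClosure K) X.c₀‖ ≤ X.R₀ ∧
    ∀ i, X.R i ≤ ‖x - algebraMap K (AlgebraicClosure K) (X.c i)‖}

/-- `r_X = min(R₀, R₁, …, Rₙ)`. -/
def minRadius : ℝ :=
  (Finset.univ : Finset (Option (Fin X.numHoles))).inf' Finset.univ_nonempty
    (fun i => i.elim X.R₀ X.R)

/-- `max(|c₀|, R₀)`. -/
def maxAbs : ℝ := max ‖X.c₀‖ X.R₀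

/-- The `K`-algebra of rational fractions in `K(T)` without poles in `X(K^alg)`, seen as functions
on `X(K^alg)`. -/
def rational : Subalgebra K (X.points → AlgebraicClosure K) where
  carrier := {f | ∃ P Q : Polynomial K, ∀ x : X.points,
    Polynomial.aeval (x : AlgebraicClosure K) Q ≠ 0 ∧
      f x = Polynomial.aeval (x : AlgebraicClosure K) P /
        Polynomial.aeval (x : AlgebraicClosure K) Q}
  mul_mem' := by
    rintro f g ⟨P, Q, h⟩ ⟨P', Q', h'⟩
    refine ⟨P * P', Q * Q', fun x => ⟨?_, ?_⟩⟩
    · rw [map_mul]; exact mul_ne_zero (h x).1 (h' x).1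
    · rw [Pi.mul_apply, (h x).2, (h' x).2, map_mul, map_mul, div_mul_div_comm]
  add_mem' := by
    rintro f g ⟨P, Q, h⟩ ⟨P', Q', h'⟩
    refine ⟨P * Q' + Q * P', Q * Q', fun x => ⟨?_, ?_⟩⟩
    · rw [map_mul]; exact mul_ne_zero (h x).1 (h' x).1
    · rw [Pi.add_apply, (h x).2, (h' x).2, map_add, map_mul, map_mul, map_mul,
        div_add_div _ _ (h x).1 (h' x).1]
  algebraMap_mem' := by
    intro a
    refine ⟨Polynomial.C a, 1, fun x => ⟨?_, ?_⟩⟩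
    · simp
    · simp

/-- A function on `X(K^alg)` is bounded. -/
def IsBdd (f : X.points → AlgebraicClosure K) : Prop := ∃ C : ℝ, ∀ x, ‖f x‖ ≤ C

theorem IsBdd.mul {X : Affinoid K} {f g : X.points → AlgebraicClosure K} (hf : X.IsBdd f)
    (hg : X.IsBdd g) : X.IsBdd (f * g) := by
  obtain ⟨C, hC⟩ := hf
  obtain ⟨D, hD⟩ := hg
  refine ⟨C * D, fun x => ?_⟩
  rw [Pi.mul_apply, norm_mul]
  exact mul_le_mul (hC x) (hD x) (norm_nonneg _) ((norm_nonneg _).trans (hC x))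

theorem IsBdd.add {X : Affinoid K} {f g : X.points → AlgebraicClosure K} (hf : X.IsBdd f)
    (hg : X.IsBdd g) : X.IsBdd (f + g) := by
  obtain ⟨C, hC⟩ := hf
  obtain ⟨D, hD⟩ := hg
  exact ⟨C + D, fun x => (norm_add_le _ _).trans (add_le_add (hC x) (hD x))⟩

theorem isBdd_const (a : AlgebraicClosure K) : X.IsBdd (fun _ => a) := ⟨‖a‖, fun _ => le_rfl⟩

theorem isBdd_coe : X.IsBdd (fun x => (x : AlgebraicClosure K)) := by
  refine ⟨X.R₀ + ‖algebraMap K (AlgebraicClosure K) X.c₀‖, fun x => ?_⟩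
  have h := norm_add_le ((x : AlgebraicClosure K) - algebraMap K (AlgebraicClosure K) X.c₀)
    (algebraMap K (AlgebraicClosure K) X.c₀)
  rw [sub_add_cancel] at h
  linarith [x.2.1]

theorem isBdd_aeval (P : Polynomial K) :
    X.IsBdd (fun x => Polynomial.aeval (x : AlgebraicClosure K) P) := by
  induction P using Polynomial.induction_on' with
  | add p q hp hq => simpa [Pi.add_def] using hp.add hq
  | monomial n a =>
    simp only [Polynomial.aeval_monomial]
    refine (X.isBdd_const _).mul ?_
    induction n with
    | zero => simpa using X.isBdd_const 1
    | succ n ih => simpa [pow_succ, Pi.mul_def] using ih.mul X.isBdd_coe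

theorem isBdd_inv_sub {a : AlgebraicClosure K} (ha : a ∉ X.points) :
    X.IsBdd (fun x => ((x : AlgebraicClosure K) - a)⁻¹) := by
  suffices h : ∃ r : ℝ, 0 < r ∧ ∀ x : X.points, r ≤ ‖(x : AlgebraicClosure K) - a‖ by
    obtain ⟨r, hr, h⟩ := h
    refine ⟨r⁻¹, fun x => ?_⟩
    rw [norm_inv]
    exact inv_anti₀ hr (h x)
  by_cases h0 : ‖a - algebraMap K (AlgebraicClosure K) X.c₀‖ ≤ X.R₀
  · have : ∃ i, ‖a - algebraMap K (AlgebraicClosure K) (X.c i)‖ < X.R i := by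
      by_contra! hcon
      exact ha ⟨h0, hcon⟩
    obtain ⟨i, hi⟩ := this
    refine ⟨X.R i, X.R_pos i, fun x => ?_⟩
    by_contra! hlt
    have h1 := norm_algClosure_add_le ((x : AlgebraicClosure K) - a)
      (a - algebraMap K (AlgebraicClosure K) (X.c i))
    rw [sub_add_sub_cancel] at h1
    exact absurd (x.2.2 i) (not_le.2 (h1.trans_lt (max_lt hlt hi)))
  · refine ⟨X.R₀, X.R₀_pos, fun x => ?_⟩
    by_contra! hlt
    have h1 := norm_algClosure_sub_le
      ((x : AlgebraicClosure K) - algebraMap K (AlgebraicClosure K) X.c₀)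
      ((x : AlgebraicClosure K) - a)
    rw [sub_sub_sub_cancel_left] at h1
    exact h0 (h1.trans (max_le x.2.1 hlt.le))

theorem isBdd_of_mem_rational {f : X.points → AlgebraicClosure K} (hf : f ∈ X.rational) :
    X.IsBdd f := by
  obtain ⟨P, Q, h⟩ := hf
  have hinv : X.IsBdd (fun x => (Polynomial.aeval (x : AlgebraicClosure K) Q)⁻¹) := by
    have hsp := IsAlgClosed.splits (Q.map (algebraMap K (AlgebraicClosure K)))
    have key : ∀ x : AlgebraicClosure K, Polynomial.aeval x Q =
        algebraMap K (AlgebraicClosure K) Q.leadingCoeff *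
          ((Q.map (algebraMap K (AlgebraicClosure K))).roots.map (fun a => x - a)).prod := by
      intro x
      rw [Polynomial.aeval_def, ← Polynomial.eval_map]
      conv_lhs => rw [hsp.eq_prod_roots]
      simp [Polynomial.eval_multiset_prod, Multiset.map_map]
    have hroots : ∀ a ∈ (Q.map (algebraMap K (AlgebraicClosure K))).roots, a ∉ X.points := by
      intro a ha hmem
      refine (h ⟨a, hmem⟩).1 ?_
      have := Polynomial.isRoot_of_mem_roots ha
      rwa [Polynomial.IsRoot, Polynomial.eval_map, ← Polynomial.aeval_def] at this
    simp only [key, mul_inv]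
    refine (X.isBdd_const _).mul ?_
    generalize (Q.map (algebraMap K (AlgebraicClosure K))).roots = s at hroots
    induction s using Multiset.induction_on with
    | empty => simpa using X.isBdd_const 1
    | cons a s ih =>
      simp only [Multiset.map_cons, Multiset.prod_cons, mul_inv]
      exact (X.isBdd_inv_sub (hroots a (Multiset.mem_cons_self a s))).mul
        (ih fun b hb => hroots b (Multiset.mem_cons_of_mem hb))
  have : f = (fun x : X.points => Polynomial.aeval (x : AlgebraicClosure K) P) *
      (fun x : X.points => (Polynomial.aeval (x : AlgebraicClosure K) Q)⁻¹) := by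
    funext x
    rw [(h x).2, div_eq_mul_inv, Pi.mul_apply]
  rw [this]
  exact (X.isBdd_aeval P).mul hinv

/-- The ring `ℋ_K(X)` of analytic elements: the completion of the ring of rational fractions
without poles in `X(K^alg)` for the norm `‖f‖_X = sup_{x ∈ X(K^alg)} |f(x)|`. Since
each residue field `K(x)`, `x ∈ K^alg`, is complete, this completion is the ring of all uniform
limits, as functions `X(K^alg) → K^alg`, of such rational fractions. -/
def analytic : Subalgebra K (X.points → AlgebraicClosure K) where
  carrier := {f | ∀ ε : ℝ, 0 < ε → ∃ g ∈ X.rational, ∀ x, ‖f x - g x‖ < ε}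
  mul_mem' := by
    intro f f' hf hf' ε hε
    obtain ⟨g₁, hg₁, h₁⟩ := hf' 1 one_pos
    obtain ⟨C, hC⟩ := X.isBdd_of_mem_rational hg₁
    have hf'C : ∀ x, ‖f' x‖ ≤ |C| + 1 := fun x => by
      have h := norm_add_le (f' x - g₁ x) (g₁ x)
      rw [sub_add_cancel] at h
      linarith [h₁ x, hC x, le_abs_self C]
    have hpos : 0 < |C| + 1 := by positivity
    obtain ⟨g, hg, h⟩ := hf (ε / (2 * (|C| + 1))) (by positivity)
    obtain ⟨D, hD⟩ := X.isBdd_of_mem_rational hg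
    obtain ⟨g', hg', h'⟩ := hf' (ε / (2 * (|D| + 1))) (by positivity)
    refine ⟨g * g', X.rational.mul_mem hg hg', fun x => ?_⟩
    have e : (f * f') x - (g * g') x = (f x - g x) * f' x + g x * (f' x - g' x) := by
      simp only [Pi.mul_apply]; ring
    rw [e]
    refine (norm_add_le _ _).trans_lt ?_
    rw [norm_mul, norm_mul]
    have a1 : ‖f x - g x‖ * ‖f' x‖ < ε / (2 * (|C| + 1)) * (|C| + 1) :=
      (mul_le_mul_of_nonneg_left (hf'C x) (norm_nonneg _)).trans_lt
        (mul_lt_mul_of_pos_right (h x) hpos)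
    have a2 : ‖g x‖ * ‖f' x - g' x‖ ≤ (|D| + 1) * (ε / (2 * (|D| + 1))) :=
      mul_le_mul (by linarith [hD x, le_abs_self D]) (h' x).le (norm_nonneg _) (by positivity)
    have b1 : ε / (2 * (|C| + 1)) * (|C| + 1) = ε / 2 := by field_simp
    have b2 : (|D| + 1) * (ε / (2 * (|D| + 1))) = ε / 2 := by field_simp
    linarith
  add_mem' := by
    intro f f' hf hf' ε hε
    obtain ⟨g, hg, h⟩ := hf (ε / 2) (half_pos hε)
    obtain ⟨g', hg', h'⟩ := hf' (ε / 2) (half_pos hε)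
    refine ⟨g + g', X.rational.add_mem hg hg', fun x => ?_⟩
    have e : (f + f') x - (g + g') x = (f x - g x) + (f' x - g' x) := by
      simp only [Pi.add_apply]; ring
    rw [e]
    exact (norm_add_le _ _).trans_lt (by linarith [h x, h' x])
  algebraMap_mem' := by
    intro a ε hε
    exact ⟨_, X.rational.algebraMap_mem a, fun x => by simpa using hε⟩

/-- The underlying type of the ring `ℋ_K(X)`. -/
abbrev H : Type u := X.analytic

/-- `‖f‖_X = sup_{x ∈ X(K^alg)} |f(x)|`. -/
def supNorm (f : X.H) : ℝ := ⨆ x : X.points, ‖f.1 x‖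

/-- The coordinate function `T ∈ ℋ_K(X)`. -/
def T : X.H :=
  ⟨fun x => (x : AlgebraicClosure K), fun ε hε =>
    ⟨_, ⟨Polynomial.X, 1, fun x => ⟨by simp, rfl⟩⟩, fun x => by simpa using hε⟩⟩

/-- `g = df/dT`: at each point of `X(K^alg)` the value of `g` is the limit of the difference
quotients of `f`. -/
def IsDeriv (f g : X.H) : Prop :=
  ∀ x : X.points, Tendsto
    (fun z : X.points => (f.1 z - f.1 x) / ((z : AlgebraicClosure K) - (x : AlgebraicClosure K)))
    (𝓝[≠] x) (𝓝 (g.1 x))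

/-! ## The group `𝒬(X)` -/

/-- The group `𝒬(X)` of all `q ∈ K^×` such that `x ↦ q x` is a bijection of `X`, as a subgroup of
the topological group `K^×`. -/
def Q : Subgroup Kˣ where
  carrier := {q | ∀ x : AlgebraicClosure K,
    algebraMap K (AlgebraicClosure K) (q : K) * x ∈ X.points ↔ x ∈ X.points}
  mul_mem' := by
    intro a b ha hb x
    rw [Units.val_mul, map_mul, mul_assoc, ha, hb]
  one_mem' := by
    intro x
    simp
  inv_mem' := by
    intro a ha x
    rw [← ha, ← mul_assoc, ← map_mul, Units.mul_inv, map_one, one_mul]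

/-- `𝒬₁(X) = 𝒬(X) ∩ D⁻(1, 1)`. -/
def Q₁ : Set X.Q := {q | ‖((q : Kˣ) : K) - 1‖ < 1}

/-- The action `x ↦ q x` of `q ∈ 𝒬(X)` on `X(K^alg)`. -/
def dilate (q : X.Q) (x : X.points) : X.points :=
  ⟨algebraMap K (AlgebraicClosure K) ((q : Kˣ) : K) * x, (q.2 x).2 x.2⟩

theorem comp_dilate_mem_rational (q : X.Q) {f : X.points → AlgebraicClosure K}
    (hf : f ∈ X.rational) : (fun x => f (X.dilate q x)) ∈ X.rational := by
  obtain ⟨P, R, h⟩ := hf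
  refine ⟨P.comp (Polynomial.C ((q : Kˣ) : K) * Polynomial.X),
    R.comp (Polynomial.C ((q : Kˣ) : K) * Polynomial.X), fun x => ?_⟩
  have hx := h (X.dilate q x)
  simpa [Polynomial.aeval_comp, dilate] using hx

/-- The ring endomorphism `σ_q : f(T) ↦ f(qT)` of `ℋ_K(X)`, for `q ∈ 𝒬(X)`. -/
def dil (q : X.Q) : X.H →+* X.H where
  toFun f := ⟨fun x => f.1 (X.dilate q x), fun ε hε => by
    obtain ⟨g, hg, h⟩ := f.2 ε hε
    exact ⟨_, X.comp_dilate_mem_rational q hg, fun x => h (X.dilate q x)⟩⟩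
  map_one' := rfl
  map_mul' _ _ := rfl
  map_zero' := rfl
  map_add' _ _ := rfl

end Affinoid

/-! ## Discrete `σ`-modules and `(σ, δ)`-modules -/

section Modules

variable {K : Type u} [NontriviallyNormedField K] [IsUltrametricDist K] [CompleteSpace K]

/-- A discrete `σ`-module over `S ⊆ 𝒬(X)`: a free `ℋ_K(X)`-module `M` of finite rank with a
group morphism `σ^M` from the subgroup `⟨S⟩` generated by `S` to the group of `K`-linear
automorphisms of `M`, such that `σ^M_q` is `σ_q`-semilinear for all `q ∈ S`. (Such maps are
continuous for the product topology of `M`, because `σ_q` is an isometry of `ℋ_K(X)`.) The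
`K`-module structure is the one induced by the `ℋ_K(X)`-module structure. -/
structure SigmaModule (X : Affinoid K) (S : Set X.Q) where
  carrier : Type u
  [addCommGroup : AddCommGroup carrier]
  [module : Module X.H carrier]
  [moduleK : Module K carrier]
  [isScalarTower : IsScalarTower K X.H carrier]
  [free : Module.Free X.H carrier]
  [finite : Module.Finite X.H carrier]
  sigma : Subgroup.closure S →* (carrier ≃ₗ[K] carrier)
  semilinear : ∀ (q : X.Q) (hq : q ∈ S) (f : X.H) (m : carrier),
    sigma ⟨q, Subgroup.subset_closure hq⟩ (f • m) =
      X.dil q f • sigma ⟨q, Subgroup.subset_closure hq⟩ m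

attribute [instance] SigmaModule.addCommGroup SigmaModule.module SigmaModule.moduleK
  SigmaModule.isScalarTower SigmaModule.free SigmaModule.finite

/-- A discrete `(σ, δ)`-module over `S ⊆ 𝒬(X)`: a discrete `σ`-module with a connection
`δ₁^M : M → M`, i.e. an additive map with `δ₁^M(f m) = δ₁(f) m + f δ₁^M(m)`,
where `δ₁ = T d/dT`. -/
structure SigmaDeltaModule (X : Affinoid K) (S : Set X.Q) extends SigmaModule X S where
  delta : carrier →+ carrier
  leibniz : ∀ (f f' : X.H), X.IsDeriv f f' → ∀ m : carrier,
    delta (f • m) = (X.T * f') • m + f • delta m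

variable {X : Affinoid K}

namespace SigmaModule

variable {S : Set X.Q}

/-- The operator `σ^M_q`, for `q ∈ S`. -/
def op (M : SigmaModule X S) (q : X.Q) (hq : q ∈ S) : M.carrier ≃ₗ[K] M.carrier :=
  M.sigma ⟨q, Subgroup.subset_closure hq⟩

/-- Morphisms of discrete `σ`-modules over `S`: the `ℋ_K(X)`-linear maps commuting
with `σ_q` for all `q ∈ S`. -/
@[ext]
structure Hom (M N : SigmaModule X S) where
  lin : M.carrier →ₗ[X.H] N.carrier
  comm : ∀ (q : X.Q) (hq : q ∈ S) (m : M.carrier), lin (M.op q hq m) = N.op q hq (lin m)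

instance : Category (SigmaModule X S) where
  Hom := Hom
  id M := ⟨LinearMap.id, fun _ _ _ => rfl⟩
  comp f g := ⟨g.lin ∘ₗ f.lin, fun q hq m => by
    simp only [LinearMap.comp_apply]; rw [f.comm, g.comm]⟩

/-- Restriction from `S` to a subset `S'`. -/
def restrict {S' : Set X.Q} (M : SigmaModule X S) (h : S' ⊆ S) : SigmaModule X S' where
  carrier := M.carrier
  sigma := M.sigma.comp (Subgroup.inclusion (Subgroup.closure_mono h))
  semilinear q hq := M.semilinear q (h hq)

/-- The matrix `A(q, T)` of `σ^M_q` in a basis `e`: `σ^M_q(eᵢ) = ∑ⱼ aᵢⱼ(q, T) eⱼ`. -/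
def matrix (M : SigmaModule X S) {n : ℕ} (e : Module.Basis (Fin n) X.H M.carrier) (q : X.Q)
    (hq : q ∈ S) : Matrix (Fin n) (Fin n) X.H :=
  fun i j => e.repr (M.op q hq (e i)) j

end SigmaModule

namespace SigmaDeltaModule

variable {S : Set X.Q}

/-- Morphisms of discrete `(σ, δ)`-modules over `S`: the morphisms of `σ`-modules commuting with
the connections. -/
@[ext]
structure Hom (M N : SigmaDeltaModule X S) where
  lin : M.carrier →ₗ[X.H] N.carrier
  comm : ∀ (q : X.Q) (hq : q ∈ S) (m : M.carrier), lin (M.op q hq m) = N.op q hq (lin m)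
  comm_delta : ∀ m : M.carrier, lin (M.delta m) = N.delta (lin m)

instance : Category (SigmaDeltaModule X S) where
  Hom := Hom
  id M := ⟨LinearMap.id, fun _ _ _ => rfl, fun _ => rfl⟩
  comp f g := ⟨g.lin ∘ₗ f.lin,
    fun q hq m => by simp only [LinearMap.comp_apply]; rw [f.comm, g.comm],
    fun m => by simp only [LinearMap.comp_apply]; rw [f.comm_delta, g.comm_delta]⟩

/-- Restriction from `S` to a subset `S'`. -/
def restrict {S' : Set X.Q} (M : SigmaDeltaModule X S) (h : S' ⊆ S) : SigmaDeltaModule X S' where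
  toSigmaModule := M.toSigmaModule.restrict h
  delta := M.delta
  leibniz := M.leibniz

/-- The matrix `G(1, T)` of `δ₁^M` in a basis `e`: `δ₁^M(eᵢ) = ∑ⱼ gᵢⱼ(1, T) eⱼ`. -/
def deltaMatrix (M : SigmaDeltaModule X S) {n : ℕ} (e : Module.Basis (Fin n) X.H M.carrier) :
    Matrix (Fin n) (Fin n) X.H :=
  fun i j => e.repr (M.delta (e i)) j

end SigmaDeltaModule

end Modules

/-! ## Functions near the diagonal and Taylor admissibility -/

section Taylor

variable {K : Type u} [NontriviallyNormedField K] [IsUltrametricDist K] [CompleteSpace K]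
variable {X : Affinoid K} {n : ℕ}

/-- The matrix function `Y(x, y) = ∑ₖ Fₖ(y) (x - y)ᵏ`, with coefficients `Fₖ ∈ Mₙ(ℋ_K(X))`,
converges on `𝒰_R = {(x, y) ∈ X × X : |x - y| < R}`: for all `0 ≤ ρ < R`
one has `‖Fₖ‖_X ρᵏ → 0`. -/
def ConvergesOn (F : ℕ → Matrix (Fin n) (Fin n) X.H) (R : ℝ) : Prop :=
  ∀ (i j : Fin n) (ρ : ℝ), 0 ≤ ρ → ρ < R →
    Tendsto (fun k : ℕ => X.supNorm (F k i j) * ρ ^ k) atTop (𝓝 0)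

/-- The value `Y(x, y) = ∑ₖ Fₖ(y) (x - y)ᵏ`. -/
def evalNearDiag (F : ℕ → Matrix (Fin n) (Fin n) X.H) (x y : X.points) :
    Matrix (Fin n) (Fin n) (AlgebraicClosure K) :=
  fun i j => ∑' k : ℕ, (F k i j).1 y * ((x : AlgebraicClosure K) - (y : AlgebraicClosure K)) ^ k

/-- The value at `x ∈ X(K^alg)` of a matrix with entries in `ℋ_K(X)`. -/
def evalMatrix (A : Matrix (Fin n) (Fin n) X.H) (x : X.points) :
    Matrix (Fin n) (Fin n) (AlgebraicClosure K) :=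
  fun i j => (A i j).1 x

/-- `Y(x, y) = ∑ₖ Fₖ(y) (x - y)ᵏ` satisfies `Y(q x, y) = A(x) Y(x, y)` on `𝒰_R`. -/
def SolvesSigma (F : ℕ → Matrix (Fin n) (Fin n) X.H) (R : ℝ) (q : X.Q)
    (A : Matrix (Fin n) (Fin n) X.H) : Prop :=
  ∀ x y : X.points, ‖(x : AlgebraicClosure K) - (y : AlgebraicClosure K)‖ < R →
    evalNearDiag F (X.dilate q x) y = evalMatrix A x * evalNearDiag F x y

/-- `F` is the sequence of coefficients `Fₖ = G_[k] / k!` of the Taylor solution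
`Y_G(x, y) = ∑ₖ G_[k](y) (x - y)ᵏ / k!` of the differential equation `δ₁ Y = G Y`, where `G_[k]` is
the matrix of `(d/dT)ᵏ`: one has `G_[0] = 1`, `T G_[1] = G` and
`G_[k+1] = dG_[k]/dT + G_[k] G_[1]`. -/
def IsTaylorSolution (G : Matrix (Fin n) (Fin n) X.H) (F : ℕ → Matrix (Fin n) (Fin n) X.H) :
    Prop :=
  ∃ D : ℕ → Matrix (Fin n) (Fin n) X.H, D 0 = 1 ∧ X.T • D 1 = G ∧
    (∀ k i j, X.IsDeriv (D k i j) ((D (k + 1) - D k * D 1) i j)) ∧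
    ∀ k, F k = ((k.factorial : K)⁻¹) • D k

/-- A discrete `σ`-module over `S ⊆ 𝒬₁(X)` (with `S` not contained in the set of
roots of unity) is Taylor admissible, with generic radius greater than `r`: one has
`S ⊆ D⁻(1, r / max(|c₀|, R₀))`, and there are `R` with `r ≤ R ≤ r_X` and a matrix `Y(x, y)`
converging on `𝒰_R`, normalised by `Y(y, y) = 1`, which is simultaneously solution of all the
equations `Y(q x, y) = A(q, x) Y(x, y)`, `q ∈ S`. (So `Y` is the `q`-Taylor solution for each
`q ∈ S` that is not a root of unity.) -/
def SigmaModule.IsTaylorAdmissibleWith {S : Set X.Q} (M : SigmaModule X S) (r : ℝ) : Prop :=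
  S ⊆ X.Q₁ ∧ (∃ q ∈ S, ¬ IsOfFinOrder q) ∧
  (∀ q ∈ S, ‖((q : Kˣ) : K) - 1‖ < r / X.maxAbs) ∧
  ∃ (R : ℝ) (n : ℕ) (e : Module.Basis (Fin n) X.H M.carrier)
    (F : ℕ → Matrix (Fin n) (Fin n) X.H),
    r ≤ R ∧ R ≤ X.minRadius ∧ ConvergesOn F R ∧ F 0 = 1 ∧
      ∀ (q : X.Q) (hq : q ∈ S), SolvesSigma F R q (M.matrix e q hq)

/-- A discrete `(σ, δ)`-module over `S ⊆ 𝒬₁(X)` is Taylor admissible, with generic radius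
greater than `r`: one has `S ⊆ D⁻(1, r / max(|c₀|, R₀))`, and there is `R` with `r ≤ R ≤ r_X`
such that the Taylor solution of the differential equation defined by `δ₁^M` converges
on `𝒰_R` and is simultaneously solution of all the equations defined by `σ^M_q`, `q ∈ S`. -/
def SigmaDeltaModule.IsTaylorAdmissibleWith {S : Set X.Q} (M : SigmaDeltaModule X S) (r : ℝ) :
    Prop :=
  S ⊆ X.Q₁ ∧
  (∀ q ∈ S, ‖((q : Kˣ) : K) - 1‖ < r / X.maxAbs) ∧
  ∃ (R : ℝ) (n : ℕ) (e : Module.Basis (Fin n) X.H M.carrier)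
    (F : ℕ → Matrix (Fin n) (Fin n) X.H),
    r ≤ R ∧ R ≤ X.minRadius ∧ IsTaylorSolution (M.deltaMatrix e) F ∧ ConvergesOn F R ∧
      ∀ (q : X.Q) (hq : q ∈ S), SolvesSigma F R q (M.matrix e q hq)

/-- Taylor admissible `σ`-modules over `S`: for some `r ≤ r_X`. -/
def SigmaModule.isTaylorAdmissible (X : Affinoid K) (S : Set X.Q) :
    ObjectProperty (SigmaModule X S) :=
  fun M => ∃ r ≤ X.minRadius, M.IsTaylorAdmissibleWith r

/-- Taylor admissible `(σ, δ)`-modules over `S`: for some `r ≤ r_X`. -/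
def SigmaDeltaModule.isTaylorAdmissible (X : Affinoid K) (S : Set X.Q) :
    ObjectProperty (SigmaDeltaModule X S) :=
  fun M => ∃ r ≤ X.minRadius, M.IsTaylorAdmissibleWith r

/-- The category `σ-Mod(ℋ_K(X))_S^adm`. -/
abbrev SigmaAdm (X : Affinoid K) (S : Set X.Q) : Type _ :=
  (SigmaModule.isTaylorAdmissible X S).FullSubcategory

/-- The category `(σ, δ)-Mod(ℋ_K(X))_S^adm`. -/
abbrev SigmaDeltaAdm (X : Affinoid K) (S : Set X.Q) : Type _ :=
  (SigmaDeltaModule.isTaylorAdmissible X S).FullSubcategory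

theorem SigmaModule.isTaylorAdmissible_restrict {S S' : Set X.Q} (h : S' ⊆ S)
    (hS' : ∃ q ∈ S', ¬ IsOfFinOrder q) {M : SigmaModule X S}
    (hM : SigmaModule.isTaylorAdmissible X S M) :
    SigmaModule.isTaylorAdmissible X S' (M.restrict h) := by
  obtain ⟨r, hr, h1, -, h2, R, n, e, F, a, b, c, d, hF⟩ := hM
  exact ⟨r, hr, h.trans h1, hS', fun q hq => h2 q (h hq), R, n, e, F, a, b, c, d,
    fun q hq => hF q (h hq)⟩

theorem SigmaDeltaModule.isTaylorAdmissible_restrict {S S' : Set X.Q} (h : S' ⊆ S)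
    {M : SigmaDeltaModule X S} (hM : SigmaDeltaModule.isTaylorAdmissible X S M) :
    SigmaDeltaModule.isTaylorAdmissible X S' (M.restrict h) := by
  obtain ⟨r, hr, h1, h2, R, n, e, F, a, b, c, d, hF⟩ := hM
  exact ⟨r, hr, h.trans h1, fun q hq => h2 q (h hq), R, n, e, F, a, b, c, d,
    fun q hq => hF q (h hq)⟩

end Taylor

/-! ## The union of the categories over the open neighbourhoods of `q` -/

section Stalk

variable {K : Type u} [NontriviallyNormedField K] [IsUltrametricDist K] [CompleteSpace K]

/-- The union (filtered colimit along the restriction functors) of the categories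
`σ-Mod(ℋ_K(X))_U^adm`, where `U` runs over the open neighbourhoods of `q` in `𝒬(X)`. Its objects
are the Taylor admissible `σ`-modules over some `U`. -/
structure SigmaStalk (X : Affinoid K) (q : X.Q) where
  U : Set X.Q
  isOpen : IsOpen U
  mem : q ∈ U
  M : SigmaAdm X U

/-- The union (filtered colimit along the restriction functors) of the categories
`(σ, δ)-Mod(ℋ_K(X))_U^adm`, where `U` runs over the open neighbourhoods of `q` in `𝒬(X)`. -/
structure SigmaDeltaStalk (X : Affinoid K) (q : X.Q) where
  U : Set X.Q
  isOpen : IsOpen U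
  mem : q ∈ U
  M : SigmaDeltaAdm X U

variable {X : Affinoid K} {q : X.Q}

/-- A morphism of `⋃_U σ-Mod(ℋ_K(X))_U^adm` is a linear map which is a morphism of `σ`-modules over
some open neighbourhood `V` of `q` on which both modules are defined. -/
@[ext]
structure SigmaStalk.Hom (A B : SigmaStalk X q) where
  lin : A.M.obj.carrier →ₗ[X.H] B.M.obj.carrier
  comm : ∃ (V : Set X.Q) (hA : V ⊆ A.U) (hB : V ⊆ B.U), IsOpen V ∧ q ∈ V ∧
    ∀ (q' : X.Q) (h : q' ∈ V) (m : A.M.obj.carrier),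
      lin (A.M.obj.op q' (hA h) m) = B.M.obj.op q' (hB h) (lin m)

/-- A morphism of `⋃_U (σ, δ)-Mod(ℋ_K(X))_U^adm` is a linear map which is a morphism of
`(σ, δ)`-modules over some open neighbourhood `V` of `q` on which both modules are defined. -/
@[ext]
structure SigmaDeltaStalk.Hom (A B : SigmaDeltaStalk X q) where
  lin : A.M.obj.carrier →ₗ[X.H] B.M.obj.carrier
  comm : ∃ (V : Set X.Q) (hA : V ⊆ A.U) (hB : V ⊆ B.U), IsOpen V ∧ q ∈ V ∧
    ∀ (q' : X.Q) (h : q' ∈ V) (m : A.M.obj.carrier),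
      lin (A.M.obj.op q' (hA h) m) = B.M.obj.op q' (hB h) (lin m)
  comm_delta : ∀ m : A.M.obj.carrier, lin (A.M.obj.delta m) = B.M.obj.delta (lin m)

instance : Category (SigmaStalk X q) where
  Hom := SigmaStalk.Hom
  id A := ⟨LinearMap.id, A.U, subset_rfl, subset_rfl, A.isOpen, A.mem, fun _ _ _ => rfl⟩
  comp {A B C} f g := ⟨g.lin ∘ₗ f.lin, by
    obtain ⟨V, hA, hB, hV, hq, h⟩ := f.comm
    obtain ⟨V', hB', hC, hV', hq', h'⟩ := g.comm
    refine ⟨V ∩ V', fun _ hx => hA hx.1, fun _ hx => hC hx.2, hV.inter hV', ⟨hq, hq'⟩,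
      fun q' hx m => ?_⟩
    simp only [LinearMap.comp_apply]
    rw [h q' hx.1, h' q' hx.2]⟩

instance : Category (SigmaDeltaStalk X q) where
  Hom := SigmaDeltaStalk.Hom
  id A := ⟨LinearMap.id, ⟨A.U, subset_rfl, subset_rfl, A.isOpen, A.mem, fun _ _ _ => rfl⟩,
    fun _ => rfl⟩
  comp {A B C} f g := ⟨g.lin ∘ₗ f.lin, by
    obtain ⟨V, hA, hB, hV, hq, h⟩ := f.comm
    obtain ⟨V', hB', hC, hV', hq', h'⟩ := g.comm
    refine ⟨V ∩ V', fun _ hx => hA hx.1, fun _ hx => hC hx.2, hV.inter hV', ⟨hq, hq'⟩,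
      fun q' hx m => ?_⟩
    simp only [LinearMap.comp_apply]
    rw [h q' hx.1, h' q' hx.2], fun m => by
      simp only [LinearMap.comp_apply]
      rw [f.comm_delta, g.comm_delta]⟩

/-- The restriction functor
`⋃_U Res^U_q : ⋃_U σ-Mod(ℋ_K(X))_U^adm ⥤ σ_q-Mod(ℋ_K(X))^adm`, `q` not a root of unity. -/
def sigmaRes (X : Affinoid K) (q : X.Q) (hq : ¬ IsOfFinOrder q) :
    SigmaStalk X q ⥤ SigmaAdm X {q} where
  obj A := ⟨A.M.obj.restrict (Set.singleton_subset_iff.2 A.mem),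
    SigmaModule.isTaylorAdmissible_restrict _ ⟨q, Set.mem_singleton q, hq⟩ A.M.property⟩
  map {A B} f := ObjectProperty.homMk ⟨f.lin, by
    obtain ⟨V, hA, hB, hV, hqV, h⟩ := f.comm
    intro q' hq' m
    obtain rfl : q' = q := hq'
    exact h q' hqV m⟩

/-- The restriction functor
`⋃_U Res^U_q : ⋃_U (σ, δ)-Mod(ℋ_K(X))_U^adm ⥤ (σ_q, δ_q)-Mod(ℋ_K(X))^adm`. -/
def sigmaDeltaRes (X : Affinoid K) (q : X.Q) :
    SigmaDeltaStalk X q ⥤ SigmaDeltaAdm X {q} where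
  obj A := ⟨A.M.obj.restrict (Set.singleton_subset_iff.2 A.mem),
    SigmaDeltaModule.isTaylorAdmissible_restrict _ A.M.property⟩
  map {A B} f := ObjectProperty.homMk ⟨f.lin, by
    obtain ⟨V, hA, hB, hV, hqV, h⟩ := f.comm
    intro q' hq' m
    obtain rfl : q' = q := hq'
    exact h q' hqV m, f.comm_delta⟩

end Stalk

end QDiff

end

/-! Restriction does not change the underlying linear map, so faithfulness is immediate. The rest
follows from the solution Y(x,y), which knows much more than the single operator σ_q.

Essential surjectivity. Setting y = x in Y(qx,y) = A(q,x)Y(x,y) gives A(q,x) = Y(qx,x), and the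
right-hand side makes sense for every q' in 𝒬(X) with |q' - 1| < R/s_X. Since |q'x - x| is bounded
on X by a constant < R, it is an analytic element of x (`evalNearDiag_dilate_mem_analytic`). That
these matrices define a group action is the cocycle relation Y(x,z) = Y(x,y)Y(y,z). In the σ case
(`IsCocycle.of_solvesSigma`), iterating the functional equation proves the relation at x = q^m y.
For y ≠ 0 and q not a root of unity, the points q^(p^N) y are distinct from y and tend to y, so the
identity theorem for power series in x - y gives it everywhere. In the δ case
(`IsCocycle.of_isTaylorSolution`), the k-th derivative of Y(·,z) at y is G_[k](y)Y(y,z), so the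
expansion at y of Y(·,z) is Y(·,y)Y(y,z). No orbit is involved, so q may be a root of unity.

Fullness. If P is the matrix of a morphism from a module with solution Y to one with solution Y',
then P(x)Y'(x,y) = Y(x,y)P(y) near the diagonal. The argument is again by orbits
(`Intertwines.of_solvesSigma`) or by derivatives (`Intertwines.of_isTaylorSolution`). Taking x = q'y
yields commutation with every σ_q' on the intersection of the two neighbourhoods
(`Intertwines.comm`).

Two analytic inputs are needed. K^alg is not complete in general, so series are handled in its
completion; their sums return to K^alg because finite extensions of K are closed there
(`isClosed_image_adjoin`). Analytic elements have Taylor series of radius r_X at each point of X,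
and their derivatives are analytic (`exists_hasTaylor`, `exists_isDeriv`). Both rest on Cauchy's
estimates, proved by averaging over roots of unity of order prime to p. The point 0, fixed by all
dilations and a zero of T, is recovered by `eq_zero_of_apply_eq_zero`. -/

noncomputable section

namespace QDiff

/-! ## Convergent power series over a complete ultrametric field -/

section PowerSeries

open PowerSeries

variable {E : Type*} [NormedField E]

/-- The power series `∑ₖ cₖ tᵏ` converges on the open disk of radius `R`: the sequence `|cₖ| ρᵏ` is
bounded for all `0 < ρ < R`. -/
def IsConv (R : ℝ) (φ : PowerSeries E) : Prop :=
  ∀ ρ : ℝ, 0 < ρ → ρ < R → ∃ B : ℝ, ∀ k, ‖coeff k φ‖ * ρ ^ k ≤ B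

/-- The sum of a power series at a point. -/
def evalPS (φ : PowerSeries E) (t : E) : E := ∑' k, coeff k φ * t ^ k

theorem IsConv.mono {R R' : ℝ} {φ : PowerSeries E} (h : IsConv R φ) (hR : R' ≤ R) :
    IsConv R' φ := fun ρ h0 h1 => h ρ h0 (h1.trans_le hR)

theorem isConv_C (R : ℝ) (a : E) : IsConv R (C a) := by
  refine fun ρ h0 _ => ⟨‖a‖, fun k => ?_⟩
  rw [coeff_C]
  split_ifs with h
  · simp [h]
  · simp

theorem isConv_X (R : ℝ) : IsConv R (X : PowerSeries E) := by
  refine fun ρ h0 _ => ⟨ρ, fun k => ?_⟩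
  rw [coeff_X]
  split_ifs with h
  · simp [h]
  · simp [h0.le]

theorem IsConv.add {R : ℝ} {φ ψ : PowerSeries E} (hφ : IsConv R φ) (hψ : IsConv R ψ) :
    IsConv R (φ + ψ) := by
  intro ρ h0 h1
  obtain ⟨A, hA⟩ := hφ ρ h0 h1
  obtain ⟨B, hB⟩ := hψ ρ h0 h1
  refine ⟨A + B, fun k => ?_⟩
  rw [map_add]
  have := mul_le_mul_of_nonneg_right (norm_add_le (coeff k φ) (coeff k ψ)) (pow_nonneg h0.le k)
  linarith [hA k, hB k]

theorem IsConv.sum {R : ℝ} {ι : Type*} (s : Finset ι) {φ : ι → PowerSeries E}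
    (h : ∀ i ∈ s, IsConv R (φ i)) : IsConv R (∑ i ∈ s, φ i) := by
  classical
  induction s using Finset.induction_on with
  | empty => simpa using isConv_C R (0 : E)
  | insert a s ha ih =>
    rw [Finset.sum_insert ha]
    exact (h a (Finset.mem_insert_self a s)).add (ih fun i hi => h i (Finset.mem_insert_of_mem hi))

theorem IsConv.exists_bound {R : ℝ} {φ : PowerSeries E} (h : IsConv R φ) {t : E} (ht : ‖t‖ < R) :
    ∃ ρ B : ℝ, 0 < ρ ∧ ‖t‖ < ρ ∧ ρ < R ∧ 0 ≤ B ∧ ∀ k, ‖coeff k φ‖ ≤ B / ρ ^ k := by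
  obtain ⟨ρ, h1, h2⟩ := exists_between ht
  have h0 : 0 < ρ := (norm_nonneg t).trans_lt h1
  obtain ⟨B, hB⟩ := h ρ h0 h2
  refine ⟨ρ, B, h0, h1, h2, (by positivity : (0:ℝ) ≤ ‖coeff 0 φ‖ * ρ ^ 0).trans (hB 0), fun k => ?_⟩
  rw [le_div_iff₀ (pow_pos h0 k)]
  exact hB k

theorem IsConv.summable_norm {R : ℝ} {φ : PowerSeries E} (h : IsConv R φ) {t : E} (ht : ‖t‖ < R) :
    Summable fun k => ‖coeff k φ * t ^ k‖ := by
  obtain ⟨ρ, B, h0, h1, h2, hB0, hB⟩ := h.exists_bound ht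
  refine Summable.of_nonneg_of_le (fun _ => norm_nonneg _) (fun k => ?_)
    ((summable_geometric_of_lt_one (div_nonneg (norm_nonneg t) h0.le)
      ((div_lt_one h0).2 h1)).mul_left B)
  rw [norm_mul, norm_pow, div_pow]
  calc ‖coeff k φ‖ * ‖t‖ ^ k ≤ B / ρ ^ k * ‖t‖ ^ k := by gcongr; exact hB k
    _ = B * (‖t‖ ^ k / ρ ^ k) := by ring

section Complete

variable [CompleteSpace E]

theorem IsConv.summable {R : ℝ} {φ : PowerSeries E} (h : IsConv R φ) {t : E} (ht : ‖t‖ < R) :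
    Summable fun k => coeff k φ * t ^ k := (h.summable_norm ht).of_norm

theorem IsConv.hasSum {R : ℝ} {φ : PowerSeries E} (h : IsConv R φ) {t : E} (ht : ‖t‖ < R) :
    HasSum (fun k => coeff k φ * t ^ k) (evalPS φ t) := (h.summable ht).hasSum

theorem evalPS_add {R : ℝ} {φ ψ : PowerSeries E} (hφ : IsConv R φ) (hψ : IsConv R ψ) {t : E}
    (ht : ‖t‖ < R) : evalPS (φ + ψ) t = evalPS φ t + evalPS ψ t := by
  rw [evalPS, evalPS, evalPS, ← (hφ.summable ht).tsum_add (hψ.summable ht)]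
  simp only [map_add, add_mul]

theorem evalPS_mul {R : ℝ} {φ ψ : PowerSeries E} (hφ : IsConv R φ) (hψ : IsConv R ψ) {t : E}
    (ht : ‖t‖ < R) : evalPS (φ * ψ) t = evalPS φ t * evalPS ψ t := by
  rw [evalPS, evalPS, evalPS, tsum_mul_tsum_eq_tsum_sum_antidiagonal_of_summable_norm
    (hφ.summable_norm ht) (hψ.summable_norm ht)]
  refine tsum_congr fun k => ?_
  rw [coeff_mul, Finset.sum_mul]
  refine Finset.sum_congr rfl fun x hx => ?_
  rw [← Finset.HasAntidiagonal.mem_antidiagonal.1 hx, pow_add]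
  ring

end Complete

theorem evalPS_C (a t : E) : evalPS (C a) t = a := by
  rw [evalPS, tsum_eq_single 0]
  · simp
  · intro k hk
    simp [coeff_C, hk]

theorem evalPS_X (t : E) : evalPS X t = t := by
  rw [evalPS, tsum_eq_single 1]
  · simp
  · intro k hk
    simp [coeff_X, hk]

theorem evalPS_zero_right (φ : PowerSeries E) : evalPS φ 0 = constantCoeff φ := by
  rw [evalPS, tsum_eq_single 0]
  · simp
  · intro k hk
    simp [hk]

theorem evalPS_zero_left (t : E) : evalPS (0 : PowerSeries E) t = 0 := by
  simp [evalPS]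

theorem evalPS_sum [CompleteSpace E] {R : ℝ} {ι : Type*} (s : Finset ι) {φ : ι → PowerSeries E}
    (h : ∀ i ∈ s, IsConv R (φ i)) {t : E} (ht : ‖t‖ < R) :
    evalPS (∑ i ∈ s, φ i) t = ∑ i ∈ s, evalPS (φ i) t := by
  classical
  induction s using Finset.induction_on with
  | empty => simp [evalPS_zero_left]
  | insert a s ha ih =>
    rw [Finset.sum_insert ha, Finset.sum_insert ha,
      evalPS_add (h a (Finset.mem_insert_self a s))
        (IsConv.sum s fun i hi => h i (Finset.mem_insert_of_mem hi)) ht,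
      ih fun i hi => h i (Finset.mem_insert_of_mem hi)]

/-- Orthogonality of characters, with N - k standing for -k so that exponents stay natural. It
isolates one coefficient in Cauchy's estimates. -/
theorem sum_pow_root_eq {N : ℕ} {ζ : E} (hζ : IsPrimitiveRoot ζ N) {k j : ℕ} (hk : k < N)
    (hj : j < N) :
    ∑ i ∈ Finset.range N, ζ ^ (i * (N - k)) * ζ ^ (i * j) = if j = k then (N : E) else 0 := by
  have e : ∀ i, ζ ^ (i * (N - k)) * ζ ^ (i * j) = (ζ ^ (N - k + j)) ^ i := fun i => by
    rw [← pow_add, ← pow_mul]; congr 1; ring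
  simp only [e]
  split_ifs with h
  · have : ζ ^ (N - k + j) = 1 := by rw [h, Nat.sub_add_cancel hk.le, hζ.pow_eq_one]
    simp [this]
  · have hne : ζ ^ (N - k + j) ≠ 1 := by
      rw [Ne, hζ.pow_eq_one_iff_dvd]
      -- 0 < N - k + j < 2N, so the only multiple of N available is N itself, which would force j =
      -- k.
      rintro ⟨d, hd⟩
      have h1 : 0 < N * d := by omega
      have h2 : N * d < N * 2 := by omega
      have h3 : d < 2 := Nat.lt_of_mul_lt_mul_left h2
      have h4 : 0 < d := Nat.pos_of_mul_pos_left h1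
      obtain rfl : d = 1 := by omega
      omega
    have := mul_neg_geom_sum (ζ ^ (N - k + j)) N
    rw [← pow_mul, mul_comm (N - k + j), pow_mul, hζ.pow_eq_one, one_pow, sub_self] at this
    exact (mul_eq_zero.1 this).resolve_left (sub_ne_zero.2 hne.symm)

/-- Grouping a summable double series by total degree; needed to expand around a new centre. -/
theorem tsum_prod_eq_tsum_antidiagonal [CompleteSpace E] {f : ℕ × ℕ → E} (hf : Summable f) :
    ∑' x, f x = ∑' n, ∑ x ∈ Finset.HasAntidiagonal.antidiagonal n, f x := by
  have hf' : Summable fun c : (Σ n : ℕ, Finset.HasAntidiagonal.antidiagonal n) => f c.2 :=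
    Finset.HasAntidiagonal.sigmaAntidiagonalEquivProd.summable_iff.2 hf
  rw [← Finset.HasAntidiagonal.sigmaAntidiagonalEquivProd.tsum_eq f]
  refine hf'.tsum_sigma.trans (tsum_congr fun n => ?_)
  rw [tsum_fintype, Finset.sum_coe_sort (Finset.HasAntidiagonal.antidiagonal n) f]

/-! ### Ultrametric estimates, change of centre, identity theorem -/

section Ultrametric

variable [IsUltrametricDist E]

/-- A coefficient of the product is a finite sum, bounded by its largest term, so bounds at radius ρ
multiply and no radius is lost. -/
theorem IsConv.mul {R : ℝ} {φ ψ : PowerSeries E} (hφ : IsConv R φ) (hψ : IsConv R ψ) :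
    IsConv R (φ * ψ) := by
  intro ρ h0 h1
  obtain ⟨A, hA⟩ := hφ ρ h0 h1
  obtain ⟨B, hB⟩ := hψ ρ h0 h1
  have hA0 : 0 ≤ A := (by positivity : (0:ℝ) ≤ ‖coeff 0 φ‖ * ρ ^ 0).trans (hA 0)
  have hB0 : 0 ≤ B := (by positivity : (0:ℝ) ≤ ‖coeff 0 ψ‖ * ρ ^ 0).trans (hB 0)
  refine ⟨A * B, fun k => ?_⟩
  rw [← le_div_iff₀ (pow_pos h0 k), coeff_mul]
  refine IsUltrametricDist.norm_sum_le_of_forall_le_of_nonneg (by positivity) fun x hx => ?_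
  rw [le_div_iff₀ (pow_pos h0 k), norm_mul, ← Finset.HasAntidiagonal.mem_antidiagonal.1 hx, pow_add]
  calc _ = (‖coeff x.1 φ‖ * ρ ^ x.1) * (‖coeff x.2 ψ‖ * ρ ^ x.2) := by ring
    _ ≤ A * B := mul_le_mul (hA _) (hB _) (by positivity) hA0

theorem norm_natCast_mul_le (m : ℕ) (a : E) : ‖(m : E) * a‖ ≤ ‖a‖ := by
  rw [norm_mul]
  exact mul_le_of_le_one_left (norm_nonneg a) (IsUltrametricDist.norm_natCast_le_one E m)

/-- Integers have norm at most 1, so differentiation costs only a factor 1/ρ. -/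
theorem IsConv.derivative {R : ℝ} {φ : PowerSeries E} (hφ : IsConv R φ) :
    IsConv R (derivative E φ) := by
  intro ρ h0 h1
  obtain ⟨A, hA⟩ := hφ ρ h0 h1
  refine ⟨A / ρ, fun k => ?_⟩
  rw [le_div_iff₀ h0, coeff_derivative, mul_comm (coeff (k + 1) φ)]
  have h := norm_natCast_mul_le (k + 1) (coeff (k + 1) φ)
  push_cast at h
  calc _ ≤ ‖coeff (k + 1) φ‖ * ρ ^ k * ρ := by gcongr
    _ = ‖coeff (k + 1) φ‖ * ρ ^ (k + 1) := by ring
    _ ≤ A := hA _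

/-- The expansion of a power series around another centre `s`. -/
def recenter (φ : PowerSeries E) (s : E) : PowerSeries E :=
  PowerSeries.mk fun j => ∑' m, ((j + m).choose j : E) * coeff (j + m) φ * s ^ m

/-- The two series agree term by term, because j! times the binomial coefficient is the factor
(m+1)⋯(m+j) produced by j derivations; hence no convergence is required. Coefficients at a new
centre thereby become values of derivatives. -/
theorem factorial_mul_coeff_recenter (φ : PowerSeries E) (s : E) (j : ℕ) :
    (j.factorial : E) * coeff j (recenter φ s) = evalPS ((derivative E)^[j] φ) s := by
  rw [recenter, coeff_mk, evalPS, ← tsum_mul_left]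
  refine tsum_congr fun m => ?_
  rw [coeff_iterate_derivative, Nat.ascFactorial_eq_factorial_mul_choose, add_comm m j]
  push_cast
  ring

theorem norm_choose_mul_coeff_le {ρ B : ℝ} (h0 : 0 < ρ) {φ : PowerSeries E}
    (hB : ∀ k, ‖coeff k φ‖ ≤ B / ρ ^ k) (s : E) (j m : ℕ) :
    ‖((j + m).choose j : E) * coeff (j + m) φ * s ^ m‖ ≤ B / ρ ^ j * (‖s‖ / ρ) ^ m := by
  rw [norm_mul, norm_pow]
  calc _ ≤ B / ρ ^ (j + m) * ‖s‖ ^ m := by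
        gcongr
        exact (norm_natCast_mul_le _ _).trans (hB _)
    _ = B / ρ ^ j * (‖s‖ / ρ) ^ m := by
        rw [pow_add, div_pow]
        field_simp

theorem IsConv.recenter {R : ℝ} {φ : PowerSeries E} (hφ : IsConv R φ) {s : E} (hs : ‖s‖ < R) :
    IsConv R (recenter φ s) := by
  intro ρ h0 h1
  -- Every point of an ultrametric disk is a centre: a bound at this larger radius, still below R,
  -- controls both the shift s and the target radius ρ.
  have hlt : max ρ ‖s‖ < R := max_lt h1 hs
  have hm : 0 < max ρ ‖s‖ := lt_max_of_lt_left h0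
  obtain ⟨B, hB⟩ := hφ _ hm hlt
  have hB0 : 0 ≤ B := (by positivity : (0:ℝ) ≤ ‖coeff 0 φ‖ * max ρ ‖s‖ ^ 0).trans (hB 0)
  refine ⟨B, fun j => ?_⟩
  rw [← le_div_iff₀ (pow_pos h0 j), QDiff.recenter, coeff_mk]
  refine IsUltrametricDist.norm_tsum_le_of_forall_le_of_nonneg (by positivity) fun m => ?_
  refine (norm_choose_mul_coeff_le hm (fun k => (le_div_iff₀ (pow_pos hm k)).2 (hB k)) s j
    m).trans ?_
  calc _ ≤ B / max ρ ‖s‖ ^ j * 1 := by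
        gcongr
        exact pow_le_one₀ (by positivity) ((div_le_one hm).2 (le_max_right _ _))
    _ ≤ B / ρ ^ j := by
        rw [mul_one]
        gcongr
        exact le_max_left _ _

/-- The double series is absolutely summable; regrouped by total degree it is the binomial expansion
of (s + t)^n. -/
theorem evalPS_recenter [CompleteSpace E] {R : ℝ} {φ : PowerSeries E} (hφ : IsConv R φ) {s t : E}
    (hs : ‖s‖ < R) (ht : ‖t‖ < R) : evalPS (recenter φ s) t = evalPS φ (s + t) := by
  obtain ⟨ρ, h1, h2⟩ := exists_between (max_lt hs ht)
  have h0 : 0 < ρ := (norm_nonneg s).trans_lt ((le_max_left _ _).trans_lt h1)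
  obtain ⟨B, hB⟩ := hφ ρ h0 h2
  have hB' : ∀ k, ‖coeff k φ‖ ≤ B / ρ ^ k := fun k => (le_div_iff₀ (pow_pos h0 k)).2 (hB k)
  have hs1 : ‖s‖ / ρ < 1 := (div_lt_one h0).2 ((le_max_left _ _).trans_lt h1)
  have ht1 : ‖t‖ / ρ < 1 := (div_lt_one h0).2 ((le_max_right _ _).trans_lt h1)
  let f : ℕ × ℕ → E := fun x =>
    ((x.1 + x.2).choose x.1 : E) * coeff (x.1 + x.2) φ * s ^ x.2 * t ^ x.1
  have hf : Summable f := by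
    have hg : Summable fun x : ℕ × ℕ => (‖t‖ / ρ) ^ x.1 * (‖s‖ / ρ) ^ x.2 :=
      (summable_geometric_of_lt_one (by positivity) ht1).mul_of_nonneg
        (summable_geometric_of_lt_one (by positivity) hs1) (fun _ => by positivity)
        (fun _ => by positivity)
    refine Summable.of_norm_bounded (hg.mul_left B) fun x => ?_
    rw [norm_mul, norm_pow]
    calc _ ≤ B / ρ ^ x.1 * (‖s‖ / ρ) ^ x.2 * ‖t‖ ^ x.1 := by
          gcongr
          exact norm_choose_mul_coeff_le h0 hB' s x.1 x.2
      _ = _ := by rw [div_pow ‖t‖]; ring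
  have e1 : ∑' x, f x = evalPS (recenter φ s) t := by
    rw [hf.tsum_prod, evalPS]
    refine tsum_congr fun j => ?_
    rw [recenter, coeff_mk, ← tsum_mul_right]
  rw [← e1, tsum_prod_eq_tsum_antidiagonal hf, evalPS]
  refine tsum_congr fun n => ?_
  rw [add_comm s t, (Commute.all t s).add_pow', Finset.mul_sum]
  refine Finset.sum_congr rfl fun x hx => ?_
  have hx := Finset.HasAntidiagonal.mem_antidiagonal.1 hx
  simp only [f, hx, nsmul_eq_mul]
  ring

theorem coeff_one_recenter (φ : PowerSeries E) (s : E) :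
    coeff 1 (recenter φ s) = evalPS (derivative E φ) s := by
  simpa using factorial_mul_coeff_recenter φ s 1

theorem norm_evalPS_le {φ : PowerSeries E} {t : E} {B : ℝ} (hB : 0 ≤ B)
    (h : ∀ k, ‖coeff k φ‖ * ‖t‖ ^ k ≤ B) : ‖evalPS φ t‖ ≤ B :=
  IsUltrametricDist.norm_tsum_le_of_forall_le_of_nonneg hB fun k => by
    rw [norm_mul, norm_pow]; exact h k

/-- A power series bounded near `0` has remainder of order one: it is continuous at `0`. -/
theorem norm_evalPS_sub_le [CompleteSpace E] {R : ℝ} (hR : 0 < R) {φ : PowerSeries E}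
    (hφ : IsConv R φ) (m : ℕ) (hm : ∀ k < m, coeff k φ = 0) :
    ∃ ρ B : ℝ, 0 < ρ ∧ ρ < R ∧ 0 ≤ B ∧
      ∀ t : E, ‖t‖ ≤ ρ → ‖evalPS φ t - coeff m φ * t ^ m‖ ≤ B * ‖t‖ ^ (m + 1) := by
  obtain ⟨ρ, B, h0, -, h2, hB0, hB⟩ := hφ.exists_bound (t := (0 : E)) (by simpa using hR)
  refine ⟨ρ, B / ρ ^ (m + 1), h0, h2, by positivity, fun t ht => ?_⟩
  have e : evalPS φ t - coeff m φ * t ^ m = evalPS (φ - monomial m (coeff m φ)) t := by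
    have hsum := hφ.hasSum (ht.trans_lt h2)
    have hmon : HasSum (fun k => coeff k (monomial m (coeff m φ)) * t ^ k) (coeff m φ * t ^ m) := by
      convert hasSum_ite_eq m (coeff m φ * t ^ m) using 2 with k
      rw [coeff_monomial]
      split_ifs with h
      · rw [h]
      · simp
    rw [← (hsum.sub hmon).tsum_eq, evalPS]
    simp only [map_sub, sub_mul]
  rw [e]
  refine norm_evalPS_le (by positivity) fun k => ?_
  rw [map_sub, coeff_monomial]
  rcases lt_trichotomy k m with h | h | h
  · rw [hm k h, if_neg h.ne]
    simp only [sub_zero, norm_zero, zero_mul]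
    positivity
  · rw [if_pos h, h, sub_self, norm_zero, zero_mul]
    positivity
  · rw [if_neg h.ne', sub_zero]
    obtain ⟨d, rfl⟩ := Nat.exists_eq_add_of_lt h
    calc _ ≤ B / ρ ^ (m + d + 1) * (‖t‖ ^ (m + 1) * ρ ^ d) := by
          rw [show m + d + 1 = m + 1 + d by ring, pow_add ‖t‖]
          gcongr
          exact hB _
      _ = _ := by
          rw [show m + d + 1 = m + 1 + d by ring, pow_add ρ]
          field_simp

/-- The difference quotients of a convergent power series at `0` converge to its first
coefficient. -/
theorem tendsto_slope_evalPS_zero [CompleteSpace E] {R : ℝ} (hR : 0 < R) {φ : PowerSeries E}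
    (hφ : IsConv R φ) {α : Type*} {l : Filter α} {t : α → E} (ht : Tendsto t l (𝓝 0))
    (ht0 : ∀ᶠ a in l, t a ≠ 0) :
    Tendsto (fun a => (evalPS φ (t a) - constantCoeff φ) / t a) l (𝓝 (coeff 1 φ)) := by
  have hψ : IsConv R (φ - C (constantCoeff φ)) := by
    rw [sub_eq_add_neg, ← map_neg]
    exact hφ.add (isConv_C R _)
  obtain ⟨ρ, B, h0, hρ, hB, h⟩ := norm_evalPS_sub_le hR hψ 1 (fun k hk => by
    obtain rfl : k = 0 := by omega
    simp)
  rw [tendsto_iff_norm_sub_tendsto_zero]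
  have ht' : Tendsto (fun a => B * ‖t a‖) l (𝓝 0) := by
    simpa using (ht.norm).const_mul B
  refine squeeze_zero' (Eventually.of_forall fun _ => norm_nonneg _) ?_ ht'
  have hev : ∀ᶠ a in l, ‖t a‖ < ρ := (ht.norm).eventually_lt_const (by simpa using h0)
  filter_upwards [hev, ht0] with a ha ha0
  have e := h (t a) ha.le
  have e2 : evalPS (φ - C (constantCoeff φ)) (t a) = evalPS φ (t a) - constantCoeff φ := by
    rw [sub_eq_add_neg, ← map_neg, evalPS_add hφ (isConv_C R _) (ha.trans hρ), evalPS_C]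
    ring
  have hpos : 0 < ‖t a‖ := norm_pos_iff.2 ha0
  rw [e2] at e
  have e3 : (evalPS φ (t a) - constantCoeff φ) / t a - coeff 1 φ =
      (evalPS φ (t a) - constantCoeff φ - coeff 1 (φ - C (constantCoeff φ)) * t a ^ 1) / t a := by
    have : coeff 1 (φ - C (constantCoeff φ)) = coeff 1 φ := by simp
    rw [this]
    field_simp
  rw [e3, norm_div, div_le_iff₀ hpos]
  calc _ ≤ _ := e
    _ = _ := by ring

/-- A convergent power series with zeros accumulating at `0` vanishes. -/
theorem IsConv.eq_zero [CompleteSpace E] {R : ℝ} (hR : 0 < R) {φ : PowerSeries E}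
    (hφ : IsConv R φ) (h : ∀ ε > 0, ∃ t : E, t ≠ 0 ∧ ‖t‖ < ε ∧ evalPS φ t = 0) : φ = 0 := by
  ext m
  rw [map_zero]
  induction m using Nat.strong_induction_on with
  | _ m ih =>
    obtain ⟨ρ, B, h0, -, hB, hbd⟩ := norm_evalPS_sub_le hR hφ m ih
    rw [← norm_le_zero_iff]
    refine le_of_forall_pos_le_add fun ε hε => ?_
    -- At a zero t the remainder estimate reads |φ_m| ≤ B‖t‖ after division by ‖t‖^m; this choice
    -- makes the right side at most ε.
    obtain ⟨t, ht0, ht, hz⟩ := h (min ρ (ε / (B + 1))) (lt_min h0 (by positivity))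
    have e := hbd t (ht.le.trans (min_le_left _ _))
    have hpos : 0 < ‖t‖ := norm_pos_iff.2 ht0
    rw [hz, zero_sub, norm_neg, norm_mul, norm_pow, pow_succ] at e
    have e2 : ‖coeff m φ‖ * ‖t‖ ^ m ≤ (B * ‖t‖) * ‖t‖ ^ m := by linarith
    have e3 := le_of_mul_le_mul_right e2 (pow_pos hpos m)
    have e4 : ‖t‖ * (B + 1) ≤ ε := by
      rw [← le_div_iff₀ (by positivity)]
      exact ht.le.trans (min_le_right _ _)
    nlinarith

/-- The identity theorem. It gives uniqueness of Taylor series and extends to a whole disk the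
relations known only along an orbit q^m y. -/
theorem IsConv.eq_of_evalPS_eq [CompleteSpace E] {R : ℝ} (hR : 0 < R) {φ ψ : PowerSeries E}
    (hφ : IsConv R φ) (hψ : IsConv R ψ)
    (h : ∀ ε > 0, ∃ t : E, t ≠ 0 ∧ ‖t‖ < ε ∧ evalPS φ t = evalPS ψ t) : φ = ψ := by
  have hψ' : IsConv R (C (-1) * ψ) := (isConv_C R _).mul hψ
  have key : φ + C (-1) * ψ = 0 := by
    refine (hφ.add hψ').eq_zero hR fun ε hε => ?_
    obtain ⟨t, h0, ht, e⟩ := h (min ε R) (lt_min hε hR)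
    refine ⟨t, h0, ht.trans_le (min_le_left _ _), ?_⟩
    have htR := ht.trans_le (min_le_right _ _)
    rw [evalPS_add hφ hψ' htR, evalPS_mul (isConv_C R _) hψ htR, evalPS_C, e]
    ring
  rw [map_neg, map_one] at key
  linear_combination key

/-- Cauchy's estimates, for a convergent power series bounded by `B` at the points `ζ τ`, where `ζ`
runs over roots of unity of orders prime to `p`. -/
theorem norm_coeff_mul_le [CompleteSpace E] (p : ℕ) (hp : ‖(p : E)‖ < 1) (hp1 : 1 ≤ p)
    {ξ : ℕ → E} (hξ : ∀ m, IsPrimitiveRoot (ξ m) (p * m + 1)) {R : ℝ} {φ : PowerSeries E}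
    (hφ : IsConv R φ) {τ : E} (hτ : ‖τ‖ < R) {B : ℝ} (hB : 0 ≤ B)
    (h : ∀ m i, ‖evalPS φ (ξ m ^ i * τ)‖ ≤ B) (k : ℕ) :
    ‖coeff k φ‖ * ‖τ‖ ^ k ≤ B := by
  refine le_of_forall_pos_le_add fun ε hε => ?_
  have htend := (hφ.summable_norm hτ).tendsto_atTop_zero
  obtain ⟨m, hm⟩ := eventually_atTop.1 (htend.eventually_lt_const hε)
  -- N is prime to p, so |N| = 1 and dividing by it is harmless. It also exceeds k and m, so k lies
  -- in the truncation range and all discarded terms are smaller than ε.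
  obtain ⟨N, hNdef⟩ : ∃ N, N = p * (m + k) + 1 := ⟨_, rfl⟩
  obtain ⟨ζ, hζdef⟩ : ∃ ζ, ζ = ξ (m + k) := ⟨_, rfl⟩
  have hζ := hξ (m + k)
  rw [← hζdef] at hζ
  rw [← hNdef] at hζ
  have hmk : m + k ≤ p * (m + k) := Nat.le_mul_of_pos_left _ hp1
  have hkN : k < N := by omega
  have hN1 : ‖(N : E)‖ = 1 := by
    have h1 : ‖(p * (m + k) : ℕ) * (1 : E)‖ < 1 := by
      push_cast
      rw [mul_one, norm_mul]
      refine (mul_le_of_le_one_right (norm_nonneg _) ?_).trans_lt hp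
      exact_mod_cast IsUltrametricDist.norm_natCast_le_one E (m + k)
    rw [mul_one] at h1
    rw [hNdef, Nat.cast_add, Nat.cast_one,
      IsUltrametricDist.norm_add_eq_max_of_norm_ne_norm (by rw [norm_one]; exact h1.ne), norm_one,
      max_eq_right h1.le]
  have hζn : ‖ζ‖ = 1 := by
    have := congrArg norm hζ.pow_eq_one
    rw [norm_pow, norm_one] at this
    exact (pow_eq_one_iff_of_nonneg (norm_nonneg _) (by omega)).1 this
  -- The truncated polynomial differs from the series by terms of norm < ε at each ζ^i τ, because
  -- |ζ| = 1.
  have hval : ∀ i, ‖∑ j ∈ Finset.range N, coeff j φ * (ζ ^ i * τ) ^ j‖ ≤ B + ε := by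
    intro i
    have hti : ‖ζ ^ i * τ‖ = ‖τ‖ := by rw [norm_mul, norm_pow, hζn, one_pow, one_mul]
    have hs := (hφ.summable (by rw [hti]; exact hτ)).sum_add_tsum_nat_add N
    have hs' : ∑ j ∈ Finset.range N, coeff j φ * (ζ ^ i * τ) ^ j = evalPS φ (ζ ^ i * τ) -
        ∑' j, coeff (j + N) φ * (ζ ^ i * τ) ^ (j + N) := by
      rw [evalPS, ← hs]; ring
    rw [hs']
    refine (norm_sub_le _ _).trans (add_le_add ?_ ?_)
    · rw [hζdef]
      exact h _ _
    · refine IsUltrametricDist.norm_tsum_le_of_forall_le_of_nonneg hε.le fun j => ?_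
      have := hm (j + N) (by omega)
      rw [norm_mul, norm_pow, hti]
      rw [norm_mul, norm_pow] at this
      exact this.le
  -- Discrete Fourier inversion: averaging the polynomial against ζ^(-ik) keeps only its k-th term.
  have hsum : ∑ i ∈ Finset.range N, ζ ^ (i * (N - k)) *
      ∑ j ∈ Finset.range N, coeff j φ * (ζ ^ i * τ) ^ j = N * (coeff k φ * τ ^ k) := by
    simp only [Finset.mul_sum]
    rw [Finset.sum_comm]
    have : ∀ j ∈ Finset.range N, ∑ i ∈ Finset.range N,
        ζ ^ (i * (N - k)) * (coeff j φ * (ζ ^ i * τ) ^ j) =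
        if j = k then N * (coeff k φ * τ ^ k) else 0 := by
      intro j hj
      have e : ∀ i, ζ ^ (i * (N - k)) * (coeff j φ * (ζ ^ i * τ) ^ j) =
          ζ ^ (i * (N - k)) * ζ ^ (i * j) * (coeff j φ * τ ^ j) := fun i => by
        rw [mul_pow, ← pow_mul]; ring
      simp only [e]
      rw [← Finset.sum_mul, sum_pow_root_eq hζ hkN (Finset.mem_range.1 hj)]
      split_ifs with hjk
      · rw [hjk]
      · rw [zero_mul]
    rw [Finset.sum_congr rfl this, Finset.sum_ite_eq' , if_pos (Finset.mem_range.2 hkN)]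
  have hfin : ‖(N : E) * (coeff k φ * τ ^ k)‖ ≤ B + ε := by
    rw [← hsum]
    refine IsUltrametricDist.norm_sum_le_of_forall_le_of_nonneg (by positivity) fun i _ => ?_
    rw [norm_mul, norm_pow, hζn, one_pow, one_mul]
    exact hval i
  rwa [norm_mul, hN1, one_mul, norm_mul, norm_pow] at hfin

end Ultrametric

end PowerSeries

/-! ### The completion of the algebraic closure -/

section CompletedClosure

variable (K : Type u) [NontriviallyNormedField K] [IsUltrametricDist K] [CompleteSpace K]

/-- The completion of the algebraic closure of `K`. -/
def CompletedClosure : Type u := UniformSpace.Completion (AlgebraicClosure K)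

instance : NormedField (CompletedClosure K) :=
  inferInstanceAs (NormedField (UniformSpace.Completion (AlgebraicClosure K)))

instance : CompleteSpace (CompletedClosure K) :=
  inferInstanceAs (CompleteSpace (UniformSpace.Completion (AlgebraicClosure K)))

variable {K}

/-- The embedding of the algebraic closure into its completion. -/
def toCompleted : AlgebraicClosure K →+* CompletedClosure K :=
  UniformSpace.Completion.coeRingHom

theorem norm_toCompleted (x : AlgebraicClosure K) : ‖toCompleted x‖ = ‖x‖ :=
  UniformSpace.Completion.norm_coe x

theorem isometry_toCompleted : Isometry (toCompleted (K := K)) :=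
  AddMonoidHomClass.isometry_of_norm _ norm_toCompleted

theorem denseRange_toCompleted : DenseRange (toCompleted (K := K)) :=
  UniformSpace.Completion.denseRange_coe

theorem toCompleted_injective : Function.Injective (toCompleted (K := K)) :=
  toCompleted.injective

instance : IsUltrametricDist (CompletedClosure K) := by
  refine IsUltrametricDist.isUltrametricDist_of_isNonarchimedean_norm fun x y => ?_
  induction x, y using (denseRange_toCompleted (K := K)).induction_on₂ with
  | hp =>
    exact isClosed_le (by fun_prop) (by fun_prop)
  | h a b =>
    rw [← map_add, norm_toCompleted, norm_toCompleted, norm_toCompleted]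
    exact norm_algClosure_add_le a b

instance [CharZero K] : CharZero (CompletedClosure K) :=
  charZero_of_injective_ringHom (toCompleted.comp (algebraMap K (AlgebraicClosure K))).injective

theorem norm_algebraMap_algClosure (a : K) : ‖algebraMap K (AlgebraicClosure K) a‖ = ‖a‖ :=
  spectralNorm_extends a

instance : NormedAlgebra K (AlgebraicClosure K) := spectralNorm.normedAlgebra K (AlgebraicClosure K)

/-- A finite extension of the complete field K is complete, hence closed. This brings limits taken
in the completion back to K^alg. -/
theorem isClosed_image_adjoin (s : Finset (AlgebraicClosure K)) :
    IsClosed (toCompleted '' (IntermediateField.adjoin K (s : Set (AlgebraicClosure K)) :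
      Set (AlgebraicClosure K))) := by
  have hfin : FiniteDimensional K (IntermediateField.adjoin K (s : Set (AlgebraicClosure K))) :=
    IntermediateField.finiteDimensional_adjoin fun x _ => Algebra.IsIntegral.isIntegral x
  have : IsComplete ((IntermediateField.adjoin K (s : Set (AlgebraicClosure K))).toSubmodule :
      Set (AlgebraicClosure K)) := Submodule.complete_of_finiteDimensional _
  exact (isometry_toCompleted.isUniformInducing.isComplete_iff.2 this).isClosed

/-- The value group of K^alg is dense: for m large, an m-th root of an element of norm > 1 has norm
so close to 1 that one of its integral powers must fall in the interval. -/
theorem exists_norm_between {a b : ℝ} (ha : 0 ≤ a) (hab : a < b) :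
    ∃ τ : AlgebraicClosure K, a < ‖τ‖ ∧ ‖τ‖ < b := by
  obtain ⟨a', h1, h2⟩ := exists_between hab
  have ha' : 0 < a' := ha.trans_lt h1
  obtain ⟨π, hπ⟩ := NormedField.exists_one_lt_norm K
  obtain ⟨m, hm⟩ := pow_unbounded_of_one_lt ‖π‖ ((one_lt_div ha').2 h2)
  have hm0 : m ≠ 0 := by
    rintro rfl
    rw [pow_zero] at hm
    exact hm.not_gt hπ
  obtain ⟨τ, hτ⟩ := IsAlgClosed.exists_pow_nat_eq (algebraMap K (AlgebraicClosure K) π)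
    (Nat.pos_of_ne_zero hm0)
  have hτn : ‖τ‖ ^ m = ‖π‖ := by rw [← norm_pow, hτ, norm_algebraMap_algClosure]
  have hτ1 : 1 < ‖τ‖ := by
    by_contra! h
    exact (hτn ▸ pow_le_one₀ (norm_nonneg τ) h).not_gt hπ
  have hτ2 : ‖τ‖ < b / a' := lt_of_pow_lt_pow_left₀ m (div_nonneg (ha.trans hab.le) ha'.le)
    (hτn ▸ hm)
  obtain ⟨n, hn1, hn2⟩ := exists_mem_Ico_zpow ha' hτ1
  refine ⟨τ ^ (n + 1), ?_, ?_⟩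
  · rw [norm_zpow]
    exact h1.trans hn2
  · rw [norm_zpow, zpow_add_one₀ (zero_lt_one.trans hτ1).ne']
    calc _ ≤ a' * ‖τ‖ := by gcongr
      _ < a' * (b / a') := by gcongr
      _ = b := by field_simp

end CompletedClosure

/-! ## Taylor expansions of analytic elements -/

namespace Affinoid

variable {K : Type u} [NontriviallyNormedField K] [IsUltrametricDist K] [CompleteSpace K]
variable (X : Affinoid K)

theorem minRadius_pos : 0 < X.minRadius := by
  rw [minRadius, Finset.lt_inf'_iff]
  rintro (_ | i) -
  · exact X.R₀_pos
  · exact X.R_pos i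

theorem minRadius_le_R₀ : X.minRadius ≤ X.R₀ :=
  Finset.inf'_le (fun i : Option (Fin X.numHoles) => i.elim X.R₀ X.R) (Finset.mem_univ none)

theorem minRadius_le_R (i : Fin X.numHoles) : X.minRadius ≤ X.R i :=
  Finset.inf'_le (fun i : Option (Fin X.numHoles) => i.elim X.R₀ X.R) (Finset.mem_univ (some i))

theorem minRadius_le_maxAbs : X.minRadius ≤ X.maxAbs := X.minRadius_le_R₀.trans (le_max_right _ _)

theorem maxAbs_pos : 0 < X.maxAbs := X.R₀_pos.trans_le (le_max_right _ _)

variable {X}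

theorem norm_point_le (x : X.points) : ‖(x : AlgebraicClosure K)‖ ≤ X.maxAbs := by
  have h := norm_algClosure_add_le
    ((x : AlgebraicClosure K) - algebraMap K (AlgebraicClosure K) X.c₀)
    (algebraMap K (AlgebraicClosure K) X.c₀)
  rw [sub_add_cancel, norm_algebraMap_algClosure, max_comm] at h
  exact h.trans (max_le_max le_rfl x.2.1)

/-- A displacement smaller than every R_i cannot bring a point of X into a hole, nor out of the
outer disk. Hence r_X is the natural radius for local expansions. -/
theorem mem_points_of_norm_sub_lt (y : X.points) {x : AlgebraicClosure K}
    (h : ‖x - (y : AlgebraicClosure K)‖ < X.minRadius) : x ∈ X.points := by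
  refine ⟨?_, fun i => ?_⟩
  · have h1 := norm_algClosure_add_le (x - (y : AlgebraicClosure K))
      ((y : AlgebraicClosure K) - algebraMap K (AlgebraicClosure K) X.c₀)
    rw [sub_add_sub_cancel] at h1
    exact h1.trans (max_le (h.le.trans X.minRadius_le_R₀) y.2.1)
  · by_contra! hlt
    have h1 := norm_algClosure_sub_le (x - algebraMap K (AlgebraicClosure K) (X.c i)) (x - y)
    rw [sub_sub_sub_cancel_left] at h1
    exact (y.2.2 i).not_gt (h1.trans_lt (max_lt hlt (h.trans_le (X.minRadius_le_R i))))

theorem minRadius_le_norm_sub {a : AlgebraicClosure K} (ha : a ∉ X.points) (y : X.points) :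
    X.minRadius ≤ ‖(y : AlgebraicClosure K) - a‖ := by
  by_contra! h
  rw [norm_sub_rev] at h
  exact ha (mem_points_of_norm_sub_lt y h)

theorem exists_point_near (y : X.points) {ε : ℝ} (hε : 0 < ε) :
    ∃ x : X.points, x ≠ y ∧ ‖(x : AlgebraicClosure K) - (y : AlgebraicClosure K)‖ < ε := by
  obtain ⟨τ, h0, h1⟩ := exists_norm_between (K := K) le_rfl (lt_min hε X.minRadius_pos)
  refine ⟨⟨(y : AlgebraicClosure K) + τ, mem_points_of_norm_sub_lt y ?_⟩, ?_, ?_⟩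
  · simpa using h1.trans_le (min_le_right _ _)
  · intro h
    have := congrArg Subtype.val h
    simp only [add_eq_left] at this
    simp [this] at h0
  · simpa using h1.trans_le (min_le_left _ _)

instance (y : X.points) : (𝓝[≠] y).NeBot := by
  rw [← mem_closure_iff_nhdsWithin_neBot, Metric.mem_closure_iff]
  intro ε hε
  obtain ⟨x, hx, h⟩ := exists_point_near y hε
  refine ⟨x, hx, ?_⟩
  rw [dist_comm, Subtype.dist_eq, dist_eq_norm]
  exact h

/-- `φ` is the Taylor series at `y` of the function `f` on `X(K^alg)`. -/
def HasTaylor (f : X.points → AlgebraicClosure K) (y : X.points)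
    (φ : PowerSeries (CompletedClosure K)) : Prop :=
  IsConv X.minRadius φ ∧ ∀ x : X.points,
    ‖(x : AlgebraicClosure K) - (y : AlgebraicClosure K)‖ < X.minRadius →
    toCompleted (f x) = evalPS φ (toCompleted ((x : AlgebraicClosure K) - (y : AlgebraicClosure K)))

theorem HasTaylor.add {f g : X.points → AlgebraicClosure K} {y : X.points}
    {φ ψ : PowerSeries (CompletedClosure K)} (hf : HasTaylor f y φ) (hg : HasTaylor g y ψ) :
    HasTaylor (f + g) y (φ + ψ) := by
  refine ⟨hf.1.add hg.1, fun x hx => ?_⟩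
  rw [evalPS_add hf.1 hg.1 (by rwa [norm_toCompleted]), Pi.add_apply, map_add, hf.2 x hx, hg.2 x hx]

theorem HasTaylor.mul {f g : X.points → AlgebraicClosure K} {y : X.points}
    {φ ψ : PowerSeries (CompletedClosure K)} (hf : HasTaylor f y φ) (hg : HasTaylor g y ψ) :
    HasTaylor (f * g) y (φ * ψ) := by
  refine ⟨hf.1.mul hg.1, fun x hx => ?_⟩
  rw [evalPS_mul hf.1 hg.1 (by rwa [norm_toCompleted]), Pi.mul_apply, map_mul, hf.2 x hx, hg.2 x hx]

theorem hasTaylor_const (a : AlgebraicClosure K) (y : X.points) :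
    HasTaylor (fun _ => a) y (PowerSeries.C (toCompleted a)) :=
  ⟨isConv_C _ _, fun x _ => by rw [evalPS_C]⟩

theorem hasTaylor_coe (y : X.points) :
    HasTaylor (fun x => (x : AlgebraicClosure K)) y
      (PowerSeries.C (toCompleted (y : AlgebraicClosure K)) + PowerSeries.X) := by
  refine ⟨(isConv_C _ _).add (isConv_X _), fun x hx => ?_⟩
  rw [evalPS_add (isConv_C _ _) (isConv_X _) (by rwa [norm_toCompleted]), evalPS_C, evalPS_X,
    map_sub]
  ring

/-- Geometric series of 1/(b + t) with b = y - a; it converges for |t| < r_X because a pole outside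
X satisfies |b| ≥ r_X. -/
theorem exists_hasTaylor_inv_sub {a : AlgebraicClosure K} (ha : a ∉ X.points) (y : X.points) :
    ∃ φ, HasTaylor (fun x => ((x : AlgebraicClosure K) - a)⁻¹) y φ := by
  have hb := minRadius_le_norm_sub ha y
  set b : AlgebraicClosure K := (y : AlgebraicClosure K) - a with hbdef
  have hb0 : 0 < ‖b‖ := X.minRadius_pos.trans_le hb
  have hbne : toCompleted b ≠ 0 := by
    rw [← norm_pos_iff, norm_toCompleted]; exact hb0
  refine ⟨PowerSeries.mk fun k => (toCompleted b)⁻¹ * (-(toCompleted b)⁻¹) ^ k, ?_, fun x hx => ?_⟩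
  · refine fun ρ h0 h1 => ⟨‖b‖⁻¹, fun k => ?_⟩
    rw [PowerSeries.coeff_mk, norm_mul, norm_pow, norm_neg, norm_inv, norm_toCompleted, mul_assoc,
      ← mul_pow]
    refine mul_le_of_le_one_right (by positivity) (pow_le_one₀ (by positivity) ?_)
    rw [inv_mul_le_iff₀ hb0, mul_one]
    exact h1.le.trans hb
  · set t := toCompleted ((x : AlgebraicClosure K) - (y : AlgebraicClosure K)) with ht
    have htb : ‖-(toCompleted b)⁻¹ * t‖ < 1 := by
      rw [norm_mul, norm_neg, norm_inv, ht, norm_toCompleted, norm_toCompleted,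
        inv_mul_lt_iff₀ hb0, mul_one]
      exact hx.trans_le hb
    simp only [evalPS, PowerSeries.coeff_mk]
    simp only [mul_assoc, ← mul_pow]
    rw [tsum_mul_left, tsum_geometric_of_norm_lt_one htb, map_inv₀, ← mul_inv]
    congr 1
    rw [mul_sub, mul_one, neg_mul, mul_neg, mul_inv_cancel_left₀ hbne, ht, ← map_neg, ← map_sub]
    congr 1
    rw [hbdef]; ring

theorem exists_hasTaylor_aeval (P : Polynomial K) (y : X.points) :
    ∃ φ, HasTaylor (fun x => Polynomial.aeval (x : AlgebraicClosure K) P) y φ := by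
  induction P using Polynomial.induction_on' with
  | add p q hp hq =>
    obtain ⟨φ, hφ⟩ := hp
    obtain ⟨ψ, hψ⟩ := hq
    exact ⟨_, by simpa [Pi.add_def] using hφ.add hψ⟩
  | monomial n a =>
    simp only [Polynomial.aeval_monomial]
    suffices h : ∃ φ, HasTaylor (fun x : X.points => (x : AlgebraicClosure K) ^ n) y φ by
      obtain ⟨φ, hφ⟩ := h
      exact ⟨_, (hasTaylor_const _ y).mul hφ⟩
    induction n with
    | zero => exact ⟨_, by simpa using hasTaylor_const 1 y⟩
    | succ n ih =>
      obtain ⟨φ, hφ⟩ := ih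
      exact ⟨_, by simpa [pow_succ, Pi.mul_def] using hφ.mul (hasTaylor_coe y)⟩

/-- Over K^alg the denominator splits into linear factors whose roots all lie outside X, which
reduces the claim to inverses of linear factors. -/
theorem exists_hasTaylor_of_mem_rational {f : X.points → AlgebraicClosure K} (hf : f ∈ X.rational)
    (y : X.points) : ∃ φ, HasTaylor f y φ := by
  obtain ⟨P, Q, h⟩ := hf
  have hinv : ∃ φ, HasTaylor
      (fun x : X.points => (Polynomial.aeval (x : AlgebraicClosure K) Q)⁻¹) y φ := by
    have hsp := IsAlgClosed.splits (Q.map (algebraMap K (AlgebraicClosure K)))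
    have key : ∀ x : AlgebraicClosure K, Polynomial.aeval x Q =
        algebraMap K (AlgebraicClosure K) Q.leadingCoeff *
          ((Q.map (algebraMap K (AlgebraicClosure K))).roots.map (fun a => x - a)).prod := by
      intro x
      rw [Polynomial.aeval_def, ← Polynomial.eval_map]
      conv_lhs => rw [hsp.eq_prod_roots]
      simp [Polynomial.eval_multiset_prod, Multiset.map_map]
    have hroots : ∀ a ∈ (Q.map (algebraMap K (AlgebraicClosure K))).roots, a ∉ X.points := by
      intro a ha hmem
      refine (h ⟨a, hmem⟩).1 ?_
      have := Polynomial.isRoot_of_mem_roots ha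
      rwa [Polynomial.IsRoot, Polynomial.eval_map, ← Polynomial.aeval_def] at this
    simp only [key, mul_inv]
    suffices hs : ∃ φ, HasTaylor (fun x : X.points =>
        ((Multiset.map (fun a => (x : AlgebraicClosure K) - a)
          (Q.map (algebraMap K (AlgebraicClosure K))).roots).prod)⁻¹) y φ by
      obtain ⟨φ, hφ⟩ := hs
      exact ⟨_, (hasTaylor_const _ y).mul hφ⟩
    generalize (Q.map (algebraMap K (AlgebraicClosure K))).roots = s at hroots
    induction s using Multiset.induction_on with
    | empty => exact ⟨_, by simpa using hasTaylor_const 1 y⟩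
    | cons a s ih =>
      obtain ⟨φ, hφ⟩ := ih fun b hb => hroots b (Multiset.mem_cons_of_mem hb)
      obtain ⟨ψ, hψ⟩ := exists_hasTaylor_inv_sub (hroots a (Multiset.mem_cons_self a s)) y
      simp only [Multiset.map_cons, Multiset.prod_cons, mul_inv]
      exact ⟨_, hψ.mul hφ⟩
  have : f = (fun x : X.points => Polynomial.aeval (x : AlgebraicClosure K) P) *
      (fun x : X.points => (Polynomial.aeval (x : AlgebraicClosure K) Q)⁻¹) := by
    funext x
    rw [(h x).2, div_eq_mul_inv, Pi.mul_apply]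
  rw [this]
  obtain ⟨φ, hφ⟩ := exists_hasTaylor_aeval P y
  obtain ⟨ψ, hψ⟩ := hinv
  exact ⟨_, hφ.mul hψ⟩

/-- The Taylor series at `y` is unique. -/
theorem HasTaylor.unique {f : X.points → AlgebraicClosure K} {y : X.points}
    {φ ψ : PowerSeries (CompletedClosure K)} (hφ : HasTaylor f y φ) (hψ : HasTaylor f y ψ) :
    φ = ψ := by
  refine hφ.1.eq_of_evalPS_eq X.minRadius_pos hψ.1 fun ε hε => ?_
  obtain ⟨x, hx, h⟩ := exists_point_near y (lt_min hε X.minRadius_pos)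
  have hr := h.trans_le (min_le_right _ _)
  refine ⟨toCompleted ((x : AlgebraicClosure K) - (y : AlgebraicClosure K)), ?_, ?_, ?_⟩
  · rw [map_ne_zero, sub_ne_zero]
    exact fun h => hx (Subtype.ext h)
  · rw [norm_toCompleted]
    exact h.trans_le (min_le_left _ _)
  · rw [← hφ.2 x hr, hψ.2 x hr]

variable {p : ℕ} [Fact p.Prime] [CharZero K]

/-- Cauchy's estimates for Taylor coefficients. -/
theorem HasTaylor.norm_coeff_sub_le (hp : ‖(p : K)‖ < 1) {f g : X.points → AlgebraicClosure K}
    {y : X.points} {φ ψ : PowerSeries (CompletedClosure K)} (hf : HasTaylor f y φ)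
    (hg : HasTaylor g y ψ) {B : ℝ} (hB : ∀ x, ‖f x - g x‖ ≤ B) {τ : AlgebraicClosure K}
    (hτ : ‖τ‖ < X.minRadius) (k : ℕ) :
    ‖PowerSeries.coeff k φ - PowerSeries.coeff k ψ‖ * ‖τ‖ ^ k ≤ B := by
  have hψ : IsConv X.minRadius (PowerSeries.C (-1) * ψ) := (isConv_C _ _).mul hg.1
  -- Orders congruent to 1 modulo p are prime to p and arbitrarily large.
  have hroot : ∀ m, ∃ ζ : AlgebraicClosure K, IsPrimitiveRoot ζ (p * m + 1) := fun m =>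
    HasEnoughRootsOfUnity.exists_primitiveRoot (AlgebraicClosure K) (p * m + 1)
  choose ξ hξ using hroot
  have hξn : ∀ m, ‖ξ m‖ = 1 := fun m => by
    have := congrArg norm (hξ m).pow_eq_one
    rw [norm_pow, norm_one] at this
    exact (pow_eq_one_iff_of_nonneg (norm_nonneg _) (by omega)).1 this
  have hp' : ‖(p : CompletedClosure K)‖ < 1 := by
    rw [← map_natCast (toCompleted (K := K)), norm_toCompleted,
      ← map_natCast (algebraMap K (AlgebraicClosure K)), norm_algebraMap_algClosure]
    exact hp
  have key := norm_coeff_mul_le p hp' (Fact.out : p.Prime).one_le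
    (fun m => (hξ m).map_of_injective toCompleted_injective) (hf.1.add hψ)
    (τ := toCompleted τ) (by rwa [norm_toCompleted])
    ((norm_nonneg _).trans (hB y)) (fun m i => ?_) k
  · rw [map_add, PowerSeries.coeff_C_mul, norm_toCompleted] at key
    convert key using 3
    ring
  · have hn : ‖ξ m ^ i * τ‖ < X.minRadius := by
      rw [norm_mul, norm_pow, hξn, one_pow, one_mul]; exact hτ
    obtain ⟨x, hx⟩ : ∃ x : X.points, (x : AlgebraicClosure K) - y = ξ m ^ i * τ :=
      ⟨⟨y + ξ m ^ i * τ, mem_points_of_norm_sub_lt y (by simpa using hn)⟩, by simp⟩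
    have hn' : ‖toCompleted (ξ m ^ i * τ)‖ < X.minRadius := by rwa [norm_toCompleted]
    rw [← map_pow, ← map_mul, evalPS_add hf.1 hψ hn', evalPS_mul (isConv_C _ _) hg.1 hn', evalPS_C,
      ← hx, ← hf.2 x (by rwa [hx]), ← hg.2 x (by rwa [hx]), neg_one_mul, ← sub_eq_add_neg,
      ← map_sub, norm_toCompleted]
    exact hB x

/-- Cauchy's estimates turn uniform convergence of the functions into convergence of each
coefficient, with an error 1/(N+1) uniform in the degree after weighting by ‖τ‖^k. The limit series
therefore converges and still represents f. -/
theorem exists_hasTaylor_of_tendsto (hp : ‖(p : K)‖ < 1) {f : X.points → AlgebraicClosure K}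
    {g : ℕ → X.points → AlgebraicClosure K} {y : X.points}
    {φ : ℕ → PowerSeries (CompletedClosure K)} (hg : ∀ n, HasTaylor (g n) y (φ n))
    (hlim : ∀ n x, ‖f x - g n x‖ ≤ 1 / ((n : ℝ) + 1)) : ∃ ψ, HasTaylor f y ψ := by
  have he : ∀ n m : ℕ, n ≤ m → 1 / ((m : ℝ) + 1) ≤ 1 / ((n : ℝ) + 1) := fun n m h => by
    have : (n : ℝ) ≤ m := by exact_mod_cast h
    gcongr
  have hd : ∀ N n m, N ≤ n → N ≤ m → ∀ k (τ : AlgebraicClosure K), ‖τ‖ < X.minRadius →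
      ‖PowerSeries.coeff k (φ n) - PowerSeries.coeff k (φ m)‖ * ‖τ‖ ^ k ≤ 1 / ((N : ℝ) + 1) := by
    intro N n m hn hm k τ hτ
    refine (hg n).norm_coeff_sub_le hp (hg m) (fun x => ?_) hτ k
    have h := norm_algClosure_sub_le (f x - g m x) (f x - g n x)
    rw [sub_sub_sub_cancel_left] at h
    exact h.trans (max_le ((hlim m x).trans (he _ _ hm)) ((hlim n x).trans (he _ _ hn)))
  -- A single nonzero τ₀ in the disk is enough to make each coefficient sequence Cauchy.
  obtain ⟨τ₀, hτ0, hτ1⟩ := exists_norm_between (K := K) le_rfl X.minRadius_pos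
  have hc : ∀ k, ∃ c, Tendsto (fun n => PowerSeries.coeff k (φ n)) atTop (𝓝 c) := by
    intro k
    refine cauchySeq_tendsto_of_complete (cauchySeq_of_le_tendsto_0
      (fun N : ℕ => 1 / ((N : ℝ) + 1) * (‖τ₀‖ ^ k)⁻¹) (fun n m N hn hm => ?_) ?_)
    · rw [dist_eq_norm, ← div_eq_mul_inv, le_div_iff₀ (pow_pos hτ0 k)]
      exact hd N n m hn hm k τ₀ hτ1
    · simpa using tendsto_one_div_add_atTop_nhds_zero_nat.mul_const (‖τ₀‖ ^ k)⁻¹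
  choose c hc using hc
  have hcd : ∀ N k (τ : AlgebraicClosure K), ‖τ‖ < X.minRadius →
      ‖PowerSeries.coeff k (φ N) - c k‖ * ‖τ‖ ^ k ≤ 1 / ((N : ℝ) + 1) := by
    intro N k τ hτ
    refine le_of_tendsto (((tendsto_const_nhds.sub (hc k)).norm).mul_const _)
      (eventually_atTop.2 ⟨N, fun m hm => hd N N m le_rfl hm k τ hτ⟩)
  have hconv : IsConv X.minRadius (PowerSeries.mk c) := by
    intro ρ h0 h1
    -- ρ need not be the norm of an element, so the estimate is used at a τ of slightly larger norm.
    obtain ⟨τ, h2, h3⟩ := exists_norm_between (K := K) h0.le h1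
    obtain ⟨B, hB⟩ := (hg 0).1 ρ h0 h1
    refine ⟨1 / ((0 : ℕ) + 1) + B, fun k => ?_⟩
    rw [PowerSeries.coeff_mk]
    calc ‖c k‖ * ρ ^ k
      ≤ (‖PowerSeries.coeff k (φ 0) - c k‖ + ‖PowerSeries.coeff k (φ 0)‖) * ρ ^ k := by
          gcongr
          have := norm_sub_le (PowerSeries.coeff k (φ 0)) (PowerSeries.coeff k (φ 0) - c k)
          rw [sub_sub_cancel] at this
          linarith
      _ = ‖PowerSeries.coeff k (φ 0) - c k‖ * ρ ^ k + ‖PowerSeries.coeff k (φ 0)‖ * ρ ^ k := by ring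
      _ ≤ ‖PowerSeries.coeff k (φ 0) - c k‖ * ‖τ‖ ^ k + B := by
          gcongr
          exact hB k
      _ ≤ _ := by
          gcongr
          exact hcd 0 k τ h3
  refine ⟨PowerSeries.mk c, hconv, fun x hx => ?_⟩
  have hx' : ‖toCompleted ((x : AlgebraicClosure K) - (y : AlgebraicClosure K))‖ < X.minRadius := by
    rwa [norm_toCompleted]
  set t := toCompleted ((x : AlgebraicClosure K) - (y : AlgebraicClosure K)) with ht
  rw [← sub_eq_zero, ← norm_le_zero_iff]
  have hlim2 := (tendsto_one_div_add_atTop_nhds_zero_nat (𝕜 := ℝ)).const_mul 2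
  rw [mul_zero] at hlim2
  refine ge_of_tendsto' hlim2 fun n => ?_
  have hc1 : IsConv X.minRadius (PowerSeries.C (-1) * PowerSeries.mk c) := (isConv_C _ _).mul hconv
  have e1 : evalPS (φ n + PowerSeries.C (-1) * PowerSeries.mk c) t =
      toCompleted (g n x) - evalPS (PowerSeries.mk c) t := by
    rw [evalPS_add (hg n).1 hc1 hx', evalPS_mul (isConv_C _ _) hconv hx', evalPS_C, (hg n).2 x hx]
    ring
  have e2 : ‖evalPS (φ n + PowerSeries.C (-1) * PowerSeries.mk c) t‖ ≤ 1 / ((n : ℝ) + 1) := by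
    refine norm_evalPS_le (by positivity) fun k => ?_
    rw [map_add, PowerSeries.coeff_C_mul, PowerSeries.coeff_mk, neg_one_mul, ← sub_eq_add_neg, ht,
      norm_toCompleted]
    exact hcd n k _ hx
  have e3 : toCompleted (f x) - evalPS (PowerSeries.mk c) t =
      toCompleted (f x - g n x) + (toCompleted (g n x) - evalPS (PowerSeries.mk c) t) := by
    rw [map_sub]; ring
  rw [e3, ← e1]
  refine (norm_add_le _ _).trans ?_
  rw [norm_toCompleted]
  linarith [hlim n x]

theorem exists_hasTaylor (hp : ‖(p : K)‖ < 1) (f : X.H) (y : X.points) :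
    ∃ φ, HasTaylor f.1 y φ := by
  have h : ∀ n : ℕ, ∃ g ∈ X.rational, ∀ x, ‖f.1 x - g x‖ < 1 / ((n : ℝ) + 1) := fun n =>
    f.2 _ (by positivity)
  choose g hg hlim using h
  choose φ hφ using fun n => exists_hasTaylor_of_mem_rational (hg n) y
  exact exists_hasTaylor_of_tendsto hp hφ fun n x => (hlim n x).le

/-! ### The Taylor morphism and derivatives of analytic elements -/

section Taylor

variable {K : Type u} [NontriviallyNormedField K] [IsUltrametricDist K] [CompleteSpace K]
variable {X : Affinoid K}

theorem aeval_T_apply (P : Polynomial K) (x : X.points) :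
    (Polynomial.aeval X.T P : X.H).1 x = Polynomial.aeval (x : AlgebraicClosure K) P :=
  (Polynomial.aeval_algHom_apply ((Pi.evalAlgHom K (fun _ : X.points => AlgebraicClosure K) x).comp
    X.analytic.val) X.T P).symm

theorem rational_le_analytic : X.rational ≤ X.analytic := fun f hf ε hε =>
  ⟨f, hf, fun x => by simpa using hε⟩

theorem apply_mem_adjoin_of_mem_rational {f : X.points → AlgebraicClosure K} (hf : f ∈ X.rational)
    (x : X.points) {s : Set (AlgebraicClosure K)} (hx : (x : AlgebraicClosure K) ∈ s) :
    f x ∈ IntermediateField.adjoin K s := by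
  obtain ⟨P, Q, h⟩ := hf
  have hP : ∀ P : Polynomial K, Polynomial.aeval (x : AlgebraicClosure K) P ∈
      IntermediateField.adjoin K s := fun P =>
    IntermediateField.algebra_adjoin_le_adjoin K s
      (Algebra.adjoin_mono (Set.singleton_subset_iff.2 hx)
        (Polynomial.aeval_mem_adjoin_singleton K _))
  rw [(h x).2]
  exact div_mem (hP P) (hP Q)

/-- f(x) is a limit of values of rational fractions with coefficients in K, all in a finite
extension of K, which is closed. -/
theorem apply_mem_adjoin (f : X.H) (x : X.points) (s : Finset (AlgebraicClosure K))
    (hx : (x : AlgebraicClosure K) ∈ s) :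
    f.1 x ∈ IntermediateField.adjoin K (s : Set (AlgebraicClosure K)) := by
  have h : toCompleted (f.1 x) ∈ toCompleted '' (IntermediateField.adjoin K
      (s : Set (AlgebraicClosure K)) : Set (AlgebraicClosure K)) := by
    rw [← (isClosed_image_adjoin s).closure_eq, Metric.mem_closure_iff]
    intro ε hε
    obtain ⟨g, hg, hd⟩ := f.2 ε hε
    refine ⟨_, ⟨g x, apply_mem_adjoin_of_mem_rational hg x hx, rfl⟩, ?_⟩
    rw [dist_eq_norm, ← map_sub, norm_toCompleted]
    exact hd x
  obtain ⟨l, hl, e⟩ := h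
  rwa [← toCompleted_injective e]

variable {p : ℕ} [Fact p.Prime] [CharZero K]

/-- The ring homomorphism sending an analytic element to its Taylor series at `y`. -/
def taylor (hp : ‖(p : K)‖ < 1) (y : X.points) : X.H →+* PowerSeries (CompletedClosure K) where
  toFun f := (exists_hasTaylor hp f y).choose
  -- Although the series is obtained by choice, its uniqueness makes the map a ring morphism.
  map_one' := (exists_hasTaylor hp 1 y).choose_spec.unique
    (by simpa [Pi.one_def] using hasTaylor_const 1 y)
  map_zero' := (exists_hasTaylor hp 0 y).choose_spec.unique
    (by simpa [Pi.zero_def] using hasTaylor_const 0 y)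
  map_add' f g := (exists_hasTaylor hp (f + g) y).choose_spec.unique
    ((exists_hasTaylor hp f y).choose_spec.add (exists_hasTaylor hp g y).choose_spec)
  map_mul' f g := (exists_hasTaylor hp (f * g) y).choose_spec.unique
    ((exists_hasTaylor hp f y).choose_spec.mul (exists_hasTaylor hp g y).choose_spec)

variable (hp : ‖(p : K)‖ < 1)

theorem hasTaylor_taylor (y : X.points) (f : X.H) : HasTaylor f.1 y (taylor hp y f) :=
  (exists_hasTaylor hp f y).choose_spec

theorem constantCoeff_taylor (y : X.points) (f : X.H) :
    PowerSeries.constantCoeff (taylor hp y f) = toCompleted (f.1 y) := by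
  rw [(hasTaylor_taylor hp y f).2 y (by simpa using X.minRadius_pos), sub_self, map_zero,
    evalPS_zero_right]

theorem taylor_eq_recenter {x y : X.points}
    (h : ‖(x : AlgebraicClosure K) - (y : AlgebraicClosure K)‖ < X.minRadius) (f : X.H) :
    taylor hp x f = recenter (taylor hp y f)
      (toCompleted ((x : AlgebraicClosure K) - (y : AlgebraicClosure K))) := by
  have hy := hasTaylor_taylor hp y f
  have h' : ‖toCompleted ((x : AlgebraicClosure K) - (y : AlgebraicClosure K))‖ < X.minRadius := by
    rwa [norm_toCompleted]
  refine (hasTaylor_taylor hp x f).unique ⟨hy.1.recenter h', fun z hz => ?_⟩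
  have e : (z : AlgebraicClosure K) - (y : AlgebraicClosure K) =
      ((x : AlgebraicClosure K) - (y : AlgebraicClosure K)) +
      ((z : AlgebraicClosure K) - (x : AlgebraicClosure K)) := by ring
  rw [evalPS_recenter hy.1 h' (by rwa [norm_toCompleted]), ← map_add, ← e]
  refine hy.2 z ?_
  rw [e]
  exact (norm_algClosure_add_le _ _).trans_lt (max_lt h hz)

theorem tendsto_slope_taylor (f : X.H) (x : X.points) :
    Tendsto (fun z : X.points => toCompleted ((f.1 z - f.1 x) /
      ((z : AlgebraicClosure K) - (x : AlgebraicClosure K)))) (𝓝[≠] x)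
      (𝓝 (PowerSeries.coeff 1 (taylor hp x f))) := by
  have ht : Tendsto (fun z : X.points =>
      toCompleted ((z : AlgebraicClosure K) - (x : AlgebraicClosure K))) (𝓝[≠] x) (𝓝 0) := by
    have hc : Continuous fun z : X.points =>
        toCompleted ((z : AlgebraicClosure K) - (x : AlgebraicClosure K)) :=
      isometry_toCompleted.continuous.comp (continuous_subtype_val.sub continuous_const)
    have := (hc.tendsto x).mono_left (nhdsWithin_le_nhds (s := {x}ᶜ))
    simpa using this
  have hne : ∀ᶠ z : X.points in 𝓝[≠] x,
      toCompleted ((z : AlgebraicClosure K) - (x : AlgebraicClosure K)) ≠ 0 := by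
    filter_upwards [self_mem_nhdsWithin] with z hz
    rw [map_ne_zero, sub_ne_zero]
    exact fun h => hz (Subtype.ext h)
  have hf := hasTaylor_taylor hp x f
  refine (tendsto_slope_evalPS_zero X.minRadius_pos hf.1 ht hne).congr' ?_
  have hev := ht.norm.eventually_lt_const (u := X.minRadius) (by simpa using X.minRadius_pos)
  filter_upwards [hev] with z hz
  rw [norm_toCompleted] at hz
  rw [map_div₀, map_sub (toCompleted (K := K)) (f.1 z), constantCoeff_taylor, hf.2 z hz]

/-- Difference quotients converge to the linear Taylor coefficient in the completion, and the
embedding of K^alg reflects limits. Derivatives thus become algebra on power series. -/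
theorem isDeriv_iff {f g : X.H} :
    X.IsDeriv f g ↔ ∀ x, toCompleted (g.1 x) = PowerSeries.coeff 1 (taylor hp x f) := by
  refine forall_congr' fun x => ?_
  rw [isometry_toCompleted.isEmbedding.tendsto_nhds_iff]
  constructor
  · exact fun h => tendsto_nhds_unique h (tendsto_slope_taylor hp f x)
  · intro h
    rw [h]
    exact tendsto_slope_taylor hp f x

/-- At a nearby x, the value of the formal derivative is the linear coefficient of the series
recentred at x, hence the derivative of f at x; uniqueness concludes. -/
theorem derivative_taylor {f g : X.H} (h : X.IsDeriv f g) (y : X.points) :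
    PowerSeries.derivative _ (taylor hp y f) = taylor hp y g := by
  have hf := hasTaylor_taylor hp y f
  refine HasTaylor.unique (f := g.1) ⟨hf.1.derivative, fun x hx => ?_⟩ (hasTaylor_taylor hp y g)
  rw [(isDeriv_iff hp).1 h x, taylor_eq_recenter hp hx, coeff_one_recenter]

theorem taylor_T (y : X.points) : taylor hp y X.T =
    PowerSeries.C (toCompleted (y : AlgebraicClosure K)) + PowerSeries.X :=
  (hasTaylor_taylor hp y X.T).unique (hasTaylor_coe y)

theorem taylor_algebraMap (y : X.points) (a : K) : taylor hp y (algebraMap K X.H a) =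
    PowerSeries.C (toCompleted (algebraMap K (AlgebraicClosure K) a)) :=
  (hasTaylor_taylor hp y _).unique (hasTaylor_const _ y)

theorem derivative_taylor_aeval (P : Polynomial K) (y : X.points) :
    PowerSeries.derivative _ (taylor hp y (Polynomial.aeval X.T P)) =
      taylor hp y (Polynomial.aeval X.T (Polynomial.derivative P)) := by
  induction P using Polynomial.induction_on with
  | C a => simp [taylor_algebraMap]
  | add P Q hP hQ => simp only [map_add, hP, hQ]
  | monomial n a h =>
    rw [pow_succ, ← mul_assoc, map_mul, map_mul, Derivation.leibniz, h]
    simp only [Polynomial.aeval_X, Polynomial.derivative_mul, map_add, map_mul, taylor_T,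
      PowerSeries.derivative_C, PowerSeries.derivative_X, smul_eq_mul, Polynomial.derivative_X,
      map_one]
    ring

theorem exists_deriv_of_mem_rational {f : X.points → AlgebraicClosure K} (hf : f ∈ X.rational) :
    ∃ g ∈ X.rational, ∀ x, toCompleted (g x) =
      PowerSeries.coeff 1 (taylor hp x ⟨f, rational_le_analytic hf⟩) := by
  obtain ⟨P, Q, h⟩ := id hf
  refine ⟨fun x => Polynomial.aeval (x : AlgebraicClosure K)
    (Polynomial.derivative P * Q - P * Polynomial.derivative Q) /
      Polynomial.aeval (x : AlgebraicClosure K) (Q * Q), ⟨_, _, fun x => ⟨?_, rfl⟩⟩, fun x => ?_⟩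
  · rw [map_mul]
    exact mul_ne_zero (h x).1 (h x).1
  · have hPQ : (⟨f, rational_le_analytic hf⟩ : X.H) * Polynomial.aeval X.T Q =
        Polynomial.aeval X.T P := by
      ext z
      have e : (((⟨f, rational_le_analytic hf⟩ : X.H) * Polynomial.aeval X.T Q : X.H)).1 z =
        f z * (Polynomial.aeval X.T Q : X.H).1 z := rfl
      change (((⟨f, rational_le_analytic hf⟩ : X.H) * Polynomial.aeval X.T Q : X.H)).1 z =
        (Polynomial.aeval X.T P : X.H).1 z
      rw [e, aeval_T_apply, aeval_T_apply, (h z).2, div_mul_cancel₀ _ (h z).1]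
    have e := congrArg (fun F => PowerSeries.constantCoeff
      (PowerSeries.derivative _ (taylor hp x F))) hPQ
    have e1 : PowerSeries.constantCoeff (PowerSeries.derivative _
        (taylor hp x ⟨f, rational_le_analytic hf⟩)) =
        PowerSeries.coeff 1 (taylor hp x ⟨f, rational_le_analytic hf⟩) := by
      rw [← PowerSeries.coeff_zero_eq_constantCoeff_apply, PowerSeries.coeff_derivative]
      simp
    have hQ0 : toCompleted (Polynomial.aeval (x : AlgebraicClosure K) Q) ≠ 0 := by
      rw [map_ne_zero]; exact (h x).1
    simp only [map_mul, Derivation.leibniz, map_add, smul_eq_mul, derivative_taylor_aeval, e1,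
      constantCoeff_taylor, aeval_T_apply, (h x).2, map_div₀] at e
    simp only [map_div₀, map_sub, map_mul]
    field_simp at e ⊢
    linear_combination -e

/-- The derivative of an analytic element is an analytic element. -/
theorem exists_isDeriv (hp : ‖(p : K)‖ < 1) (f : X.H) : ∃ g : X.H, X.IsDeriv f g := by
  obtain ⟨τ, hτ0, hτ1⟩ := exists_norm_between (K := K) le_rfl X.minRadius_pos
  -- Cauchy's estimate in degree 1: derivatives of rational approximants converge uniformly. The
  -- tolerance ε‖τ‖/2 on f absorbs the division by ‖τ‖.
  have key : ∀ ε : ℝ, 0 < ε → ∃ h ∈ X.rational, ∀ x,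
      ‖PowerSeries.coeff 1 (taylor hp x f) - toCompleted (h x)‖ < ε := by
    intro ε hε
    obtain ⟨g, hg, hd⟩ := f.2 (ε * ‖τ‖ / 2) (by positivity)
    obtain ⟨h, hh, he⟩ := exists_deriv_of_mem_rational hp hg
    refine ⟨h, hh, fun x => ?_⟩
    have := (hasTaylor_taylor hp x f).norm_coeff_sub_le hp
      (hasTaylor_taylor hp x ⟨g, rational_le_analytic hg⟩) (fun z => (hd z).le) hτ1 1
    rw [he x]
    rw [pow_one] at this
    nlinarith
  -- The linear coefficient lives a priori in the completion; being a limit of elements of the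
  -- finite extension K(x), it lies in K^alg.
  have hl : ∀ x : X.points, ∃ l, toCompleted l = PowerSeries.coeff 1 (taylor hp x f) := by
    intro x
    have : PowerSeries.coeff 1 (taylor hp x f) ∈ toCompleted '' (IntermediateField.adjoin K
        (({(x : AlgebraicClosure K)} : Finset (AlgebraicClosure K)) : Set (AlgebraicClosure K)) :
        Set (AlgebraicClosure K)) := by
      rw [← (isClosed_image_adjoin _).closure_eq, Metric.mem_closure_iff]
      intro ε hε
      obtain ⟨h, hh, hd⟩ := key ε hε
      refine ⟨_, ⟨h x, apply_mem_adjoin_of_mem_rational hh x (by simp), rfl⟩, ?_⟩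
      rw [dist_eq_norm]
      exact hd x
    obtain ⟨l, -, e⟩ := this
    exact ⟨l, e⟩
  choose g hg using hl
  refine ⟨⟨g, fun ε hε => ?_⟩, (isDeriv_iff hp).2 hg⟩
  obtain ⟨h, hh, hd⟩ := key ε hε
  refine ⟨h, hh, fun x => ?_⟩
  rw [← norm_toCompleted, map_sub, hg]
  exact hd x

/-- An analytic element vanishing away from `0` is zero. -/
theorem eq_zero_of_apply_eq_zero (hp : ‖(p : K)‖ < 1) (f : X.H)
    (h : ∀ x : X.points, (x : AlgebraicClosure K) ≠ 0 → f.1 x = 0) : f = 0 := by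
  have key : ∀ x : X.points, taylor hp x f = 0 := by
    intro x
    refine (hasTaylor_taylor hp x f).1.eq_zero X.minRadius_pos fun ε hε => ?_
    have hε' : 0 < min ε X.minRadius := lt_min hε X.minRadius_pos
    -- Points of X accumulate at x even after 0 is removed, whether or not x = 0.
    obtain ⟨z, hzx, hz0, hz⟩ : ∃ z : X.points, z ≠ x ∧ (z : AlgebraicClosure K) ≠ 0 ∧
        ‖(z : AlgebraicClosure K) - (x : AlgebraicClosure K)‖ < min ε X.minRadius := by
      by_cases hx : (x : AlgebraicClosure K) = 0
      · obtain ⟨z, h1, h2⟩ := exists_point_near x hε'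
        refine ⟨z, h1, fun h => h1 (Subtype.ext (h.trans hx.symm)), h2⟩
      · obtain ⟨z, h1, h2⟩ := exists_point_near x (lt_min hε' (norm_pos_iff.2 hx))
        refine ⟨z, h1, fun h => ?_, h2.trans_le (min_le_left _ _)⟩
        rw [h, zero_sub, norm_neg] at h2
        exact absurd (h2.trans_le (min_le_right _ _)) (lt_irrefl _)
    have hr := hz.trans_le (min_le_right _ _)
    refine ⟨toCompleted ((z : AlgebraicClosure K) - (x : AlgebraicClosure K)), ?_, ?_, ?_⟩
    · rw [map_ne_zero, sub_ne_zero]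
      exact fun h => hzx (Subtype.ext h)
    · rw [norm_toCompleted]
      exact hz.trans_le (min_le_left _ _)
    · rw [← (hasTaylor_taylor hp x f).2 z hr, h z hz0, map_zero]
  ext x
  have := constantCoeff_taylor hp x f
  rw [key x, map_zero] at this
  exact (map_eq_zero _).1 this.symm

end Taylor

end Affinoid

/-! ## Matrices of power series -/

section MatrixSeries

open PowerSeries

variable {E : Type*} [NormedField E] {l m n : Type*}

/-- The value at `t` of a matrix of power series. -/
def evalMat (Φ : Matrix m n (PowerSeries E)) (t : E) : Matrix m n E := Φ.map fun φ => evalPS φ t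

/-- A matrix of power series converges on the open disk of radius `R`. -/
def IsConvMat (R : ℝ) (Φ : Matrix m n (PowerSeries E)) : Prop := ∀ i j, IsConv R (Φ i j)

theorem IsConvMat.mul [IsUltrametricDist E] [Fintype m] {R : ℝ} {Φ : Matrix l m (PowerSeries E)}
    {Ψ : Matrix m n (PowerSeries E)} (hΦ : IsConvMat R Φ) (hΨ : IsConvMat R Ψ) :
    IsConvMat R (Φ * Ψ) := fun i j => by
  rw [Matrix.mul_apply]
  exact IsConv.sum _ fun k _ => (hΦ i k).mul (hΨ k j)

theorem evalMat_mul [IsUltrametricDist E] [CompleteSpace E] [Fintype m] {R : ℝ}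
    {Φ : Matrix l m (PowerSeries E)} {Ψ : Matrix m n (PowerSeries E)} (hΦ : IsConvMat R Φ)
    (hΨ : IsConvMat R Ψ) {t : E} (ht : ‖t‖ < R) :
    evalMat (Φ * Ψ) t = evalMat Φ t * evalMat Ψ t := by
  ext i j
  simp only [evalMat, Matrix.map_apply, Matrix.mul_apply]
  rw [evalPS_sum _ (fun k _ => (hΦ i k).mul (hΨ k j)) ht]
  exact Finset.sum_congr rfl fun k _ => evalPS_mul (hΦ i k) (hΨ k j) ht

theorem isConvMat_map_C (R : ℝ) (A : Matrix m n E) : IsConvMat R (A.map (C (R := E))) :=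
  fun i j => isConv_C R (A i j)

theorem evalMat_map_C (A : Matrix m n E) (t : E) : evalMat (A.map (C (R := E))) t = A := by
  ext i j
  exact evalPS_C _ _

theorem derivative_mul_apply [Fintype m] (Φ : Matrix l m (PowerSeries E))
    (Ψ : Matrix m n (PowerSeries E)) (i : l) (j : n) :
    derivative E ((Φ * Ψ) i j) =
      (Φ.map (derivative E) * Ψ + Φ * Ψ.map (derivative E)) i j := by
  simp only [Matrix.mul_apply, Matrix.add_apply, map_sum, Derivation.leibniz, smul_eq_mul,
    Finset.sum_add_distrib, Matrix.map_apply]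
  rw [add_comm]
  congr 1
  exact Finset.sum_congr rfl fun _ _ => mul_comm _ _

/-- The recursion is designed so that (M_k Y)' = (M_{k+1} - M_k D)Y + M_k D Y = M_{k+1} Y. It is
applied to M_k = D_k for the cocycle relation and to M_k = D_k P for morphisms. -/
theorem mul_eq_iterate_derivative [Fintype n] {D Y : Matrix n n (PowerSeries E)}
    (hY : Y.map (derivative E) = D * Y) {M : ℕ → Matrix m n (PowerSeries E)}
    (hM : ∀ k, (M k).map (derivative E) = M (k + 1) - M k * D) (k : ℕ) (i : m) (j : n) :
    (M k * Y) i j = (derivative E)^[k] ((M 0 * Y) i j) := by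
  induction k with
  | zero => rfl
  | succ k ih =>
    rw [Function.iterate_succ_apply', ← ih, derivative_mul_apply, hM, hY, Matrix.sub_mul,
      Matrix.mul_assoc, sub_add_cancel]

variable [Fintype n] [DecidableEq n] [CharZero E]

/-- The series with coefficients `D_k(0) / k!` is a fundamental solution of `Y' = D_1 Y`, where
`D_0 = 1` and `D_{k+1} = D_k' + D_k D_1`. -/
theorem derivative_eq_mul_of_coeff {D : ℕ → Matrix n n (PowerSeries E)} (h0 : D 0 = 1)
    (hD : ∀ k, (D k).map (derivative E) = D (k + 1) - D k * D 1) {Y : Matrix n n (PowerSeries E)}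
    (hY : ∀ k i j, (k.factorial : E) * coeff k (Y i j) = constantCoeff (D k i j)) :
    Y.map (derivative E) = D 1 * Y := by
  have hY0 : ∀ i j, constantCoeff (Y i j) = (1 : Matrix n n E) i j := by
    intro i j
    have := hY 0 i j
    rw [h0] at this
    simp only [Nat.factorial_zero, Nat.cast_one, one_mul, coeff_zero_eq_constantCoeff_apply] at this
    rw [this, Matrix.one_apply, Matrix.one_apply]
    split_ifs <;> simp
  -- Induction on the degree m for all k at once; the case k = 1 is the differential equation.
  have key : ∀ m k i j, (m.factorial : E) * coeff m ((D k * Y) i j) =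
      constantCoeff (D (k + m) i j) := by
    intro m
    induction m using Nat.strong_induction_on with
    | _ m ih =>
      intro k i j
      rcases m with _ | m
      · simp only [Nat.factorial_zero, Nat.cast_one, one_mul, coeff_zero_eq_constantCoeff_apply,
          Matrix.mul_apply, map_sum, map_mul, hY0, add_zero]
        exact congrFun (congrFun (Matrix.mul_one ((D k).map constantCoeff)) i) j
      -- The induction hypothesis for k = 1 already gives Y' = D_1 Y in degrees at most m.
      · have hz : ∀ a b, ∀ c ≤ m, coeff c ((Y.map (derivative E) - D 1 * Y) a b) = 0 := by
          intro a b c hc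
          have h1 := ih c (by omega) 1 a b
          have h2 := hY (c + 1) a b
          rw [add_comm 1 c, ← h2, Nat.factorial_succ] at h1
          have h3 : (c.factorial : E) ≠ 0 := Nat.cast_ne_zero.2 c.factorial_ne_zero
          rw [Matrix.sub_apply, map_sub, Matrix.map_apply, coeff_derivative]
          push_cast at h1
          refine mul_left_cancel₀ h3 ?_
          linear_combination -h1
        have hz' : coeff m ((D k * (Y.map (derivative E) - D 1 * Y)) i j) = 0 := by
          rw [Matrix.mul_apply, map_sum]
          refine Finset.sum_eq_zero fun a _ => ?_
          rw [coeff_mul]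
          refine Finset.sum_eq_zero fun x hx => ?_
          have := Finset.HasAntidiagonal.mem_antidiagonal.1 hx
          rw [hz a j x.2 (by omega), mul_zero]
        -- The last term vanishes in degree m, so the coefficient of degree m + 1 for k is reduced
        -- to that of degree m for k + 1.
        have e : derivative E ((D k * Y) i j) =
            (D (k + 1) * Y) i j + (D k * (Y.map (derivative E) - D 1 * Y)) i j := by
          have e3 : (D (k + 1) - D k * D 1) * Y + D k * Y.map (derivative E) =
              D (k + 1) * Y + D k * (Y.map (derivative E) - D 1 * Y) := by noncomm_ring
          rw [derivative_mul_apply, hD, e3, Matrix.add_apply]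
        have e2 := congrArg (coeff m) e
        rw [map_add, hz', add_zero, coeff_derivative] at e2
        rw [Nat.factorial_succ, show k + (m + 1) = k + 1 + m by ring, ← ih m (by omega), ← e2]
        push_cast
        ring
  ext i j m
  have h1 := key m 1 i j
  have h2 := hY (m + 1) i j
  rw [add_comm 1 m, ← h2, Nat.factorial_succ] at h1
  have h3 : (m.factorial : E) ≠ 0 := Nat.cast_ne_zero.2 m.factorial_ne_zero
  rw [Matrix.map_apply, coeff_derivative]
  push_cast at h1
  refine mul_left_cancel₀ h3 ?_
  linear_combination -h1

end MatrixSeries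

/-! ## Functions near the diagonal -/

namespace Affinoid

section NearDiag

variable {K : Type u} [NontriviallyNormedField K] [IsUltrametricDist K] [CompleteSpace K]
variable {X : Affinoid K} {n : ℕ}

theorem isBdd_of_mem_analytic (f : X.H) : X.IsBdd f.1 := by
  obtain ⟨g, hg, hd⟩ := f.2 1 one_pos
  obtain ⟨C, hC⟩ := X.isBdd_of_mem_rational hg
  refine ⟨1 + C, fun x => ?_⟩
  have h := norm_add_le (f.1 x - g x) (g x)
  rw [sub_add_cancel] at h
  linarith [hd x, hC x]

theorem norm_apply_le_supNorm (f : X.H) (x : X.points) : ‖f.1 x‖ ≤ X.supNorm f := by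
  obtain ⟨C, hC⟩ := isBdd_of_mem_analytic f
  exact le_ciSup (f := fun x => ‖f.1 x‖) ⟨C, by rintro _ ⟨y, rfl⟩; exact hC y⟩ x

theorem mem_analytic_of_approx {f : X.points → AlgebraicClosure K}
    (h : ∀ ε > 0, ∃ g : X.H, ∀ x, ‖f x - g.1 x‖ ≤ ε) : f ∈ X.analytic := by
  intro ε hε
  obtain ⟨g, hg⟩ := h (ε / 2) (by positivity)
  obtain ⟨k, hk, hd⟩ := g.2 (ε / 2) (by positivity)
  refine ⟨k, hk, fun x => ?_⟩
  have e := norm_add_le (f x - g.1 x) (g.1 x - k x)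
  rw [sub_add_sub_cancel] at e
  linarith [hg x, hd x]

/-- The matrix of power series `∑ₖ Fₖ(y) tᵏ`. -/
def diagSeries (F : ℕ → Matrix (Fin n) (Fin n) X.H) (y : X.points) :
    Matrix (Fin n) (Fin n) (PowerSeries (CompletedClosure K)) :=
  fun i j => PowerSeries.mk fun k => toCompleted ((F k i j).1 y)

theorem coeff_diagSeries (F : ℕ → Matrix (Fin n) (Fin n) X.H) (y : X.points) (k : ℕ)
    (i j : Fin n) :
    PowerSeries.coeff k (diagSeries F y i j) = toCompleted ((F k i j).1 y) :=
  PowerSeries.coeff_mk _ _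

theorem isConvMat_diagSeries {F : ℕ → Matrix (Fin n) (Fin n) X.H} {R : ℝ}
    (hF : ConvergesOn F R) (y : X.points) : IsConvMat R (diagSeries F y) := by
  intro i j ρ h0 h1
  obtain ⟨B, hB⟩ := (hF i j ρ h0.le h1).bddAbove_range
  refine ⟨B, fun k => ?_⟩
  rw [coeff_diagSeries, norm_toCompleted]
  exact (mul_le_mul_of_nonneg_right (norm_apply_le_supNorm _ y) (by positivity)).trans
    (hB ⟨k, rfl⟩)

/-- Partial sums stay in the closed subfield K(x,y), so the series is summable in K^alg itself and
its `tsum` there is the true sum, not the default value 0. -/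
theorem toCompleted_evalNearDiag {F : ℕ → Matrix (Fin n) (Fin n) X.H} {R : ℝ}
    (hF : ConvergesOn F R) {x y : X.points}
    (h : ‖(x : AlgebraicClosure K) - (y : AlgebraicClosure K)‖ < R) :
    (evalNearDiag F x y).map toCompleted = evalMat (diagSeries F y)
      (toCompleted ((x : AlgebraicClosure K) - (y : AlgebraicClosure K))) := by
  classical
  ext i j
  have hs := (isConvMat_diagSeries hF y i j).hasSum (t := toCompleted
    ((x : AlgebraicClosure K) - (y : AlgebraicClosure K))) (by rwa [norm_toCompleted])
  have e : (fun k => PowerSeries.coeff k (diagSeries F y i j) * toCompleted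
      ((x : AlgebraicClosure K) - (y : AlgebraicClosure K)) ^ k) = toCompleted ∘ fun k =>
      (F k i j).1 y * ((x : AlgebraicClosure K) - (y : AlgebraicClosure K)) ^ k := by
    funext k
    simp [coeff_diagSeries]
  rw [e] at hs
  let s : Finset (AlgebraicClosure K) := {(x : AlgebraicClosure K), (y : AlgebraicClosure K)}
  have hx : (x : AlgebraicClosure K) ∈ s := by simp [s]
  have hy : (y : AlgebraicClosure K) ∈ s := by simp [s]
  have hmem : evalPS (diagSeries F y i j) (toCompleted
      ((x : AlgebraicClosure K) - (y : AlgebraicClosure K))) ∈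
      toCompleted '' (IntermediateField.adjoin K (s : Set (AlgebraicClosure K)) :
        Set (AlgebraicClosure K)) := by
    refine (isClosed_image_adjoin s).mem_of_tendsto hs (Eventually.of_forall fun t => ?_)
    refine ⟨∑ k ∈ t, (F k i j).1 y * ((x : AlgebraicClosure K) - (y : AlgebraicClosure K)) ^ k,
      sum_mem fun k _ => mul_mem (apply_mem_adjoin _ y s hy) (pow_mem (sub_mem ?_ ?_) k), ?_⟩
    · exact IntermediateField.subset_adjoin K _ hx
    · exact IntermediateField.subset_adjoin K _ hy
    · rw [map_sum]; rfl
  obtain ⟨l, -, hl⟩ := hmem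
  rw [← hl, isometry_toCompleted.isEmbedding.isInducing.hasSum_iff] at hs
  change toCompleted (∑' k, _) = evalPS _ _
  rw [hs.tsum_eq, hl]

theorem evalNearDiag_self {F : ℕ → Matrix (Fin n) (Fin n) X.H} (h0 : F 0 = 1) (x : X.points) :
    evalNearDiag F x x = 1 := by
  ext i j
  rw [evalNearDiag, tsum_eq_single 0]
  · rw [h0, pow_zero, mul_one, Matrix.one_apply, Matrix.one_apply]
    split_ifs <;> rfl
  · intro k hk
    rw [sub_self, zero_pow hk, mul_zero]

theorem map_toCompleted_injective : Function.Injective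
    fun A : Matrix (Fin n) (Fin n) (AlgebraicClosure K) => A.map (toCompleted (K := K)) :=
  Matrix.map_injective toCompleted_injective

/-- `Y(x, z) = Y(x, y) Y(y, z)` for `x`, `y`, `z` in a common disk of radius `R`, `y ≠ 0`. -/
def IsCocycle (F : ℕ → Matrix (Fin n) (Fin n) X.H) (R : ℝ) : Prop :=
  ∀ x y z : X.points, (y : AlgebraicClosure K) ≠ 0 →
    ‖(x : AlgebraicClosure K) - (y : AlgebraicClosure K)‖ < R →
    ‖(y : AlgebraicClosure K) - (z : AlgebraicClosure K)‖ < R →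
    evalNearDiag F x z = evalNearDiag F x y * evalNearDiag F y z

/-- A function near the diagonal is a cocycle as soon as its expansion at `z`, recentered at `y`, is
its expansion at `y` times a constant. -/
theorem isCocycle_of_recenter {F : ℕ → Matrix (Fin n) (Fin n) X.H} {R : ℝ}
    (hF : ConvergesOn F R)
    (h : ∀ y z : X.points, (y : AlgebraicClosure K) ≠ 0 →
      ‖(y : AlgebraicClosure K) - (z : AlgebraicClosure K)‖ < R → ∀ i j,
      recenter (diagSeries F z i j)
        (toCompleted ((y : AlgebraicClosure K) - (z : AlgebraicClosure K))) =
      (diagSeries F y * ((evalNearDiag F y z).map toCompleted).map PowerSeries.C) i j) :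
    IsCocycle F R := by
  intro x y z hy hxy hyz
  have hxz : ‖(x : AlgebraicClosure K) - (z : AlgebraicClosure K)‖ < R := by
    have := norm_algClosure_add_le ((x : AlgebraicClosure K) - (y : AlgebraicClosure K))
      ((y : AlgebraicClosure K) - (z : AlgebraicClosure K))
    rw [sub_add_sub_cancel] at this
    exact this.trans_lt (max_lt hxy hyz)
  have hxy' : ‖toCompleted ((x : AlgebraicClosure K) - (y : AlgebraicClosure K))‖ < R := by
    rwa [norm_toCompleted]
  refine map_toCompleted_injective ?_
  change (evalNearDiag F x z).map toCompleted = _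
  simp only [Matrix.map_mul]
  rw [toCompleted_evalNearDiag hF hxy, ← evalMat_map_C ((evalNearDiag F y z).map toCompleted)
    (toCompleted ((x : AlgebraicClosure K) - (y : AlgebraicClosure K))),
    ← evalMat_mul (isConvMat_diagSeries hF y) (isConvMat_map_C R _) hxy',
    toCompleted_evalNearDiag hF hxz]
  ext i j
  change evalPS (diagSeries F z i j) _ = evalPS ((diagSeries F y *
    ((evalNearDiag F y z).map toCompleted).map PowerSeries.C) i j) _
  rw [← h y z hy hyz i j, evalPS_recenter (isConvMat_diagSeries hF z i j)
    (by rwa [norm_toCompleted]) hxy', ← map_add]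
  congr 2
  ring

theorem toCompleted_smul_apply (c : K) (f : X.H) (x : X.points) : toCompleted ((c • f).1 x) =
    toCompleted (algebraMap K (AlgebraicClosure K) c) * toCompleted (f.1 x) := by
  rw [← map_mul, ← Algebra.smul_def]
  rfl

theorem evalMat_map_taylor [CharZero K] {p : ℕ} [Fact p.Prime] (hp : ‖(p : K)‖ < 1) {m : ℕ}
    (A : Matrix (Fin m) (Fin n) X.H) {x y : X.points}
    (h : ‖(x : AlgebraicClosure K) - (y : AlgebraicClosure K)‖ < X.minRadius) :
    evalMat (A.map (taylor hp y))
      (toCompleted ((x : AlgebraicClosure K) - (y : AlgebraicClosure K))) =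
      A.map fun f => toCompleted (f.1 x) := by
  ext i j
  exact ((hasTaylor_taylor hp y (A i j)).2 x h).symm

/-- Transports the recursion for G_[k] to Taylor series at each z, where the formal lemmas on
matrices of series apply; in particular Y(·,z) solves the differential equation. -/
theorem exists_series_of_isTaylorSolution [CharZero K] {p : ℕ} [Fact p.Prime]
    (hp : ‖(p : K)‖ < 1) {G : Matrix (Fin n) (Fin n) X.H} {F : ℕ → Matrix (Fin n) (Fin n) X.H}
    (hG : IsTaylorSolution G F) :
    ∃ D : ℕ → Matrix (Fin n) (Fin n) X.H, D 0 = 1 ∧ X.T • D 1 = G ∧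
      (∀ k z, ((D k).map (taylor hp z)).map (PowerSeries.derivative _) =
        (D (k + 1)).map (taylor hp z) - (D k).map (taylor hp z) * (D 1).map (taylor hp z)) ∧
      (∀ k i j z, (k.factorial : CompletedClosure K) * toCompleted ((F k i j).1 z) =
        toCompleted ((D k i j).1 z)) ∧
      ∀ z, (diagSeries F z).map (PowerSeries.derivative _) =
        (D 1).map (taylor hp z) * diagSeries F z := by
  obtain ⟨D, h0, hT, hder, hFk⟩ := hG
  have h1 : ∀ k z, ((D k).map (taylor hp z)).map (PowerSeries.derivative _) =
      (D (k + 1)).map (taylor hp z) - (D k).map (taylor hp z) * (D 1).map (taylor hp z) := by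
    intro k z
    rw [← Matrix.map_mul]
    ext1 i j
    rw [Matrix.map_apply, Matrix.map_apply, derivative_taylor hp (hder k i j) z, Matrix.sub_apply,
      map_sub]
    rfl
  have h2 : ∀ k i j z, (k.factorial : CompletedClosure K) * toCompleted ((F k i j).1 z) =
      toCompleted ((D k i j).1 z) := by
    intro k i j z
    have e : F k i j = ((k.factorial : K)⁻¹) • D k i j := by rw [hFk]; rfl
    rw [e, toCompleted_smul_apply, map_inv₀, map_natCast, map_inv₀, map_natCast,
      mul_inv_cancel_left₀ (Nat.cast_ne_zero.2 k.factorial_ne_zero)]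
  refine ⟨D, h0, hT, h1, h2, fun z => ?_⟩
  refine derivative_eq_mul_of_coeff (D := fun k => (D k).map (taylor hp z)) ?_
    (fun k => h1 k z) fun k i j => ?_
  · rw [h0, Matrix.map_one _ (map_zero _) (map_one _)]
  · rw [coeff_diagSeries, h2, Matrix.map_apply, constantCoeff_taylor]

/-- The Taylor solution of a differential equation is a cocycle. -/
theorem IsCocycle.of_isTaylorSolution [CharZero K] {p : ℕ} [Fact p.Prime] (hp : ‖(p : K)‖ < 1)
    {G : Matrix (Fin n) (Fin n) X.H} {F : ℕ → Matrix (Fin n) (Fin n) X.H} {R : ℝ}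
    (hR : R ≤ X.minRadius) (hF : ConvergesOn F R) (hG : IsTaylorSolution G F) :
    IsCocycle F R := by
  obtain ⟨D, h0, -, h1, h2, h3⟩ := exists_series_of_isTaylorSolution hp hG
  refine isCocycle_of_recenter hF fun y z _ hyz i j => ?_
  -- After multiplication by k!, the left side is the k-th derivative of Y(·,z) at y, namely
  -- D_k(y)Y(y,z), and D_k = k! F_k.
  ext k
  have hk : (k.factorial : CompletedClosure K) ≠ 0 := Nat.cast_ne_zero.2 k.factorial_ne_zero
  have hyz' : ‖toCompleted ((y : AlgebraicClosure K) - (z : AlgebraicClosure K))‖ < R := by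
    rwa [norm_toCompleted]
  have hconv : IsConvMat R ((D k).map (taylor hp z)) := fun a b =>
    (hasTaylor_taylor hp z (D k a b)).1.mono hR
  have e0 : (D 0).map (taylor hp z) = 1 := by
    rw [h0, Matrix.map_one _ (map_zero _) (map_one _)]
  have e := mul_eq_iterate_derivative (h3 z) (M := fun k => (D k).map (taylor hp z))
    (fun k => h1 k z) k i j
  rw [e0, Matrix.one_mul] at e
  refine mul_left_cancel₀ hk ?_
  rw [factorial_mul_coeff_recenter, ← e]
  have e2 := congrFun (congrFun (evalMat_mul hconv (isConvMat_diagSeries hF z) hyz') i) j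
  rw [evalMat_map_taylor hp _ (hyz.trans_le hR), ← toCompleted_evalNearDiag hF hyz] at e2
  refine Eq.trans e2 ?_
  rw [Matrix.mul_apply, Matrix.mul_apply, map_sum, Finset.mul_sum]
  refine Finset.sum_congr rfl fun l _ => ?_
  rw [Matrix.map_apply, Matrix.map_apply, Matrix.map_apply, Matrix.map_apply,
    PowerSeries.coeff_mul_C, coeff_diagSeries, ← mul_assoc, h2]

/-! ## Dilations by elements close to `1` -/

theorem norm_sub_one_pow_le {L : Type*} [NormedField L] [IsUltrametricDist L] {a : L}
    (ha : ‖a - 1‖ < 1) (i : ℕ) : ‖a ^ i - 1‖ ≤ ‖a - 1‖ := by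
  have ha1 : ‖a‖ ≤ 1 := by
    have := IsUltrametricDist.norm_add_le_max (a - 1) 1
    rw [sub_add_cancel, norm_one] at this
    exact this.trans (max_le ha.le le_rfl)
  rw [← geom_sum_mul, norm_mul]
  refine mul_le_of_le_one_left (norm_nonneg _)
    (IsUltrametricDist.norm_sum_le_of_forall_le_of_nonneg zero_le_one fun j _ => ?_)
  rw [norm_pow]
  exact pow_le_one₀ (norm_nonneg _) ha1

/-- In a^p - 1 = (a - 1)∑ a^i, the sum equals p + ∑ (a^i - 1), and both parts have norm at most c.
-/
theorem norm_pow_prime_sub_one_le {L : Type*} [NormedField L] [IsUltrametricDist L]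
    {p : ℕ} {c : ℝ} (hc0 : 0 ≤ c) (hp : ‖(p : L)‖ ≤ c) {a : L}
    (ha : ‖a - 1‖ < 1) (hac : ‖a - 1‖ ≤ c) : ‖a ^ p - 1‖ ≤ c * ‖a - 1‖ := by
  rw [← geom_sum_mul, norm_mul]
  refine mul_le_mul_of_nonneg_right ?_ (norm_nonneg _)
  have e : ∑ i ∈ Finset.range p, a ^ i = p + ∑ i ∈ Finset.range p, (a ^ i - 1) := by
    rw [Finset.sum_sub_distrib]; simp
  rw [e]
  refine (IsUltrametricDist.norm_add_le_max _ _).trans (max_le hp ?_)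
  exact IsUltrametricDist.norm_sum_le_of_forall_le_of_nonneg hc0 fun j _ =>
    (norm_sub_one_pow_le ha j).trans hac

/-- Each p-th power gains a factor c < 1, so a^(p^N) tends to 1. The application takes c = max(|p|,
|q - 1|). -/
theorem norm_pow_prime_pow_sub_one_le {L : Type*} [NormedField L] [IsUltrametricDist L]
    {p : ℕ} {c : ℝ} (hc0 : 0 ≤ c) (hc1 : c < 1)
    (hp : ‖(p : L)‖ ≤ c) {a : L} (hac : ‖a - 1‖ ≤ c) (N : ℕ) :
    ‖a ^ p ^ N - 1‖ ≤ c ^ N := by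
  induction N with
  | zero => simpa using hac.trans hc1.le
  | succ N ih =>
    have h1 : ‖a ^ p ^ N - 1‖ ≤ ‖a - 1‖ := norm_sub_one_pow_le (hac.trans_lt hc1) _
    rw [pow_succ, pow_mul, pow_succ, mul_comm]
    exact (norm_pow_prime_sub_one_le hc0 hp (h1.trans_lt (hac.trans_lt hc1)) (h1.trans hac)).trans
      (mul_comm c (c ^ N) ▸ mul_le_mul_of_nonneg_left ih hc0)

theorem dilate_sub (q : X.Q) (x : X.points) :
    (X.dilate q x : AlgebraicClosure K) - (x : AlgebraicClosure K) =
      algebraMap K (AlgebraicClosure K) (((q : Kˣ) : K) - 1) * (x : AlgebraicClosure K) := by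
  rw [map_sub, map_one, sub_mul, one_mul]
  rfl

theorem dilate_mul (a b : X.Q) (x : X.points) :
    X.dilate (a * b) x = X.dilate a (X.dilate b x) := by
  refine Subtype.ext ?_
  simp only [dilate, Subgroup.coe_mul, Units.val_mul, map_mul, mul_assoc]

theorem dilate_one (x : X.points) : X.dilate 1 x = x := by
  refine Subtype.ext ?_
  simp [dilate]

theorem dilate_eq_self (q : X.Q) {x : X.points} (hx : (x : AlgebraicClosure K) = 0) :
    X.dilate q x = x := by
  refine Subtype.ext ?_
  simp [dilate, hx]

theorem norm_dilate_sub_lt {q : X.Q} {r : ℝ} (hq : ‖((q : Kˣ) : K) - 1‖ < r / X.maxAbs)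
    (x : X.points) :
    ‖(X.dilate q x : AlgebraicClosure K) - (x : AlgebraicClosure K)‖ < r := by
  rw [dilate_sub, norm_mul, norm_algebraMap_algClosure]
  rw [lt_div_iff₀ X.maxAbs_pos] at hq
  exact (mul_le_mul_of_nonneg_left (norm_point_le x) (norm_nonneg _)).trans_lt hq

/-- q^(p^N) tends to 1 without being 1, and y ≠ 0, so the orbit of y accumulates at y. This is where
infinite order of q enters. -/
theorem exists_pow_dilate_near {p : ℕ} [Fact p.Prime] (hp : ‖(p : K)‖ < 1) {q : X.Q}
    (hq : q ∈ X.Q₁) (hroot : ¬ IsOfFinOrder q) {y : X.points} (hy : (y : AlgebraicClosure K) ≠ 0)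
    {ε : ℝ} (hε : 0 < ε) : ∃ m : ℕ, X.dilate (q ^ m) y ≠ y ∧
      ‖(X.dilate (q ^ m) y : AlgebraicClosure K) - (y : AlgebraicClosure K)‖ < ε := by
  have hc1 : max ‖(p : K)‖ ‖((q : Kˣ) : K) - 1‖ < 1 := max_lt hp hq
  have hc0 : 0 ≤ max ‖(p : K)‖ ‖((q : Kˣ) : K) - 1‖ := le_max_of_le_left (norm_nonneg _)
  obtain ⟨N, hN⟩ := exists_pow_lt_of_lt_one (div_pos hε X.maxAbs_pos) hc1
  refine ⟨p ^ N, fun h => hroot ?_, norm_dilate_sub_lt ?_ y⟩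
  · refine isOfFinOrder_iff_pow_eq_one.2 ⟨p ^ N, pow_pos (Fact.out : p.Prime).pos N, ?_⟩
    have h1 := dilate_sub (q ^ p ^ N) y
    rw [h, sub_self, zero_eq_mul, or_iff_left hy, map_eq_zero, sub_eq_zero] at h1
    exact Subtype.ext (Units.ext h1)
  · refine lt_of_le_of_lt ?_ hN
    simpa using norm_pow_prime_pow_sub_one_le hc0 hc1 (le_max_left _ _) (le_max_right _ _) N

/-- The subgroup of `𝒬(X)` of all `q` with `|q - 1| < ρ`. -/
def ballSubgroup (X : Affinoid K) (ρ : ℝ) (h0 : 0 < ρ) (h1 : ρ ≤ 1) : Subgroup X.Q where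
  carrier := {q | ‖((q : Kˣ) : K) - 1‖ < ρ}
  one_mem' := by simpa using h0
  mul_mem' := by
    intro a b ha hb
    have hb1 : ‖((b : Kˣ) : K)‖ ≤ 1 := by
      have := IsUltrametricDist.norm_add_le_max (((b : Kˣ) : K) - 1) 1
      rw [sub_add_cancel, norm_one] at this
      exact this.trans (max_le (hb.le.trans h1) le_rfl)
    have e : (((a * b : X.Q) : Kˣ) : K) - 1 =
        (((a : Kˣ) : K) - 1) * ((b : Kˣ) : K) + (((b : Kˣ) : K) - 1) := by
      simp only [Subgroup.coe_mul, Units.val_mul]; ring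
    change ‖_‖ < ρ
    rw [e]
    refine (IsUltrametricDist.norm_add_le_max _ _).trans_lt (max_lt ?_ hb)
    rw [norm_mul]
    exact (mul_le_of_le_one_right (norm_nonneg _) hb1).trans_lt ha
  inv_mem' := by
    intro a ha
    have ha1 : 1 ≤ ‖((a : Kˣ) : K)‖ := by
      have := IsUltrametricDist.norm_add_le_max (((a : Kˣ) : K)) (1 - ((a : Kˣ) : K))
      rw [add_sub_cancel, norm_one, norm_sub_rev] at this
      exact (le_max_iff.1 this).resolve_right (not_le.2 (lt_of_lt_of_le ha h1))
    have e : (((a⁻¹ : X.Q) : Kˣ) : K) - 1 = -(((a : Kˣ) : K)⁻¹ * (((a : Kˣ) : K) - 1)) := by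
      rw [mul_sub, inv_mul_cancel₀ (Units.ne_zero _)]; simp
    change ‖_‖ < ρ
    rw [e, norm_neg, norm_mul, norm_inv]
    exact (mul_le_of_le_one_left (norm_nonneg _) (inv_le_one_of_one_le₀ ha1)).trans_lt ha

theorem isOpen_ballSubgroup (ρ : ℝ) (h0 : 0 < ρ) (h1 : ρ ≤ 1) :
    IsOpen (X.ballSubgroup ρ h0 h1 : Set X.Q) := by
  have : Continuous fun q : X.Q => ‖((q : Kˣ) : K) - 1‖ :=
    ((Units.continuous_val.comp continuous_subtype_val).sub continuous_const).norm
  exact this.isOpen_preimage _ isOpen_Iio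

theorem norm_pow_sub_one_lt {q : X.Q} {ρ : ℝ} (h1 : ρ ≤ 1) (hq : ‖((q : Kˣ) : K) - 1‖ < ρ)
    (m : ℕ) : ‖((q ^ m : X.Q) : Kˣ).val - 1‖ < ρ :=
  (X.ballSubgroup ρ ((norm_nonneg _).trans_lt hq) h1).pow_mem hq m

/-- A solution of `Y(q x, y) = A(q, x) Y(x, y)`, `q` not a root of unity, is a cocycle. -/
theorem IsCocycle.of_solvesSigma {p : ℕ} [Fact p.Prime] (hp : ‖(p : K)‖ < 1) {q : X.Q}
    (hq : q ∈ X.Q₁) (hroot : ¬ IsOfFinOrder q) {A : Matrix (Fin n) (Fin n) X.H}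
    {F : ℕ → Matrix (Fin n) (Fin n) X.H} {R : ℝ} (hR : R ≤ X.minRadius)
    (hqR : ‖((q : Kˣ) : K) - 1‖ < R / X.maxAbs) (hF : ConvergesOn F R) (h0 : F 0 = 1)
    (hA : SolvesSigma F R q A) : IsCocycle F R := by
  have hR1 : R / X.maxAbs ≤ 1 := (div_le_one X.maxAbs_pos).2 (hR.trans X.minRadius_le_maxAbs)
  refine isCocycle_of_recenter hF fun y z hy hyz i j => ?_
  have hR0 : 0 < R := (norm_nonneg _).trans_lt hyz
  have hyz' : ‖toCompleted ((y : AlgebraicClosure K) - (z : AlgebraicClosure K))‖ < R := by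
    rwa [norm_toCompleted]
  -- The ball around 1 is a group, so the whole orbit of y stays in the disk where the equation
  -- holds.
  have hnear : ∀ m : ℕ,
      ‖(X.dilate (q ^ m) y : AlgebraicClosure K) - (y : AlgebraicClosure K)‖ < R := fun m =>
    norm_dilate_sub_lt (norm_pow_sub_one_lt hR1 hqR m) y
  have hnearz : ∀ m : ℕ,
      ‖(X.dilate (q ^ m) y : AlgebraicClosure K) - (z : AlgebraicClosure K)‖ < R := fun m => by
    have := norm_algClosure_add_le ((X.dilate (q ^ m) y : AlgebraicClosure K) -
      (y : AlgebraicClosure K))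
      ((y : AlgebraicClosure K) - (z : AlgebraicClosure K))
    rw [sub_add_sub_cancel] at this
    exact this.trans_lt (max_lt (hnear m) hyz)
  -- Both sides are multiplied by the same A(q, q^m y) when m increases by one.
  have key : ∀ m : ℕ, evalNearDiag F (X.dilate (q ^ m) y) z =
      evalNearDiag F (X.dilate (q ^ m) y) y * evalNearDiag F y z := by
    intro m
    induction m with
    | zero => rw [pow_zero, dilate_one, evalNearDiag_self h0, Matrix.one_mul]
    | succ m ih =>
      rw [pow_succ', dilate_mul, hA _ _ (hnearz m), hA _ _ (hnear m), ih, Matrix.mul_assoc]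
  refine ((isConvMat_diagSeries hF z i j).recenter hyz').eq_of_evalPS_eq hR0
    ((isConvMat_diagSeries hF y).mul (isConvMat_map_C R _) i j) fun ε hε => ?_
  obtain ⟨m, hm, hmε⟩ := exists_pow_dilate_near hp hq hroot hy hε
  have hm' : ‖toCompleted ((X.dilate (q ^ m) y : AlgebraicClosure K) -
      (y : AlgebraicClosure K))‖ < R := by rw [norm_toCompleted]; exact hnear m
  refine ⟨toCompleted ((X.dilate (q ^ m) y : AlgebraicClosure K) - (y : AlgebraicClosure K)),
    ?_, ?_, ?_⟩
  · rw [map_ne_zero, sub_ne_zero]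
    exact fun h => hm (Subtype.ext h)
  · rwa [norm_toCompleted]
  · have e := congrArg (fun A => A.map (toCompleted (K := K))) (key m)
    simp only [Matrix.map_mul] at e
    rw [toCompleted_evalNearDiag hF (hnear m), toCompleted_evalNearDiag hF (hnearz m),
      ← evalMat_map_C ((evalNearDiag F y z).map toCompleted)
        (toCompleted ((X.dilate (q ^ m) y : AlgebraicClosure K) - (y : AlgebraicClosure K))),
      ← evalMat_mul (isConvMat_diagSeries hF y) (isConvMat_map_C R _) hm'] at e
    have e' := congrFun (congrFun e i) j
    refine Eq.trans ?_ e'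
    rw [evalPS_recenter (isConvMat_diagSeries hF z i j) hyz' hm', ← map_add]
    change _ = evalPS (diagSeries F z i j) _
    congr 2
    ring

end NearDiag

/-! ### The operators defined by a cocycle -/

section Extension

variable {K : Type u} [NontriviallyNormedField K] [IsUltrametricDist K] [CompleteSpace K]
variable {X : Affinoid K} {n : ℕ}

/-- Evaluation of analytic elements at a point. -/
def evalHom (x : X.points) : X.H →+* AlgebraicClosure K :=
  (Pi.evalRingHom (fun _ : X.points => AlgebraicClosure K) x).comp X.analytic.val.toRingHom

theorem evalHom_apply (x : X.points) (f : X.H) : evalHom x f = f.1 x := rfl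

theorem evalMatrix_injective {A B : Matrix (Fin n) (Fin n) X.H}
    (h : ∀ x, evalMatrix A x = evalMatrix B x) : A = B := by
  ext i j x
  exact congrFun (congrFun (h x) i) j

theorem evalMatrix_mul (A B : Matrix (Fin n) (Fin n) X.H) (x : X.points) :
    evalMatrix (A * B) x = evalMatrix A x * evalMatrix B x :=
  Matrix.map_mul (f := evalHom x)

theorem evalMatrix_one (x : X.points) :
    evalMatrix (1 : Matrix (Fin n) (Fin n) X.H) x = 1 :=
  Matrix.map_one (evalHom x) (map_zero _) (map_one _)

/-- Since |qx - x| ≤ |q - 1| s_X < R for all x, the series ∑ F_k(x)((q-1)x)^k converges uniformly on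
X, and its partial sums are analytic elements. -/
theorem evalNearDiag_dilate_mem_analytic {F : ℕ → Matrix (Fin n) (Fin n) X.H} {R : ℝ}
    (hF : ConvergesOn F R) (q : X.Q) (hq : ‖((q : Kˣ) : K) - 1‖ < R / X.maxAbs) (i j : Fin n) :
    (fun x => evalNearDiag F (X.dilate q x) x i j) ∈ X.analytic := by
  have hρ : ‖((q : Kˣ) : K) - 1‖ * X.maxAbs < R := (lt_div_iff₀ X.maxAbs_pos).1 hq
  have hρ0 : 0 ≤ ‖((q : Kˣ) : K) - 1‖ * X.maxAbs := mul_nonneg (norm_nonneg _) X.maxAbs_pos.le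
  refine mem_analytic_of_approx fun ε hε => ?_
  obtain ⟨N, hN⟩ := eventually_atTop.1 ((hF i j _ hρ0 hρ).eventually_lt_const hε)
  refine ⟨∑ k ∈ Finset.range N, F k i j * (algebraMap K X.H (((q : Kˣ) : K) - 1) * X.T) ^ k,
    fun x => ?_⟩
  have hx := norm_dilate_sub_lt hq x
  have hd := dilate_sub q x
  have hconv := isConvMat_diagSeries hF x i j
  set t := (X.dilate q x : AlgebraicClosure K) - (x : AlgebraicClosure K) with ht
  have ht' : ‖toCompleted t‖ < R := by rwa [norm_toCompleted]
  have htρ : ‖t‖ ≤ ‖((q : Kˣ) : K) - 1‖ * X.maxAbs := by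
    rw [hd, norm_mul, norm_algebraMap_algClosure]
    exact mul_le_mul_of_nonneg_left (norm_point_le x) (norm_nonneg _)
  have e1 : (∑ k ∈ Finset.range N, F k i j * (algebraMap K X.H (((q : Kˣ) : K) - 1) * X.T) ^ k :
      X.H).1 x = ∑ k ∈ Finset.range N, (F k i j).1 x * t ^ k := by
    rw [hd]
    exact map_sum (evalHom x) _ _
  have e2 : toCompleted (evalNearDiag F (X.dilate q x) x i j) =
      evalPS (diagSeries F x i j) (toCompleted t) :=
    congrFun (congrFun (toCompleted_evalNearDiag hF hx) i) j
  have hs := (hconv.summable ht').sum_add_tsum_nat_add N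
  rw [e1, ← norm_toCompleted, map_sub, e2, evalPS, ← hs, map_sum]
  simp only [coeff_diagSeries, map_mul, map_pow]
  rw [add_sub_cancel_left]
  refine IsUltrametricDist.norm_tsum_le_of_forall_le_of_nonneg hε.le fun k => ?_
  rw [norm_mul, norm_pow, norm_toCompleted, norm_toCompleted]
  refine le_trans ?_ (hN (k + N) (by omega)).le
  exact mul_le_mul (norm_apply_le_supNorm (F (k + N) i j) x)
    (pow_le_pow_left₀ (norm_nonneg _) htρ _) (by positivity)
    ((norm_nonneg _).trans (norm_apply_le_supNorm (F (k + N) i j) x))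

/-- The matrix `A(q, x) = Y(q x, x)`. -/
def sigmaMatrix {F : ℕ → Matrix (Fin n) (Fin n) X.H} {R : ℝ}
    (hF : ConvergesOn F R) (q : X.Q) (hq : ‖((q : Kˣ) : K) - 1‖ < R / X.maxAbs) :
    Matrix (Fin n) (Fin n) X.H :=
  fun i j => ⟨_, evalNearDiag_dilate_mem_analytic hF q hq i j⟩

variable {F : ℕ → Matrix (Fin n) (Fin n) X.H} {R : ℝ} (hF : ConvergesOn F R)

theorem evalMatrix_sigmaMatrix (q : X.Q) (hq : ‖((q : Kˣ) : K) - 1‖ < R / X.maxAbs)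
    (x : X.points) : evalMatrix (sigmaMatrix hF q hq) x = evalNearDiag F (X.dilate q x) x := rfl

theorem sigmaMatrix_one (h0 : F 0 = 1)
    (h1 : ‖(((1 : X.Q) : Kˣ) : K) - 1‖ < R / X.maxAbs) : sigmaMatrix hF 1 h1 = 1 :=
  evalMatrix_injective fun x => by
    rw [evalMatrix_sigmaMatrix, dilate_one, evalNearDiag_self h0, evalMatrix_one]

/-- The cocycle relation at the points b(ax), ax, x. Its middle point must be nonzero; at x = 0 all
the dilations are trivial. -/
theorem sigmaMatrix_mul (h0 : F 0 = 1) (hc : IsCocycle F R) {a b : X.Q}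
    (ha : ‖((a : Kˣ) : K) - 1‖ < R / X.maxAbs) (hb : ‖((b : Kˣ) : K) - 1‖ < R / X.maxAbs)
    (hab : ‖(((a * b : X.Q) : Kˣ) : K) - 1‖ < R / X.maxAbs) :
    sigmaMatrix hF (a * b) hab =
      (sigmaMatrix hF b hb).map (X.dil a) * sigmaMatrix hF a ha := by
  refine evalMatrix_injective fun x => ?_
  have e : evalMatrix ((sigmaMatrix hF b hb).map (X.dil a)) x =
      evalNearDiag F (X.dilate b (X.dilate a x)) (X.dilate a x) := rfl
  rw [evalMatrix_mul, e, evalMatrix_sigmaMatrix, evalMatrix_sigmaMatrix]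
  by_cases hx : (x : AlgebraicClosure K) = 0
  · rw [dilate_eq_self a hx, dilate_eq_self b hx, dilate_eq_self _ hx, evalNearDiag_self h0,
      Matrix.one_mul]
  · rw [mul_comm a b, dilate_mul]
    refine hc _ _ _ ?_ (norm_dilate_sub_lt hb _) (norm_dilate_sub_lt ha _)
    refine mul_ne_zero ?_ hx
    rw [map_ne_zero]
    exact Units.ne_zero _

/-- The cocycle relation at the points qx, x, y. -/
theorem solvesSigma_sigmaMatrix (h0 : F 0 = 1) (hc : IsCocycle F R) {q : X.Q}
    (hq : ‖((q : Kˣ) : K) - 1‖ < R / X.maxAbs) :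
    SolvesSigma F R q (sigmaMatrix hF q hq) := by
  intro x y hxy
  rw [evalMatrix_sigmaMatrix]
  by_cases hx : (x : AlgebraicClosure K) = 0
  · rw [dilate_eq_self q hx, evalNearDiag_self h0, Matrix.one_mul]
  · exact hc _ _ _ hx (norm_dilate_sub_lt hq _) hxy

/-- Take y = x in the functional equation: the normalised solution determines its matrix. -/
theorem sigmaMatrix_eq (h0 : F 0 = 1) {q : X.Q} (hq : ‖((q : Kˣ) : K) - 1‖ < R / X.maxAbs)
    (hR : 0 < R) {A : Matrix (Fin n) (Fin n) X.H} (hA : SolvesSigma F R q A) :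
    sigmaMatrix hF q hq = A := by
  refine evalMatrix_injective fun x => ?_
  rw [evalMatrix_sigmaMatrix, hA x x (by simpa using hR), evalNearDiag_self h0, Matrix.mul_one]

theorem dil_one (f : X.H) : X.dil 1 f = f := by
  ext x
  exact congrArg f.1 (dilate_one x)

theorem dil_mul (a b : X.Q) (f : X.H) : X.dil (a * b) f = X.dil a (X.dil b f) := by
  ext x
  exact congrArg f.1 (by rw [mul_comm, dilate_mul])

theorem dil_algebraMap (q : X.Q) (a : K) : X.dil q (algebraMap K X.H a) = algebraMap K X.H a := rfl

variable {M : Type*} [AddCommGroup M] [Module X.H M] [Module K M]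

/-- A semilinear map is determined by the images of the basis vectors. -/
theorem semilinear_ext {N : Type*} [AddCommGroup N] [Module X.H N] [Module K N]
    (e : Module.Basis (Fin n) X.H M) {q : X.Q} {φ ψ : M →ₗ[K] N}
    (hφ : ∀ (f : X.H) m, φ (f • m) = X.dil q f • φ m)
    (hψ : ∀ (f : X.H) m, ψ (f • m) = X.dil q f • ψ m) (h : ∀ i, φ (e i) = ψ (e i)) : φ = ψ := by
  ext m
  rw [← e.sum_repr m, map_sum, map_sum]
  exact Finset.sum_congr rfl fun i _ => by rw [hφ, hψ, h]

variable [IsScalarTower K X.H M] (e : Module.Basis (Fin n) X.H M)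

/-- The `σ_q`-semilinear map with matrix `A` in the basis `e`. -/
def semilinearMap (q : X.Q) (A : Matrix (Fin n) (Fin n) X.H) : M →ₗ[K] M where
  toFun m := ∑ i, X.dil q (e.repr m i) • ∑ j, A i j • e j
  map_add' m m' := by
    simp only [map_add, Finsupp.add_apply, add_smul, Finset.sum_add_distrib]
  map_smul' c m := by
    rw [RingHom.id_apply, ← algebraMap_smul X.H c m, ← algebraMap_smul X.H c, Finset.smul_sum]
    refine Finset.sum_congr rfl fun i _ => ?_
    rw [map_smul, Finsupp.smul_apply, smul_eq_mul, map_mul, dil_algebraMap, mul_smul]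

theorem semilinearMap_smul (q : X.Q) (A : Matrix (Fin n) (Fin n) X.H) (f : X.H) (m : M) :
    semilinearMap e q A (f • m) = X.dil q f • semilinearMap e q A m := by
  change ∑ i, X.dil q (e.repr (f • m) i) • ∑ j, A i j • e j =
    X.dil q f • ∑ i, X.dil q (e.repr m i) • ∑ j, A i j • e j
  rw [Finset.smul_sum]
  refine Finset.sum_congr rfl fun i _ => ?_
  rw [map_smul, Finsupp.smul_apply, smul_eq_mul, map_mul, mul_smul]

theorem semilinearMap_basis (q : X.Q) (A : Matrix (Fin n) (Fin n) X.H) (i : Fin n) :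
    semilinearMap e q A (e i) = ∑ j, A i j • e j := by
  change ∑ k, X.dil q (e.repr (e i) k) • ∑ j, A k j • e j = _
  rw [Finset.sum_eq_single i]
  · simp
  · intro k _ hk
    simp [Finsupp.single_eq_of_ne hk]
  · simp

theorem semilinearMap_one : semilinearMap e 1 (1 : Matrix (Fin n) (Fin n) X.H) = LinearMap.id := by
  refine semilinear_ext (q := 1) e (semilinearMap_smul e 1 1) (fun f m => ?_) fun i => ?_
  · rw [dil_one]; rfl
  · rw [semilinearMap_basis, Finset.sum_eq_single i]
    · simp
    · intro j _ hj
      rw [Matrix.one_apply_ne hj.symm, zero_smul]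
    · simp

/-- σ_a acts on the coefficients of σ_b(e_i), and basis vectors are indexed by rows. The resulting
order is that of `sigmaMatrix_mul`, so the cocycle relation is exactly multiplicativity. -/
theorem semilinearMap_comp (a b : X.Q) (A B : Matrix (Fin n) (Fin n) X.H) :
    semilinearMap e a A ∘ₗ semilinearMap e b B =
      semilinearMap e (a * b) (B.map (X.dil a) * A) := by
  refine semilinear_ext (q := a * b) e (fun f m => ?_) (semilinearMap_smul e _ _) fun i => ?_
  · rw [LinearMap.comp_apply, semilinearMap_smul, semilinearMap_smul, dil_mul]; rfl
  · rw [LinearMap.comp_apply, semilinearMap_basis, semilinearMap_basis, map_sum]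
    simp only [semilinearMap_smul, semilinearMap_basis, Finset.smul_sum, smul_smul]
    rw [Finset.sum_comm]
    refine Finset.sum_congr rfl fun j _ => ?_
    rw [← Finset.sum_smul]
    rfl

/-- The representation of the group of all `q` with `|q - 1| < ρ`, `ρ ≤ R / max(|c₀|, R₀)`, defined
by a cocycle. -/
def cocycleRep (h0 : F 0 = 1) (hc : IsCocycle F R) {ρ : ℝ} (hρ0 : 0 < ρ) (hρ1 : ρ ≤ 1)
    (hρ : ρ ≤ R / X.maxAbs) : X.ballSubgroup ρ hρ0 hρ1 →* Module.End K M where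
  toFun q := semilinearMap e q.1 (sigmaMatrix hF q.1 (q.2.trans_le hρ))
  map_one' := (congrArg (semilinearMap e 1) (sigmaMatrix_one hF h0
    (((1 : X.ballSubgroup ρ hρ0 hρ1).2 : ‖_‖ < ρ).trans_le hρ))).trans (semilinearMap_one e)
  map_mul' a b := by
    rw [Module.End.mul_eq_comp, semilinearMap_comp, ← sigmaMatrix_mul hF h0 hc]
    rfl

end Extension

end Affinoid

/-! ### Extension of a σ-module to a ball around 1 -/

section Extend

open Affinoid

variable {K : Type u} [NontriviallyNormedField K] [IsUltrametricDist K] [CompleteSpace K]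
variable {X : Affinoid K} {n : ℕ} {S : Set X.Q}

/-- The extension of a `σ`-module defined by a cocycle. -/
def SigmaModule.extend (M : SigmaModule X S) (e : Module.Basis (Fin n) X.H M.carrier)
    {F : ℕ → Matrix (Fin n) (Fin n) X.H} {R : ℝ} (hF : ConvergesOn F R) (h0 : F 0 = 1)
    (hc : IsCocycle F R) {ρ : ℝ} (hρ0 : 0 < ρ) (hρ1 : ρ ≤ 1) (hρ : ρ ≤ R / X.maxAbs) :
    SigmaModule X (X.ballSubgroup ρ hρ0 hρ1 : Set X.Q) where
  carrier := M.carrier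
  -- A monoid morphism out of a group takes values in units, so invertibility is automatic; the
  -- ball, being a subgroup, contains the subgroup it generates.
  sigma := (LinearMap.GeneralLinearGroup.generalLinearEquiv K M.carrier).toMonoidHom.comp
    ((cocycleRep hF e h0 hc hρ0 hρ1 hρ).toHomUnits.comp
      (Subgroup.inclusion ((Subgroup.closure_le _).2 subset_rfl)))
  semilinear q _ f m := semilinearMap_smul e q _ f m

theorem SigmaModule.extend_op (M : SigmaModule X S) (e : Module.Basis (Fin n) X.H M.carrier)
    {F : ℕ → Matrix (Fin n) (Fin n) X.H} {R : ℝ} (hF : ConvergesOn F R) (h0 : F 0 = 1)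
    (hc : IsCocycle F R) {ρ : ℝ} (hρ0 : 0 < ρ) (hρ1 : ρ ≤ 1) (hρ : ρ ≤ R / X.maxAbs) (q : X.Q)
    (hq : q ∈ (X.ballSubgroup ρ hρ0 hρ1 : Set X.Q)) (m : M.carrier) :
    (M.extend e hF h0 hc hρ0 hρ1 hρ).op q hq m =
      semilinearMap e q (sigmaMatrix hF q (lt_of_lt_of_le hq hρ)) m := rfl

theorem SigmaModule.extend_matrix (M : SigmaModule X S) (e : Module.Basis (Fin n) X.H M.carrier)
    {F : ℕ → Matrix (Fin n) (Fin n) X.H} {R : ℝ} (hF : ConvergesOn F R) (h0 : F 0 = 1)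
    (hc : IsCocycle F R) {ρ : ℝ} (hρ0 : 0 < ρ) (hρ1 : ρ ≤ 1) (hρ : ρ ≤ R / X.maxAbs) (q : X.Q)
    (hq : q ∈ (X.ballSubgroup ρ hρ0 hρ1 : Set X.Q)) :
    (M.extend e hF h0 hc hρ0 hρ1 hρ).matrix e q hq =
      sigmaMatrix hF q (lt_of_lt_of_le hq hρ) := by
  ext1 i j
  change e.repr ((M.extend e hF h0 hc hρ0 hρ1 hρ).op q hq (e i)) j = _
  rw [SigmaModule.extend_op, semilinearMap_basis]
  simp [Finsupp.single_apply]

theorem SigmaModule.op_basis (M : SigmaModule X S) (e : Module.Basis (Fin n) X.H M.carrier)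
    (q : X.Q) (hq : q ∈ S) (i : Fin n) : M.op q hq (e i) = ∑ j, M.matrix e q hq i j • e j :=
  (e.sum_repr _).symm

/-- Y determines A(q,x) as Y(qx,x), so the new operator has the same matrix as the given one, and
semilinear maps are determined on a basis. -/
theorem SigmaModule.extend_op_eq (M : SigmaModule X S) (e : Module.Basis (Fin n) X.H M.carrier)
    {F : ℕ → Matrix (Fin n) (Fin n) X.H} {R : ℝ} (hF : ConvergesOn F R) (h0 : F 0 = 1)
    (hc : IsCocycle F R) {ρ : ℝ} (hρ0 : 0 < ρ) (hρ1 : ρ ≤ 1) (hρ : ρ ≤ R / X.maxAbs) (q : X.Q)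
    (hq : q ∈ (X.ballSubgroup ρ hρ0 hρ1 : Set X.Q)) (hqS : q ∈ S)
    (hA : SolvesSigma F R q (M.matrix e q hqS)) (m : M.carrier) :
    (M.extend e hF h0 hc hρ0 hρ1 hρ).op q hq m = M.op q hqS m := by
  have hR : 0 < R := by
    have := hρ0.trans_le hρ
    rwa [lt_div_iff₀ X.maxAbs_pos, zero_mul] at this
  rw [SigmaModule.extend_op, sigmaMatrix_eq hF h0 _ hR hA]
  have key : semilinearMap e q (M.matrix e q hqS) = (M.op q hqS).toLinearMap :=
    semilinear_ext e (semilinearMap_smul e q _) (M.semilinear q hqS) fun i => by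
      rw [semilinearMap_basis]
      exact (M.op_basis e q hqS i).symm
  rw [key]
  rfl

end Extend

open Affinoid

/-! ### Morphisms intertwine solutions -/

section Intertwine

variable {K : Type u} [NontriviallyNormedField K] [IsUltrametricDist K] [CompleteSpace K]
variable {X : Affinoid K} {m n : ℕ}

/-- `P(x) Y'(x, y) = Y(x, y) P(y)` for `|x - y| < R`, `y ≠ 0`. -/
def Intertwines (P : Matrix (Fin m) (Fin n) X.H) (F : ℕ → Matrix (Fin m) (Fin m) X.H)
    (F' : ℕ → Matrix (Fin n) (Fin n) X.H) (R : ℝ) : Prop :=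
  ∀ x y : X.points, (y : AlgebraicClosure K) ≠ 0 →
    ‖(x : AlgebraicClosure K) - (y : AlgebraicClosure K)‖ < R →
    P.map (evalHom x) * evalNearDiag F' x y = evalNearDiag F x y * P.map (evalHom y)

theorem IsTaylorSolution.apply_zero {G : Matrix (Fin n) (Fin n) X.H}
    {F : ℕ → Matrix (Fin n) (Fin n) X.H} (h : IsTaylorSolution G F) : F 0 = 1 := by
  obtain ⟨D, h0, -, -, hF⟩ := h
  rw [hF 0, h0]
  simp

variable {p : ℕ} [Fact p.Prime] [CharZero K]

/-- Both sides of the intertwining relation are values at x - y of convergent matrices of series, so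
the relation can be proved on those series at y. -/
theorem evalMat_intertwine (hp : ‖(p : K)‖ < 1) {P : Matrix (Fin m) (Fin n) X.H}
    {F : ℕ → Matrix (Fin m) (Fin m) X.H} {F' : ℕ → Matrix (Fin n) (Fin n) X.H} {R : ℝ}
    (hR : R ≤ X.minRadius) (hF : ConvergesOn F R) (hF' : ConvergesOn F' R) {x y : X.points}
    (hxy : ‖(x : AlgebraicClosure K) - (y : AlgebraicClosure K)‖ < R) :
    evalMat (P.map (taylor hp y) * diagSeries F' y)
        (toCompleted ((x : AlgebraicClosure K) - (y : AlgebraicClosure K))) =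
      (P.map (evalHom x) * evalNearDiag F' x y).map toCompleted ∧
    evalMat (diagSeries F y * ((P.map (evalHom y)).map toCompleted).map PowerSeries.C)
        (toCompleted ((x : AlgebraicClosure K) - (y : AlgebraicClosure K))) =
      (evalNearDiag F x y * P.map (evalHom y)).map toCompleted := by
  have hxy' : ‖toCompleted ((x : AlgebraicClosure K) - (y : AlgebraicClosure K))‖ < R := by
    rwa [norm_toCompleted]
  have hconv : IsConvMat R (P.map (taylor hp y)) := fun a b =>
    (hasTaylor_taylor hp y (P a b)).1.mono hR
  constructor
  · rw [evalMat_mul hconv (isConvMat_diagSeries hF' y) hxy',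
      evalMat_map_taylor hp _ (hxy.trans_le hR), ← toCompleted_evalNearDiag hF' hxy,
      Matrix.map_mul, Matrix.map_map]
    rfl
  · rw [evalMat_mul (isConvMat_diagSeries hF y) (isConvMat_map_C R _) hxy', evalMat_map_C,
      ← toCompleted_evalNearDiag hF hxy, Matrix.map_mul]

theorem intertwines_of_series (hp : ‖(p : K)‖ < 1) {P : Matrix (Fin m) (Fin n) X.H}
    {F : ℕ → Matrix (Fin m) (Fin m) X.H} {F' : ℕ → Matrix (Fin n) (Fin n) X.H} {R : ℝ}
    (hR : R ≤ X.minRadius) (hF : ConvergesOn F R) (hF' : ConvergesOn F' R)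
    (h : ∀ y : X.points, (y : AlgebraicClosure K) ≠ 0 → 0 < R →
      P.map (taylor hp y) * diagSeries F' y =
        diagSeries F y * ((P.map (evalHom y)).map toCompleted).map PowerSeries.C) :
    Intertwines P F F' R := by
  intro x y hy hxy
  obtain ⟨h1, h2⟩ := evalMat_intertwine hp (P := P) hR hF hF' hxy
  refine Matrix.map_injective toCompleted_injective ?_
  change (P.map (evalHom x) * evalNearDiag F' x y).map toCompleted =
    (evalNearDiag F x y * P.map (evalHom y)).map toCompleted
  rw [← h1, ← h2, h y hy ((norm_nonneg _).trans_lt hxy)]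

/-- A matrix commuting with `σ_q`, `q` not a root of unity, intertwines the solutions. -/
theorem Intertwines.of_solvesSigma (hp : ‖(p : K)‖ < 1) {q : X.Q} (hq : q ∈ X.Q₁)
    (hroot : ¬ IsOfFinOrder q) {P : Matrix (Fin m) (Fin n) X.H}
    {F : ℕ → Matrix (Fin m) (Fin m) X.H} {F' : ℕ → Matrix (Fin n) (Fin n) X.H} {R : ℝ}
    (hR : R ≤ X.minRadius) (hqR : ‖((q : Kˣ) : K) - 1‖ < R / X.maxAbs) (hF : ConvergesOn F R)
    (hF' : ConvergesOn F' R) (h0 : F 0 = 1) (h0' : F' 0 = 1) {A : Matrix (Fin m) (Fin m) X.H}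
    {B : Matrix (Fin n) (Fin n) X.H} (hA : SolvesSigma F R q A) (hB : SolvesSigma F' R q B)
    (hP : A * P = P.map (X.dil q) * B) : Intertwines P F F' R := by
  have hR1 : R / X.maxAbs ≤ 1 := (div_le_one X.maxAbs_pos).2 (hR.trans X.minRadius_le_maxAbs)
  refine intertwines_of_series hp hR hF hF' fun y hy hR0 => ?_
  have hnear : ∀ m : ℕ,
      ‖(X.dilate (q ^ m) y : AlgebraicClosure K) - (y : AlgebraicClosure K)‖ < R := fun m =>
    norm_dilate_sub_lt (norm_pow_sub_one_lt hR1 hqR m) y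
  have hPx : ∀ x : X.points, P.map (evalHom (X.dilate q x)) * evalMatrix B x =
      evalMatrix A x * P.map (evalHom x) := by
    intro x
    have := congrArg (fun C => C.map (evalHom x)) hP
    simp only [Matrix.map_mul, Matrix.map_map] at this
    exact this.symm
  -- Commutation with σ_q propagates the relation from q^m y to q^(m+1) y; it is trivial at y
  -- itself.
  have key : ∀ m : ℕ, P.map (evalHom (X.dilate (q ^ m) y)) *
      evalNearDiag F' (X.dilate (q ^ m) y) y =
      evalNearDiag F (X.dilate (q ^ m) y) y * P.map (evalHom y) := by
    intro m
    induction m with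
    | zero =>
      rw [pow_zero, dilate_one, evalNearDiag_self h0, evalNearDiag_self h0', Matrix.one_mul,
        Matrix.mul_one]
    | succ m ih =>
      rw [pow_succ', dilate_mul, hA _ _ (hnear m), hB _ _ (hnear m), ← Matrix.mul_assoc, hPx,
        Matrix.mul_assoc, ih, Matrix.mul_assoc]
  have hconv : IsConvMat R (P.map (taylor hp y)) := fun a b =>
    (hasTaylor_taylor hp y (P a b)).1.mono hR
  ext1 i j
  refine (hconv.mul (isConvMat_diagSeries hF' y) i j).eq_of_evalPS_eq hR0
    ((isConvMat_diagSeries hF y).mul (isConvMat_map_C R _) i j) fun ε hε => ?_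
  obtain ⟨N, hN, hNε⟩ := exists_pow_dilate_near hp hq hroot hy hε
  obtain ⟨h1, h2⟩ := evalMat_intertwine hp (P := P) hR hF hF' (hnear N)
  refine ⟨toCompleted ((X.dilate (q ^ N) y : AlgebraicClosure K) - (y : AlgebraicClosure K)),
    ?_, ?_, ?_⟩
  · rw [map_ne_zero, sub_ne_zero]
    exact fun h => hN (Subtype.ext h)
  · rwa [norm_toCompleted]
  · rw [key N, ← h2] at h1
    exact congrFun (congrFun h1 i) j

/-- A matrix commuting with the connections intertwines the Taylor solutions. -/
theorem Intertwines.of_isTaylorSolution (hp : ‖(p : K)‖ < 1) {P P' : Matrix (Fin m) (Fin n) X.H}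
    {F : ℕ → Matrix (Fin m) (Fin m) X.H} {F' : ℕ → Matrix (Fin n) (Fin n) X.H} {R : ℝ}
    (hR : R ≤ X.minRadius) (hF : ConvergesOn F R) (hF' : ConvergesOn F' R)
    {G : Matrix (Fin m) (Fin m) X.H} {G' : Matrix (Fin n) (Fin n) X.H}
    (hG : IsTaylorSolution G F) (hG' : IsTaylorSolution G' F')
    (hP' : ∀ i j, X.IsDeriv (P i j) (P' i j)) (hP : G * P = X.T • P' + P * G') :
    Intertwines P F F' R := by
  have h0' := hG'.apply_zero
  obtain ⟨D, h0, hT, h1, h2, -⟩ := exists_series_of_isTaylorSolution hp hG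
  obtain ⟨D', -, hT', -, -, h3⟩ := exists_series_of_isTaylorSolution hp hG'
  -- The hypothesis is this relation multiplied by T. It can be cancelled away from 0, which
  -- suffices for analytic elements.
  have hD : D 1 * P = P' + P * D' 1 := by
    rw [← sub_eq_zero]
    have hz : X.T • (D 1 * P - (P' + P * D' 1)) = 0 := by
      rw [smul_sub, smul_add, ← Matrix.smul_mul, hT, ← Matrix.mul_smul, hT', hP, sub_self]
    ext1 i j
    refine eq_zero_of_apply_eq_zero hp _ fun x hx => ?_
    have e : (x : AlgebraicClosure K) * ((D 1 * P - (P' + P * D' 1)) i j).1 x = 0 :=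
      congrArg (evalHom x) (congrFun (congrFun hz i) j)
    exact (mul_eq_zero.1 e).resolve_left hx
  refine intertwines_of_series hp hR hF hF' fun y hy _ => ?_
  have hdP : (P.map (taylor hp y)).map (PowerSeries.derivative _) =
      (D 1).map (taylor hp y) * P.map (taylor hp y) -
        P.map (taylor hp y) * (D' 1).map (taylor hp y) := by
    rw [← Matrix.map_mul, ← Matrix.map_mul, hD]
    ext1 i j
    rw [Matrix.map_apply, Matrix.map_apply, derivative_taylor hp (hP' i j) y, Matrix.sub_apply,
      Matrix.map_apply, Matrix.map_apply, Matrix.add_apply, map_add, add_sub_cancel_right]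
  -- D_k P obeys the recursion relative to the target connection, so the k-th derivative of P Y' is
  -- D_k P Y', with value D_k(y)P(y) = k! F_k(y)P(y) at y.
  have hM : ∀ k, ((D k).map (taylor hp y) * P.map (taylor hp y)).map (PowerSeries.derivative _) =
      (D (k + 1)).map (taylor hp y) * P.map (taylor hp y) -
        (D k).map (taylor hp y) * P.map (taylor hp y) * (D' 1).map (taylor hp y) := by
    intro k
    ext1 i j
    rw [Matrix.map_apply, derivative_mul_apply, h1, hdP]
    rw [Matrix.sub_mul, Matrix.mul_sub, Matrix.mul_assoc, Matrix.mul_assoc, sub_add_sub_cancel]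
  ext i j k
  have hk : (k.factorial : CompletedClosure K) ≠ 0 := Nat.cast_ne_zero.2 k.factorial_ne_zero
  have e0 : (D 0).map (taylor hp y) = 1 := by
    rw [h0, Matrix.map_one _ (map_zero _) (map_one _)]
  have e := mul_eq_iterate_derivative (h3 y)
    (M := fun k => (D k).map (taylor hp y) * P.map (taylor hp y)) hM k i j
  simp only [e0, Matrix.one_mul] at e
  refine mul_left_cancel₀ hk ?_
  rw [← PowerSeries.constantCoeff_iterate_derivative, ← e]
  have hY0 : (diagSeries F' y).map PowerSeries.constantCoeff = 1 := by
    ext1 a b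
    rw [Matrix.map_apply, ← PowerSeries.coeff_zero_eq_constantCoeff_apply, coeff_diagSeries, h0',
      Matrix.one_apply, Matrix.one_apply]
    split_ifs
    · exact map_one toCompleted
    · exact map_zero toCompleted
  have e3 := congrFun (congrFun (Matrix.map_mul (L := (D k).map (taylor hp y) * P.map (taylor hp y))
    (M := diagSeries F' y) (f := PowerSeries.constantCoeff)) i) j
  rw [hY0, Matrix.mul_one] at e3
  refine Eq.trans e3 ?_
  rw [Matrix.map_mul, Matrix.mul_apply, Matrix.mul_apply, map_sum, Finset.mul_sum]
  refine Finset.sum_congr rfl fun l _ => ?_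
  simp only [Matrix.map_apply]
  rw [PowerSeries.coeff_mul_C, coeff_diagSeries, ← mul_assoc, h2, constantCoeff_taylor,
    constantCoeff_taylor, evalHom_apply]

end Intertwine

/-! ### Matrices of morphisms -/

section Morphisms

variable {K : Type u} [NontriviallyNormedField K] [IsUltrametricDist K] [CompleteSpace K]
variable {X : Affinoid K} {m n : ℕ} {S S' : Set X.Q}

/-- The matrix of a linear map. -/
def linMatrix {M N : Type*} [AddCommGroup M] [Module X.H M] [AddCommGroup N] [Module X.H N]
    (e : Module.Basis (Fin m) X.H M) (e' : Module.Basis (Fin n) X.H N) (φ : M →ₗ[X.H] N) :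
    Matrix (Fin m) (Fin n) X.H :=
  fun i j => e'.repr (φ (e i)) j

theorem sum_linMatrix {M N : Type*} [AddCommGroup M] [Module X.H M] [AddCommGroup N]
    [Module X.H N] (e : Module.Basis (Fin m) X.H M) (e' : Module.Basis (Fin n) X.H N)
    (φ : M →ₗ[X.H] N) (i : Fin m) : φ (e i) = ∑ j, linMatrix e e' φ i j • e' j :=
  (e'.sum_repr _).symm

theorem repr_sum_smul {N : Type*} [AddCommGroup N] [Module X.H N]
    (e' : Module.Basis (Fin n) X.H N) (c : Fin n → X.H) (k : Fin n) :
    e'.repr (∑ j, c j • e' j) k = c k := by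
  rw [e'.repr_sum_self]

theorem sum_smul_sum {N : Type*} [AddCommGroup N] [Module X.H N]
    (e' : Module.Basis (Fin n) X.H N) (A : Matrix (Fin m) (Fin m) X.H)
    (B : Matrix (Fin m) (Fin n) X.H) (i : Fin m) :
    ∑ j, A i j • ∑ k, B j k • e' k = ∑ k, (A * B) i k • e' k := by
  simp only [Finset.smul_sum, smul_smul, Matrix.mul_apply, Finset.sum_smul]
  exact Finset.sum_comm

theorem lin_op_basis (M : SigmaModule X S) (N : SigmaModule X S')
    (e : Module.Basis (Fin m) X.H M.carrier) (e' : Module.Basis (Fin n) X.H N.carrier)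
    (φ : M.carrier →ₗ[X.H] N.carrier) {q : X.Q} (hq : q ∈ S) (i : Fin m) :
    φ (M.op q hq (e i)) = ∑ k, (M.matrix e q hq * linMatrix e e' φ) i k • e' k := by
  rw [M.op_basis e, map_sum, ← sum_smul_sum]
  exact Finset.sum_congr rfl fun j _ => by rw [map_smul, sum_linMatrix e e']

theorem op_lin_basis (M : SigmaModule X S) (N : SigmaModule X S')
    (e : Module.Basis (Fin m) X.H M.carrier) (e' : Module.Basis (Fin n) X.H N.carrier)
    (φ : M.carrier →ₗ[X.H] N.carrier) {q : X.Q} (hq : q ∈ S') (i : Fin m) :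
    N.op q hq (φ (e i)) =
      ∑ k, ((linMatrix e e' φ).map (X.dil q) * N.matrix e' q hq) i k • e' k := by
  rw [sum_linMatrix e e', map_sum]
  simp only [Matrix.mul_apply, Finset.sum_smul]
  rw [Finset.sum_comm]
  refine Finset.sum_congr rfl fun j _ => ?_
  refine (N.semilinear q hq _ _).trans ?_
  change X.dil q _ • N.op q hq (e' j) = _
  rw [N.op_basis e', Finset.smul_sum]
  exact Finset.sum_congr rfl fun k _ => by rw [smul_smul, Matrix.map_apply]

theorem matrix_mul_linMatrix (M : SigmaModule X S) (N : SigmaModule X S')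
    (e : Module.Basis (Fin m) X.H M.carrier) (e' : Module.Basis (Fin n) X.H N.carrier)
    (φ : M.carrier →ₗ[X.H] N.carrier) {q : X.Q} (hq : q ∈ S) (hq' : q ∈ S')
    (h : ∀ v, φ (M.op q hq v) = N.op q hq' (φ v)) :
    M.matrix e q hq * linMatrix e e' φ = (linMatrix e e' φ).map (X.dil q) * N.matrix e' q hq' := by
  ext1 i k
  rw [← repr_sum_smul e' (fun k => (M.matrix e q hq * linMatrix e e' φ) i k) k,
    ← lin_op_basis M N, h, op_lin_basis M N e e', repr_sum_smul]

/-- A linear map whose matrix intertwines the solutions commutes with the operators `σ_q`. -/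
theorem Intertwines.comm {p : ℕ} [Fact p.Prime] [CharZero K] (hp : ‖(p : K)‖ < 1)
    (M : SigmaModule X S) (N : SigmaModule X S')
    (e : Module.Basis (Fin m) X.H M.carrier) (e' : Module.Basis (Fin n) X.H N.carrier)
    (φ : M.carrier →ₗ[X.H] N.carrier) {F : ℕ → Matrix (Fin m) (Fin m) X.H}
    {F' : ℕ → Matrix (Fin n) (Fin n) X.H} {R : ℝ} (h0 : F 0 = 1) (h0' : F' 0 = 1)
    (hP : Intertwines (linMatrix e e' φ) F F' R) {q : X.Q} (hq : q ∈ S) (hq' : q ∈ S')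
    (hqR : ‖((q : Kˣ) : K) - 1‖ < R / X.maxAbs) (hA : SolvesSigma F R q (M.matrix e q hq))
    (hB : SolvesSigma F' R q (N.matrix e' q hq')) (v : M.carrier) :
    φ (M.op q hq v) = N.op q hq' (φ v) := by
  have hR : 0 < R := by
    have := (norm_nonneg _).trans_lt hqR
    rwa [lt_div_iff₀ X.maxAbs_pos, zero_mul] at this
  have key : M.matrix e q hq * linMatrix e e' φ =
      (linMatrix e e' φ).map (X.dil q) * N.matrix e' q hq' := by
    rw [← sub_eq_zero]
    ext1 i j
    refine eq_zero_of_apply_eq_zero hp _ fun x hx => ?_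
    have hself : ‖(x : AlgebraicClosure K) - (x : AlgebraicClosure K)‖ < R := by simpa using hR
    -- Intertwining between qx and x, where Y(qx,x) and Y'(qx,x) are the matrices of σ_q on the two
    -- modules, is the commutation relation at x.
    have h1 := hP _ x hx (norm_dilate_sub_lt hqR x)
    rw [hA x x hself, hB x x hself, evalNearDiag_self h0, evalNearDiag_self h0', Matrix.mul_one,
      Matrix.mul_one] at h1
    have h2 : (M.matrix e q hq * linMatrix e e' φ -
        (linMatrix e e' φ).map (X.dil q) * N.matrix e' q hq').map (evalHom x) = 0 := by
      rw [Matrix.map_sub _ (map_sub _), Matrix.map_mul, Matrix.map_mul, sub_eq_zero]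
      exact h1.symm
    exact congrFun (congrFun h2 i) j
  have h := semilinear_ext (q := q) e
    (φ := (φ.restrictScalars K) ∘ₗ (M.op q hq).toLinearMap)
    (ψ := (N.op q hq').toLinearMap ∘ₗ (φ.restrictScalars K))
    (fun f v => ?_) (fun f v => ?_) fun i => ?_
  · exact LinearMap.congr_fun h v
  · exact (congrArg φ (M.semilinear q hq f v)).trans (map_smul φ _ _)
  · exact (congrArg (N.op q hq') (map_smul φ f v)).trans (N.semilinear q hq' f _)
  · change φ (M.op q hq (e i)) = N.op q hq' (φ (e i))
    rw [lin_op_basis M N e e', op_lin_basis M N e e', key]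

/-- The term T P' comes from the Leibniz rule applied to the coefficients of φ(e_i), which is why
the derivative of P must exist in ℋ_K(X). -/
theorem deltaMatrix_mul_linMatrix (M : SigmaDeltaModule X S) (N : SigmaDeltaModule X S')
    (e : Module.Basis (Fin m) X.H M.carrier) (e' : Module.Basis (Fin n) X.H N.carrier)
    (φ : M.carrier →ₗ[X.H] N.carrier) {P' : Matrix (Fin m) (Fin n) X.H}
    (hP' : ∀ i j, X.IsDeriv (linMatrix e e' φ i j) (P' i j))
    (h : ∀ v, φ (M.delta v) = N.delta (φ v)) :
    M.deltaMatrix e * linMatrix e e' φ = X.T • P' + linMatrix e e' φ * N.deltaMatrix e' := by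
  have hM : ∀ i, M.delta (e i) = ∑ j, M.deltaMatrix e i j • e j := fun i => (e.sum_repr _).symm
  have hN : ∀ i, N.delta (e' i) = ∑ j, N.deltaMatrix e' i j • e' j := fun i => (e'.sum_repr _).symm
  have h1 : ∀ i, φ (M.delta (e i)) =
      ∑ k, (M.deltaMatrix e * linMatrix e e' φ) i k • e' k := by
    intro i
    rw [hM, map_sum, ← sum_smul_sum]
    exact Finset.sum_congr rfl fun j _ => by rw [map_smul, sum_linMatrix e e']
  have h2 : ∀ i, N.delta (φ (e i)) =
      ∑ k, (X.T • P' + linMatrix e e' φ * N.deltaMatrix e') i k • e' k := by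
    intro i
    rw [sum_linMatrix e e', map_sum]
    simp only [Matrix.add_apply, add_smul, Finset.sum_add_distrib, Matrix.mul_apply,
      Finset.sum_smul]
    rw [Finset.sum_comm (s := Finset.univ) (t := Finset.univ)
      (f := fun k j => (linMatrix e e' φ i j * N.deltaMatrix e' j k) • e' k),
      ← Finset.sum_add_distrib]
    refine Finset.sum_congr rfl fun j _ => ?_
    rw [N.leibniz _ _ (hP' i j), hN, Finset.smul_sum]
    simp only [smul_smul]
    rfl
  ext1 i k
  rw [← repr_sum_smul e' (fun k => (M.deltaMatrix e * linMatrix e e' φ) i k) k, ← h1, h, h2,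
    repr_sum_smul]

end Morphisms

open Affinoid

/-! ### Fullness, faithfulness and essential surjectivity -/

section Equivalence

variable {K : Type u} [NontriviallyNormedField K] [IsUltrametricDist K] [CompleteSpace K]
variable {X : Affinoid K} {n : ℕ}

theorem ConvergesOn.mono {F : ℕ → Matrix (Fin n) (Fin n) X.H} {R R' : ℝ} (h : ConvergesOn F R)
    (hR : R' ≤ R) : ConvergesOn F R' := fun i j ρ h0 h1 => h i j ρ h0 (h1.trans_le hR)

theorem SolvesSigma.mono {F : ℕ → Matrix (Fin n) (Fin n) X.H} {R R' : ℝ} {q : X.Q}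
    {A : Matrix (Fin n) (Fin n) X.H} (h : SolvesSigma F R q A) (hR : R' ≤ R) :
    SolvesSigma F R' q A := fun x y hxy => h x y (hxy.trans_le hR)

theorem lt_min_div {a R R' : ℝ} {c : ℝ} (hc : 0 < c) (h : a < R / c) (h' : a < R' / c) :
    a < min R R' / c := by
  rw [lt_div_iff₀ hc] at h h' ⊢
  exact lt_min h h'

/-- Commutation with σ_q alone makes the matrix intertwine the two solutions, hence commute with
σ_q' for every q' where both modules are defined; the smaller of the two radii serves for both. -/
theorem sigmaRes_full [CharZero K] {p : ℕ} [Fact p.Prime] (hp : ‖(p : K)‖ < 1) {q : X.Q}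
    (hq : q ∈ X.Q₁) (hroot : ¬ IsOfFinOrder q) : (sigmaRes X q hroot).Full := by
  refine ⟨fun {A B} f => ?_⟩
  obtain ⟨r, hr, -, -, hA1, R, n, e, F, hrR, hRX, hF, h0, hA⟩ := A.M.property
  obtain ⟨r', hr', -, -, hB1, R', n', e', F', hrR', hRX', hF', h0', hB⟩ := B.M.property
  have hball : ∀ q' ∈ A.U ∩ B.U, ‖((q' : Kˣ) : K) - 1‖ < min R R' / X.maxAbs := fun q' h =>
    lt_min_div X.maxAbs_pos
      ((hA1 q' h.1).trans_le (div_le_div_of_nonneg_right hrR X.maxAbs_pos.le))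
      ((hB1 q' h.2).trans_le (div_le_div_of_nonneg_right hrR' X.maxAbs_pos.le))
  have hmin : min R R' ≤ X.minRadius := (min_le_left _ _).trans hRX
  let φ : A.M.obj.carrier →ₗ[X.H] B.M.obj.carrier := f.hom.lin
  have hφ : ∀ v, φ (A.M.obj.op q A.mem v) = B.M.obj.op q B.mem (φ v) :=
    f.hom.comm q (Set.mem_singleton q)
  have hint : Intertwines (linMatrix e e' φ) F F' (min R R') :=
    Intertwines.of_solvesSigma hp hq hroot hmin (hball q ⟨A.mem, B.mem⟩)
      (hF.mono (min_le_left _ _)) (hF'.mono (min_le_right _ _)) h0 h0'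
      ((hA q A.mem).mono (min_le_left _ _)) ((hB q B.mem).mono (min_le_right _ _))
      (matrix_mul_linMatrix _ _ e e' φ A.mem B.mem hφ)
  exact ⟨⟨φ, A.U ∩ B.U, Set.inter_subset_left, Set.inter_subset_right, A.isOpen.inter B.isOpen,
    ⟨A.mem, B.mem⟩, fun q' h v => hint.comm hp _ _ e e' φ h0 h0' h.1 h.2 (hball q' h)
      ((hA q' h.1).mono (min_le_left _ _)) ((hB q' h.2).mono (min_le_right _ _)) v⟩, rfl⟩

theorem sigmaRes_faithful (q : X.Q) (hroot : ¬ IsOfFinOrder q) :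
    (sigmaRes X q hroot).Faithful := by
  refine ⟨fun {A B} f g h => SigmaStalk.Hom.ext ?_⟩
  exact congrArg (fun f => f.hom.lin) h

/-- The module is extended to the ball of radius r/s_X by its own solution Y, which also witnesses
admissibility; the isomorphism is the identity map. -/
theorem sigmaRes_essSurj {p : ℕ} [Fact p.Prime] (hp : ‖(p : K)‖ < 1) {q : X.Q}
    (hq : q ∈ X.Q₁) (hroot : ¬ IsOfFinOrder q) : (sigmaRes X q hroot).EssSurj := by
  refine ⟨fun N => ?_⟩
  obtain ⟨r, hr, hS, -, hr1, R, n, e, F, hrR, hRX, hF, h0, hA⟩ := N.property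
  have hqr := hr1 q (Set.mem_singleton q)
  -- Positivity of r is forced by q lying in the ball.
  have hρ0 : 0 < r / X.maxAbs := (norm_nonneg _).trans_lt hqr
  have hρ1 : r / X.maxAbs ≤ 1 := (div_le_one X.maxAbs_pos).2 (hr.trans X.minRadius_le_maxAbs)
  have hρ : r / X.maxAbs ≤ R / X.maxAbs := div_le_div_of_nonneg_right hrR X.maxAbs_pos.le
  have hc : IsCocycle F R := IsCocycle.of_solvesSigma hp hq hroot hRX (hqr.trans_le hρ) hF h0
    (hA q (Set.mem_singleton q))
  have hadm : SigmaModule.isTaylorAdmissible X _ (N.obj.extend e hF h0 hc hρ0 hρ1 hρ) := by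
    refine ⟨r, hr, fun q' h => lt_of_lt_of_le h hρ1, ⟨q, hqr, hroot⟩, fun q' h => h, R, n, e, F,
      hrR, hRX, hF, h0, fun q' h => ?_⟩
    rw [SigmaModule.extend_matrix]
    exact solvesSigma_sigmaMatrix hF h0 hc _
  refine ⟨⟨_, isOpen_ballSubgroup _ hρ0 hρ1, hqr, ⟨_, hadm⟩⟩,
    ⟨ObjectProperty.isoMk _ ⟨?_, ?_, ?_, ?_⟩⟩⟩
  · exact ⟨LinearMap.id, fun q' h m => by
      obtain rfl : q' = q := h
      exact N.obj.extend_op_eq e hF h0 hc hρ0 hρ1 hρ _ hqr (Set.mem_singleton _)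
        (hA _ (Set.mem_singleton _)) m⟩
  · exact ⟨LinearMap.id, fun q' h m => by
      obtain rfl : q' = q := h
      exact (N.obj.extend_op_eq e hF h0 hc hρ0 hρ1 hρ _ hqr (Set.mem_singleton _)
        (hA _ (Set.mem_singleton _)) m).symm⟩
  · rfl
  · rfl

/-- Commutation with the connection already gives the intertwining relation, so q may be a root of
unity. -/
theorem sigmaDeltaRes_full [CharZero K] {p : ℕ} [Fact p.Prime] (hp : ‖(p : K)‖ < 1) (q : X.Q) :
    (sigmaDeltaRes X q).Full := by
  refine ⟨fun {A B} f => ?_⟩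
  obtain ⟨r, hr, -, hA1, R, n, e, F, hrR, hRX, hG, hF, hA⟩ := A.M.property
  obtain ⟨r', hr', -, hB1, R', n', e', F', hrR', hRX', hG', hF', hB⟩ := B.M.property
  have hball : ∀ q' ∈ A.U ∩ B.U, ‖((q' : Kˣ) : K) - 1‖ < min R R' / X.maxAbs := fun q' h =>
    lt_min_div X.maxAbs_pos
      ((hA1 q' h.1).trans_le (div_le_div_of_nonneg_right hrR X.maxAbs_pos.le))
      ((hB1 q' h.2).trans_le (div_le_div_of_nonneg_right hrR' X.maxAbs_pos.le))
  have hmin : min R R' ≤ X.minRadius := (min_le_left _ _).trans hRX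
  let φ : A.M.obj.carrier →ₗ[X.H] B.M.obj.carrier := f.hom.lin
  have hφ : ∀ v, φ (A.M.obj.delta v) = B.M.obj.delta (φ v) := f.hom.comm_delta
  -- The Leibniz rule applies only to elements with a derivative in ℋ_K(X), whence the need for
  -- `exists_isDeriv`.
  choose P' hP' using fun i j => exists_isDeriv hp (linMatrix e e' φ i j)
  have hint : Intertwines (linMatrix e e' φ) F F' (min R R') :=
    Intertwines.of_isTaylorSolution hp hmin (hF.mono (min_le_left _ _))
      (hF'.mono (min_le_right _ _)) hG hG' hP'
      (deltaMatrix_mul_linMatrix A.M.obj B.M.obj e e' φ hP' hφ)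
  exact ⟨⟨φ, ⟨A.U ∩ B.U, Set.inter_subset_left, Set.inter_subset_right, A.isOpen.inter B.isOpen,
    ⟨A.mem, B.mem⟩, fun q' h v => hint.comm hp _ _ e e' φ hG.apply_zero hG'.apply_zero h.1 h.2
      (hball q' h) ((hA q' h.1).mono (min_le_left _ _)) ((hB q' h.2).mono (min_le_right _ _)) v⟩,
    hφ⟩, rfl⟩

theorem sigmaDeltaRes_faithful (q : X.Q) : (sigmaDeltaRes X q).Faithful := by
  refine ⟨fun {A B} f g h => SigmaDeltaStalk.Hom.ext ?_⟩
  exact congrArg (fun f => f.hom.lin) h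

/-- The cocycle relation comes from the differential equation; the connection is kept unchanged
while the σ-structure is extended to the ball. -/
theorem sigmaDeltaRes_essSurj [CharZero K] {p : ℕ} [Fact p.Prime] (hp : ‖(p : K)‖ < 1) (q : X.Q) :
    (sigmaDeltaRes X q).EssSurj := by
  refine ⟨fun N => ?_⟩
  obtain ⟨r, hr, hS, hr1, R, n, e, F, hrR, hRX, hG, hF, hA⟩ := N.property
  have h0 := hG.apply_zero
  have hqr := hr1 q (Set.mem_singleton q)
  have hρ0 : 0 < r / X.maxAbs := (norm_nonneg _).trans_lt hqr
  have hρ1 : r / X.maxAbs ≤ 1 := (div_le_one X.maxAbs_pos).2 (hr.trans X.minRadius_le_maxAbs)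
  have hρ : r / X.maxAbs ≤ R / X.maxAbs := div_le_div_of_nonneg_right hrR X.maxAbs_pos.le
  have hc : IsCocycle F R := IsCocycle.of_isTaylorSolution hp hRX hF hG
  let N' : SigmaDeltaModule X (X.ballSubgroup _ hρ0 hρ1 : Set X.Q) :=
    { N.obj.toSigmaModule.extend e hF h0 hc hρ0 hρ1 hρ with
      delta := N.obj.delta
      leibniz := N.obj.leibniz }
  have hadm : SigmaDeltaModule.isTaylorAdmissible X _ N' := by
    refine ⟨r, hr, fun q' h => lt_of_lt_of_le h hρ1, fun q' h => h, R, n, e, F,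
      hrR, hRX, hG, hF, fun q' h => ?_⟩
    change SolvesSigma F R q' ((N.obj.toSigmaModule.extend e hF h0 hc hρ0 hρ1 hρ).matrix e q' h)
    rw [SigmaModule.extend_matrix]
    exact solvesSigma_sigmaMatrix hF h0 hc _
  refine ⟨⟨_, isOpen_ballSubgroup _ hρ0 hρ1, hqr, ⟨_, hadm⟩⟩,
    ⟨ObjectProperty.isoMk _ ⟨?_, ?_, ?_, ?_⟩⟩⟩
  · exact ⟨LinearMap.id, fun q' h m => by
      obtain rfl : q' = q := h
      exact N.obj.toSigmaModule.extend_op_eq e hF h0 hc hρ0 hρ1 hρ _ hqr (Set.mem_singleton _)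
        (hA _ (Set.mem_singleton _)) m,
      fun _ => rfl⟩
  · exact ⟨LinearMap.id, fun q' h m => by
      obtain rfl : q' = q := h
      exact (N.obj.toSigmaModule.extend_op_eq e hF h0 hc hρ0 hρ1 hρ _ hqr (Set.mem_singleton _)
        (hA _ (Set.mem_singleton _)) m).symm,
      fun _ => rfl⟩
  · rfl
  · rfl

end Equivalence

end QDiff

end

theorem mainTheorem2 {K : Type u} [NontriviallyNormedField K] [IsUltrametricDist K]
    [CompleteSpace K] [CharZero K] (p : ℕ) [Fact p.Prime] (hp : ‖(p : K)‖ < 1)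
    (X : QDiff.Affinoid K) (q : X.Q) (hq : q ∈ X.Q₁) :
    (∀ hroot : ¬ IsOfFinOrder q, (QDiff.sigmaRes X q hroot).IsEquivalence) ∧
      (QDiff.sigmaDeltaRes X q).IsEquivalence :=
  ⟨fun hroot =>
    { faithful := QDiff.sigmaRes_faithful q hroot
      full := QDiff.sigmaRes_full hp hq hroot
      essSurj := QDiff.sigmaRes_essSurj hp hq hroot },
    { faithful := QDiff.sigmaDeltaRes_faithful q
      full := QDiff.sigmaDeltaRes_full hp q
      essSurj := QDiff.sigmaDeltaRes_essSurj hp q }⟩
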